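/- \textbf{Setting.} Fix $d\in\mathbb N$. A \emph{combinatorial type} $\pi$ of an interval exchange with $d$ bands consists of a horizontal interval, thickened to a top and a bottom copy, and $d$ labelled untwisted bands; each band has two ends, and the $2d$ ends are attached to the two copies in a given left-to-right order on each copy. Given widths $\lambda=(\lambda_\alpha)\in\mathbb R_{\ge 0}^d$ of the bands, the \emph{switch condition} says that the total width of the ends on the top equals the total width of the ends on the bottom. The type $\pi$ is \emph{non-classical} if the associated one-vertex train track is recurrent (the switch condition has a strictly positive solution) and the thickened interval with bands embeds in an oriented surface of non-positive Euler characteristic as a complete train track, i.e. every complementary region is an ideal triangle or a once-punctured monogon. Equivalently to the last condition, every boundary circle of the thickened interval with bands has exactly three or exactly one cusps, where cusps occur between neighbouring ends on the same copy of the interval. The \emph{configuration space} of $\pi$ is $W_\pi=\{\lambda\in\mathbb R_{\ge0}^d:\ \sum_\alpha\lambda_\alpha=1,\ \lambda \text{ satisfies the switch condition of } \pi\}$; it carries $(d-2)$-dimensional Lebesgue measure. \textbf{Splits.} Let $\alpha_1,\alpha_0$ be the bands with the rightmost ends on the top and on the bottom. If $\lambda_{\alpha_1}>\lambda_{\alpha_0}$,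 then $\alpha_1$ \emph{splits} $\alpha_0$ (Rauzy induction): the rightmost bottom end is detached and re-attached next to the other end of $\alpha_1$, immediately to its right if that end is on the bottom and immediately to its left if it is on the top; the new widths $\lambda'$ are given by $\lambda=E\lambda'$ with $E=I+M_{\alpha_1\alpha_0}$, where $M_{\alpha\beta}$ has entry $1$ at $(\alpha,\beta)$ and $0$ elsewhere. If $\lambda_{\alpha_0}>\lambda_{\alpha_1}$, the same is done with top and bottom exchanged. The \emph{reduced Rauzy diagram} $G$ has as vertices the non-classical combinatorial types with $d$ bands up to relabelling, and as arrows the splits between them. A \emph{sink} of $G$ is a set of vertices that no arrow leaves and in which any vertex is joined to any vertex by a directed path of positive length. A \emph{finite splitting sequence} starting from $\pi_0$ is a finite directed path of splits in $G$ starting at $\pi_0$. \textbf{Expansions.} For $\mathbf x\in W_{\pi_0}$, iterating Rauzy induction as long as it is defined gives stages $\pi_0=\pi_{\mathbf x,0}\to\pi_{\mathbf x,1}\to\cdots$, elementary matrices $E_{\mathbf x,1},E_{\mathbf x,2},\dots$ and $Q_{\mathbf x,n}=E_{\mathbf x,1}\cdots E_{\mathbf x,n}$. If this never stops, it is the infinite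 expansion of $\mathbf x$. For $C>1$ the stage $\pi_{\mathbf x,n}$ is \emph{$C$-distributed} if any two columns $u,v$ of $Q_{\mathbf x,n}$ satisfy $1/C<|u|/|v|<C$, where $|y|=\sum_i|y_i|$. A finite splitting sequence $\jmath$ starting from $\pi_0$ \emph{immediately follows} the stage $\pi_{\mathbf x,n}$ if $\pi_{\mathbf x,n}$ is, up to relabelling, the type $\pi_0$ and the expansion of $\mathbf x$ after $\pi_{\mathbf x,n}$ begins with $\jmath$. \textbf{Theorem (Strong Normality).} For every $d$ there is a constant $C>1$, depending only on $d$, such that for every non-classical combinatorial type $\pi_0$ with $d$ bands that lies in a sink of the reduced Rauzy diagram, the following holds for Lebesgue-almost every $\mathbf x\in W_{\pi_0}$: $\mathbf x$ has an infinite expansion, and for every finite splitting sequence $\jmath$ starting from $\pi_0$ there are infinitely many $n$ such that the stage $\pi_{\mathbf x,n}$ is $C$-distributed and is immediately followed by $\jmath$. -/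

import Mathlib

/-!
Interval exchanges with bands (an interval thickened to a top and a bottom copy, with `d` bands
of uniform width attached to the two copies), Rauzy induction, the reduced Rauzy diagram, and the
expansion of a point of the parameter space.
-/

namespace BandExchange

/-- The two copies of the thickened interval. -/
inductive Side
  | top
  | bot
  deriving DecidableEq

/-- The opposite copy of the interval. -/
def Side.opp : Side → Side
  | .top => .bot
  | .bot => .top

/-- The band with label `α : Fin d` has the two ends `(α, false)` and `(α, true)`. -/
abbrev BandEnd (d : ℕ) := Fin d × Bool

/-- The other end of the same band. -/
def otherEnd {d : ℕ} (a : BandEnd d) : BandEnd d := (a.1, !a.2)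

/-- A combinatorial type of an interval exchange with `d` bands: the band ends attached to the top
and to the bottom copy of the interval, listed from left to right; every end of every band is
attached exactly once. -/
structure Pattern (d : ℕ) where
  word : Side → List (BandEnd d)
  nodup : (word .top ++ word .bot).Nodup
  mem : ∀ a : BandEnd d, a ∈ word .top ++ word .bot

/-- The total width of the band ends attached to one side, when the bands have widths `w`. -/
def Pattern.total {d : ℕ} (π : Pattern d) (w : Fin d → ℝ) (s : Side) : ℝ :=
  ((π.word s).map fun a => w a.1).sum

/-- The switch condition: the bands fill the same length on the top and on the bottom. (Bands
running from top to bottom cancel, so this says that the total width of the orientation reversing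
bands on the top equals the total width of those on the bottom.) -/
def Pattern.SwitchCondition {d : ℕ} (π : Pattern d) (w : Fin d → ℝ) : Prop :=
  π.total w .top = π.total w .bot

/-- The associated train track is recurrent: it carries strictly positive weights. -/
def Pattern.IsRecurrent {d : ℕ} (π : Pattern d) : Prop :=
  ∃ w : Fin d → ℝ, (∀ α, 0 < w α) ∧ π.SwitchCondition w

/-- The left or the right edge of a band end, as seen in the picture. -/
inductive Hand
  | left
  | right
  deriving DecidableEq

/-- The opposite edge. -/
def Hand.opp : Hand → Hand
  | .left => .right
  | .right => .left

/-- `a` and `b` are neighbours on the side `s`, with `a` immediately to the left of `b`. The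
associated train track has a cusp between them. -/
def Pattern.Neighbours {d : ℕ} (π : Pattern d) (s : Side) (a b : BandEnd d) : Prop :=
  [a, b] <:+: π.word s

/-- Consecutive pieces of the boundary of the thickened interval with (untwisted) bands, each
piece being the left or right edge of a band near one of the two ends of the band.

* `preserving`, `reversing`: one follows an edge of a band from one end of the band to the other.
  A band that joins the top to the bottom is glued by a translation, a band that has both ends on
  the same side is glued by a rotation through a half-turn;
* `cusp`: between neighbouring ends on the same side the boundary makes a cusp;
* `leftEnd`, `rightEnd`: around the two ends of the interval the boundary is smooth. -/
inductive Pattern.BoundaryStep {d : ℕ} (π : Pattern d) :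
    BandEnd d × Hand → BandEnd d × Hand → Prop
  | preserving (s : Side) (a : BandEnd d) (h : Hand) :
      a ∈ π.word s → otherEnd a ∈ π.word s.opp → BoundaryStep π (a, h) (otherEnd a, h)
  | reversing (s : Side) (a : BandEnd d) (h : Hand) :
      a ∈ π.word s → otherEnd a ∈ π.word s → BoundaryStep π (a, h) (otherEnd a, h.opp)
  | cusp (s : Side) (a b : BandEnd d) :
      π.Neighbours s a b → BoundaryStep π (a, .right) (b, .left)
  | leftEnd (a b : BandEnd d) :
      (π.word .top).head? = some a → (π.word .bot).head? = some b →
      BoundaryStep π (a, .left) (b, .left)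
  | rightEnd (a b : BandEnd d) :
      (π.word .top).getLast? = some a → (π.word .bot).getLast? = some b →
      BoundaryStep π (a, .right) (b, .right)

/-- Two boundary pieces lie on the same boundary circle of the thickened interval with bands. -/
def Pattern.SameCircle {d : ℕ} (π : Pattern d) : BandEnd d × Hand → BandEnd d × Hand → Prop :=
  Relation.EqvGen π.BoundaryStep

/-- The number of cusps on the boundary circle through `g`; a cusp is recorded by the band end on
its left. -/
noncomputable def Pattern.cuspCount {d : ℕ} (π : Pattern d) (g : BandEnd d × Hand) : ℕ :=
  {a : BandEnd d | (∃ s b, π.Neighbours s a b) ∧ π.SameCircle (a, .right) g}.ncard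

/-- The thickened interval with bands embeds in an oriented surface as a complete train track,
i.e. with every complementary region an ideal triangle or a once-punctured monogon: each boundary
circle has exactly three cusps (and is filled by a triangle) or exactly one cusp (and is filled by
a once-punctured monogon). The resulting surface has Euler characteristic
`1 - d + #triangles`, which is automatically nonpositive as `3 * #triangles ≤ 2 * d - 2`. -/
def Pattern.IsComplete {d : ℕ} (π : Pattern d) : Prop :=
  ∀ g : BandEnd d × Hand, π.cuspCount g = 1 ∨ π.cuspCount g = 3

/-- Combinatorial types of non-classical interval exchanges with `d` bands. -/
def NonClassical (d : ℕ) : Type := {π : Pattern d // π.IsRecurrent ∧ π.IsComplete}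

/-- The same combinatorial type up to the names of the bands and of their ends. -/
def SameType {d : ℕ} (π π' : NonClassical d) : Prop :=
  ∃ φ : Equiv.Perm (BandEnd d), (∀ a, φ (otherEnd a) = otherEnd (φ a)) ∧
    ∀ s, π'.1.word s = (π.1.word s).map φ

/-- Equality of unlabelled combinatorial types, as an equivalence relation. -/
def typeSetoid (d : ℕ) : Setoid (NonClassical d) where
  r := SameType
  iseqv :=
    { refl := fun π => ⟨Equiv.refl _, fun _ => rfl, fun s => by simp⟩
      symm := by
        rintro π π' ⟨φ, h₁, h₂⟩
        refine ⟨φ.symm, fun a => ?_, fun s => ?_⟩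
        · rw [Equiv.symm_apply_eq, h₁, Equiv.apply_symm_apply]
        · rw [h₂ s]; simp
      trans := by
        rintro π π' π'' ⟨φ, h₁, h₂⟩ ⟨ψ, k₁, k₂⟩
        refine ⟨φ.trans ψ, fun a => ?_, fun s => ?_⟩
        · simp [h₁, k₁]
        · rw [k₂ s, h₂ s]; simp }

/-- Rauzy induction, combinatorially. `IsSplit π s a b π'`: the rightmost end `a` on the side `s`
belongs to the wider of the two critical bands, `b` is the rightmost end on the opposite side, the
band of `a` splits the band of `b`, and `π'` is the outcome. The end `b` slides along the band of
`a` and is attached next to its other end: on the opposite side immediately to the right of it if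
the band of `a` joins the two sides, and on the side `s` immediately to the left of it if the band
of `a` has both ends on `s`. -/
inductive IsSplit {d : ℕ} (π : Pattern d) (s : Side) (a b : BandEnd d) (π' : Pattern d) : Prop
  | preserving (u v₁ v₂ : List (BandEnd d)) :
      π.word s = u ++ [a] →
      π.word s.opp = v₁ ++ [otherEnd a] ++ v₂ ++ [b] →
      π'.word s = u ++ [a] →
      π'.word s.opp = v₁ ++ [otherEnd a, b] ++ v₂ →
      IsSplit π s a b π'
  | reversing (u₁ u₂ v : List (BandEnd d)) :
      π.word s = u₁ ++ [otherEnd a] ++ u₂ ++ [a] →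
      π.word s.opp = v ++ [b] →
      π'.word s = u₁ ++ [b, otherEnd a] ++ u₂ ++ [a] →
      π'.word s.opp = v →
      IsSplit π s a b π'

/-- The nodes of the reduced Rauzy diagram: unlabelled combinatorial types of non-classical
interval exchanges with `d` bands. -/
def ReducedType (d : ℕ) : Type := Quotient (typeSetoid d)

/-- The unlabelled type of a labelled one. -/
def NonClassical.reduced {d : ℕ} (π : NonClassical d) : ReducedType d :=
  Quotient.mk (typeSetoid d) π

/-- The arrows of the reduced Rauzy diagram. -/
def Arrow {d : ℕ} (v v' : ReducedType d) : Prop :=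
  ∃ (π π' : NonClassical d) (s : Side) (a b : BandEnd d),
    π.reduced = v ∧ π'.reduced = v' ∧ IsSplit π.1 s a b π'.1

/-- A sink of the reduced Rauzy diagram: a strongly connected piece (any vertex is joined to any
vertex by a directed path of positive length) that no arrow leaves. -/
def IsSink {d : ℕ} (G₀ : Set (ReducedType d)) : Prop :=
  (∀ v ∈ G₀, ∀ v' ∈ G₀, Relation.TransGen Arrow v v') ∧
    ∀ v ∈ G₀, ∀ v', Arrow v v' → v' ∈ G₀

/-- The configuration space: normalized widths (nonnegative, of sum one) that satisfy the switch
condition. -/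
def NonClassical.configSpace {d : ℕ} (π : NonClassical d) : Set (EuclideanSpace ℝ (Fin d)) :=
  {x | (∀ α, 0 ≤ x α) ∧ ∑ α, x α = 1 ∧ π.1.SwitchCondition fun α => x α}

/-- The `(d - 2)`-dimensional volume on the configuration space (not normalized, which does not
change its null sets). -/
noncomputable def NonClassical.volume {d : ℕ} (π : NonClassical d) :
    MeasureTheory.Measure (EuclideanSpace ℝ (Fin d)) :=
  (MeasureTheory.Measure.hausdorffMeasure ((d : ℝ) - 2)).restrict π.configSpace

/-- The elementary matrix `I + M_{αβ}` of the split in which band `α` splits band `β`. -/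
def splitMatrix {d : ℕ} (α β : Fin d) : Matrix (Fin d) (Fin d) ℝ := 1 + Matrix.single α β 1

/-- A finite splitting sequence starting from `π₀`: a directed path of `length` splits between
non-classical interval exchanges (only the values of `stage` at indices `≤ length` and of `side`
at indices `< length` matter). -/
structure SplittingSequence {d : ℕ} (π₀ : NonClassical d) where
  length : ℕ
  stage : ℕ → NonClassical d
  side : ℕ → Side
  stage_zero : stage 0 = π₀
  isSplit : ∀ i < length, ∃ a b, IsSplit (stage i).1 (side i) a b (stage (i + 1)).1

/-- The infinite expansion of `x` by iterated Rauzy induction from `π₀`: in the `n`-th split the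
critical band with end `winner n` on the side `side n` is strictly wider than the critical band
with end `loser n` on the opposite side and splits it; `width n` are the actual widths. -/
structure Expansion {d : ℕ} (π₀ : NonClassical d) (x : EuclideanSpace ℝ (Fin d)) where
  stage : ℕ → NonClassical d
  side : ℕ → Side
  winner : ℕ → BandEnd d
  loser : ℕ → BandEnd d
  width : ℕ → Fin d → ℝ
  stage_zero : stage 0 = π₀
  width_zero : ∀ α, width 0 α = x α
  isSplit : ∀ n, IsSplit (stage n).1 (side n) (winner n) (loser n) (stage (n + 1)).1
  loser_lt_winner : ∀ n, width n (loser n).1 < width n (winner n).1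
  width_eq : ∀ n,
    width n = (splitMatrix (winner n).1 (loser n).1).mulVec (width (n + 1))

/-- The matrix `Q_n = E_1 E_2 ⋯ E_n` of the `n`-th stage of an expansion. -/
def Expansion.matrix {d : ℕ} {π₀ : NonClassical d} {x : EuclideanSpace ℝ (Fin d)}
    (e : Expansion π₀ x) : ℕ → Matrix (Fin d) (Fin d) ℝ
  | 0 => 1
  | n + 1 => e.matrix n * splitMatrix (e.winner n).1 (e.loser n).1

/-- The norm `|y| = ∑ |y_i|`. -/
def oneNorm {d : ℕ} (y : Fin d → ℝ) : ℝ := ∑ i, |y i|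

/-- A family of vectors is `C`-distributed if all ratios of norms lie strictly between `1 / C` and
`C`. -/
def CDistributed {d : ℕ} {ι : Type*} (C : ℝ) (u : ι → Fin d → ℝ) : Prop :=
  ∀ i j, 1 / C < oneNorm (u i) / oneNorm (u j) ∧ oneNorm (u i) / oneNorm (u j) < C

/-- The `n`-th stage of an expansion is `C`-distributed: the columns of its matrix are. -/
def Expansion.StageDistributed {d : ℕ} {π₀ : NonClassical d} {x : EuclideanSpace ℝ (Fin d)}
    (e : Expansion π₀ x) (C : ℝ) (n : ℕ) : Prop :=
  CDistributed C fun α : Fin d => (e.matrix n).col α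

/-- The expansion after its `n`-th stage begins with the splitting sequence `j`: it runs through
the same arrows and vertices of the reduced Rauzy diagram. In particular the `n`-th stage is
combinatorially the same as the start of `j`. -/
def Expansion.FollowedBy {d : ℕ} {π₀ : NonClassical d} {x : EuclideanSpace ℝ (Fin d)}
    (e : Expansion π₀ x) (n : ℕ) (j : SplittingSequence π₀) : Prop :=
  (∀ i ≤ j.length, (e.stage (n + i)).reduced = (j.stage i).reduced) ∧
    ∀ i < j.length, e.side (n + i) = j.side i

end BandExchange

/-! A split is linear in the widths, so the proof follows stages (type, `norm`, `width`), where
`norm`, started at the all-ones vector, lists the column sums of `Q_n`. On the hyperplane of the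
switch condition, `stageVolume π q` is the volume restricted to generic widths `x` with `q ⬝ᵥ x ≤
1`. A split is given by a matrix of determinant one, and it changes `q` so that `q ⬝ᵥ x` is kept.
Hence, conditioned on the first `n` sides, the stage after them is distributed like a fresh start
with the new type and the new norms (`stageVolume_agree`). The probability of a finite path is
therefore a quotient of two volumes.

Up to a factor depending on `d`, the volume of `x ≥ 0`, `q ⬝ᵥ x ≤ 1` in the hyperplane is `minRev`
divided by the product of the weights `hat`. The weight of a band is the least `q ⬝ᵥ x` over
nonnegative `x` in the hyperplane giving that band width one (`hyperVolume_body_le`,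
`le_hyperVolume_body`). The weights and `minRev` never decrease under splits, so a path on which
every weight grows by at most a factor `K` has probability at least a constant times `K⁻ᵈ`
(`Good.le_stageVolume_agree`).

The main estimate says, by induction on `k`, that almost surely the weights of `k` bands are
comparable with the largest weight infinitely often (`frequently_balanced`). Let `S` be such a set
of `k` bands. With probability bounded below some band outside `S` becomes critical
(`exists_balancedOpen`). Stop when some weight first exceeds `R` times the old maximum `M`. If no
band outside `S` has become heavy by then, every winner so far lies outside `S`, so adding `R * M`
to the norms on `S` at the start amounts to adding it at the end. At the start this divides the
volume by about `R ^ k`. At the end it costs only about `R ^ (k - 1)`, since one weight in `S` is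
already that large. Summing over all such paths bounds their probability by a constant over `R`,
hence by one half for large `R` (`exists_balanced_succ`).

For `k = d` all weights are comparable, so every path of bounded length has probability bounded
below. Choose one that first has a positive matrix and reaches the type `π₀`, which makes the norms
comparable with a constant independent of `j`, and then runs through `j`. A conditional
Borel–Cantelli argument (`frequently_of_frequently`) yields infinitely many occurrences.

The combinatorial input is that every band is critical infinitely often and all widths tend to zero
(`Good.frequently_isCritical`). Bands that stop being critical would occupy an initial block of both
words. By genericity this block or the complementary one would consist only of bands joining top to
bottom, and a parity count of cusps excludes this in a complete pattern
(`IsComplete.no_classical_prefix`). Finally, the exceptional set is a cone, so Fubini and scaling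
carry nullity from the hyperplane to the configuration space (`NonClassical.ae_volume_of_cone`). -/

namespace BandExchange

/-! ### The switch condition as a linear functional, and determinism of splits -/

variable {d : ℕ}

@[simp] theorem otherEnd_otherEnd (a : BandEnd d) : otherEnd (otherEnd a) = a := by
  simp [otherEnd]

theorem otherEnd_ne (a : BandEnd d) : otherEnd a ≠ a := by
  intro h
  have := congrArg Prod.snd h
  simp [otherEnd] at this

theorem eq_or_eq_otherEnd {a b : BandEnd d} (h : a.1 = b.1) : a = b ∨ a = otherEnd b := by
  rcases a with ⟨a, x⟩; rcases b with ⟨b, y⟩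
  simp only at h
  subst h
  cases x <;> cases y <;> simp [otherEnd]

@[simp] theorem Side.opp_opp (s : Side) : s.opp.opp = s := by cases s <;> rfl

theorem Side.eq_or_eq_opp (s t : Side) : t = s ∨ t = s.opp := by
  cases s <;> cases t <;> simp [Side.opp]

@[simp] theorem Hand.opp_opp (h : Hand) : h.opp.opp = h := by cases h <;> rfl

namespace Pattern

theorem ext_word {π π' : Pattern d} (h : ∀ s, π.word s = π'.word s) : π = π' := by
  cases π; cases π'
  simp only [mk.injEq]
  exact funext h

theorem nodup_word (π : Pattern d) (s : Side) : (π.word s).Nodup := by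
  have h := List.nodup_append.1 π.nodup
  cases s
  · exact h.1
  · exact h.2.1

theorem mem_or (π : Pattern d) (s : Side) (a : BandEnd d) : a ∈ π.word s ∨ a ∈ π.word s.opp := by
  have h := List.mem_append.1 (π.mem a)
  cases s
  · exact h
  · exact h.symm

theorem notMem_opp (π : Pattern d) {s : Side} {a : BandEnd d} (ha : a ∈ π.word s) :
    a ∉ π.word s.opp := by
  have h := (List.nodup_append.1 π.nodup).2.2
  intro hb
  cases s
  · exact h a ha a hb rfl
  · exact h a hb a ha rfl

theorem side_unique (π : Pattern d) {s t : Side} {a : BandEnd d} (ha : a ∈ π.word s)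
    (hb : a ∈ π.word t) : t = s := by
  rcases s.eq_or_eq_opp t with h | h
  · exact h
  · subst h; exact absurd hb (π.notMem_opp ha)

/-- The indicator of the ends attached to the top. -/
def topInd (π : Pattern d) (a : BandEnd d) : ℤ := by
  classical exact if a ∈ π.word .top then 1 else 0

/-- Half of the coefficient of a band in the switch condition: `1` for a band with both ends on
the top, `-1` for a band with both ends on the bottom, and `0` otherwise. -/
def sgn (π : Pattern d) (α : Fin d) : ℤ := π.topInd (α, false) + π.topInd (α, true) - 1

/-- The real version of `sgn`. -/
def coef (π : Pattern d) (α : Fin d) : ℝ := (π.sgn α : ℝ)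

theorem topInd_of_top {π : Pattern d} {a : BandEnd d} (h : a ∈ π.word .top) : π.topInd a = 1 := by
  simp [topInd, h]

theorem topInd_of_bot {π : Pattern d} {a : BandEnd d} (h : a ∈ π.word .bot) : π.topInd a = 0 := by
  have : a ∉ π.word .top := π.notMem_opp (s := .bot) h
  simp [topInd, this]

theorem sgn_eq (π : Pattern d) (a : BandEnd d) :
    π.sgn a.1 = π.topInd a + π.topInd (otherEnd a) - 1 := by
  rcases a with ⟨a, x⟩
  cases x <;> simp [sgn, otherEnd, add_comm]

theorem sgn_of_preserving {π : Pattern d} {s : Side} {a : BandEnd d} (ha : a ∈ π.word s)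
    (hb : otherEnd a ∈ π.word s.opp) : π.sgn a.1 = 0 := by
  rw [sgn_eq]
  cases s
  · rw [topInd_of_top ha, topInd_of_bot hb]; rfl
  · rw [topInd_of_bot ha, topInd_of_top hb]; rfl

theorem sgn_of_top {π : Pattern d} {a : BandEnd d} (ha : a ∈ π.word .top)
    (hb : otherEnd a ∈ π.word .top) : π.sgn a.1 = 1 := by
  rw [sgn_eq, topInd_of_top ha, topInd_of_top hb]; rfl

theorem sgn_of_bot {π : Pattern d} {a : BandEnd d} (ha : a ∈ π.word .bot)
    (hb : otherEnd a ∈ π.word .bot) : π.sgn a.1 = -1 := by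
  rw [sgn_eq, topInd_of_bot ha, topInd_of_bot hb]; rfl

theorem preserving_of_sgn {π : Pattern d} {s : Side} {a : BandEnd d} (h : π.sgn a.1 = 0)
    (ha : a ∈ π.word s) : otherEnd a ∈ π.word s.opp := by
  rcases π.mem_or s (otherEnd a) with hb | hb
  · cases s
    · rw [sgn_of_top ha hb] at h; simp at h
    · rw [sgn_of_bot ha hb] at h; simp at h
  · exact hb

theorem sgn_mem (π : Pattern d) (α : Fin d) : π.sgn α = 0 ∨ π.sgn α = 1 ∨ π.sgn α = -1 := by
  unfold sgn topInd
  split_ifs <;> simp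

theorem coef_mem (π : Pattern d) (α : Fin d) : π.coef α = 0 ∨ π.coef α = 1 ∨ π.coef α = -1 := by
  rcases π.sgn_mem α with h | h | h <;> simp [coef, h]

theorem total_eq_sum (π : Pattern d) (w : Fin d → ℝ) (s : Side) :
    π.total w s = ∑ a ∈ (π.word s).toFinset, w a.1 := by
  rw [List.sum_toFinset _ (π.nodup_word s)]
  rfl

/-- A band from top to bottom cancels in the difference, and a band with both ends on one side is
counted twice; hence the factor 2 and coefficients in {0, 1, -1}. -/
theorem total_sub_total (π : Pattern d) (w : Fin d → ℝ) :
    π.total w .top - π.total w .bot = 2 * ∑ α, π.coef α * w α := by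
  classical
  have h1 : π.total w .top = ∑ a : BandEnd d, (π.topInd a : ℝ) * w a.1 := by
    rw [total_eq_sum, ← Finset.sum_subset (Finset.subset_univ (π.word .top).toFinset)]
    · refine Finset.sum_congr rfl fun a ha => ?_
      rw [topInd_of_top (List.mem_toFinset.1 ha)]; simp
    · intro a _ ha
      rw [List.mem_toFinset] at ha
      simp [topInd, ha]
  have h2 : π.total w .bot = ∑ a : BandEnd d, (1 - π.topInd a : ℝ) * w a.1 := by
    rw [total_eq_sum, ← Finset.sum_subset (Finset.subset_univ (π.word .bot).toFinset)]
    · refine Finset.sum_congr rfl fun a ha => ?_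
      rw [topInd_of_bot (List.mem_toFinset.1 ha)]; simp
    · intro a _ ha
      rw [List.mem_toFinset] at ha
      rw [topInd_of_top ((π.mem_or .top a).resolve_right ha)]; simp
  rw [h1, h2, ← Finset.sum_sub_distrib, Fintype.sum_prod_type, Finset.mul_sum]
  refine Finset.sum_congr rfl fun α _ => ?_
  simp only [Fintype.sum_bool, coef, sgn]
  push_cast
  ring

theorem switchCondition_iff (π : Pattern d) (w : Fin d → ℝ) :
    π.SwitchCondition w ↔ π.coef ⬝ᵥ w = 0 := by
  have h := π.total_sub_total w
  unfold SwitchCondition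
  rw [← sub_eq_zero, h]
  simp [dotProduct]

/-- Two patterns whose sides are related by permutations have the same coefficients. -/
theorem topInd_congr {π π' : Pattern d} {a : BandEnd d}
    (h : a ∈ π'.word .top ↔ a ∈ π.word .top) : π'.topInd a = π.topInd a := by
  simp [topInd, h]

end Pattern

namespace IsSplit

variable {π π' : Pattern d} {s : Side} {a b : BandEnd d}

theorem last_left (h : IsSplit π s a b π') : (π.word s).getLast? = some a := by
  cases h with
  | preserving u v₁ v₂ h1 h2 h3 h4 => simp [h1]
  | reversing u₁ u₂ v h1 h2 h3 h4 => rw [h1, List.getLast?_concat]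

theorem last_right (h : IsSplit π s a b π') : (π.word s.opp).getLast? = some b := by
  cases h with
  | preserving u v₁ v₂ h1 h2 h3 h4 => rw [h2, List.getLast?_concat]
  | reversing u₁ u₂ v h1 h2 h3 h4 => rw [h2, List.getLast?_concat]

theorem mem_left (h : IsSplit π s a b π') : a ∈ π.word s :=
  List.mem_of_getLast? h.last_left

theorem mem_right (h : IsSplit π s a b π') : b ∈ π.word s.opp :=
  List.mem_of_getLast? h.last_right

/-- Only the end `b` can change sides, and it does so exactly when the band of `a` has both ends on
`s`. The coefficients thus transform by the transpose of the split matrix, dually to the widths. -/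
theorem sgn_eq (h : IsSplit π s a b π') (γ : Fin d) :
    π'.sgn γ = π.sgn γ + if γ = b.1 then π.sgn a.1 else 0 := by
  have ha := h.mem_left
  have hb := h.mem_right
  have key : ∀ e, π'.topInd e = π.topInd e + if e = b then π.sgn a.1 else 0 := by
    intro e
    cases h with
    | preserving u v₁ v₂ h1 h2 h3 h4 =>
      have h0 : π.sgn a.1 = 0 := Pattern.sgn_of_preserving ha (by rw [h2]; simp)
      rw [h0]
      simp only [ite_self, add_zero]
      refine Pattern.topInd_congr ?_
      cases s
      · rw [h3, h1]
      · simp only [Side.opp] at h2 h4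
        rw [h4, h2]; simp; tauto
    | reversing u₁ u₂ v h1 h2 h3 h4 =>
      have ho : otherEnd a ∈ π.word s := by rw [h1]; simp
      have hb' : b ∈ π'.word s := by rw [h3]; simp
      by_cases e1 : e = b
      · subst e1
        simp only [if_true]
        cases s
        · rw [Pattern.sgn_of_top ha ho, Pattern.topInd_of_top hb', Pattern.topInd_of_bot hb]; rfl
        · rw [Pattern.sgn_of_bot ha ho, Pattern.topInd_of_bot hb', Pattern.topInd_of_top hb]; rfl
      · simp only [e1, if_false, add_zero]
        refine Pattern.topInd_congr ?_
        cases s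
        · rw [h3, h1]; simp [e1]
        · simp only [Side.opp] at h2 h4
          rw [h4, h2]; simp [e1]
  unfold Pattern.sgn
  rw [key, key]
  rcases b with ⟨β, x⟩
  by_cases e : γ = β
  · subst e; cases x <;> simp [Pattern.sgn] <;> ring
  · simp [e]

theorem coef_eq (h : IsSplit π s a b π') (γ : Fin d) :
    π'.coef γ = π.coef γ + if γ = b.1 then π.coef a.1 else 0 := by
  unfold Pattern.coef
  rw [h.sgn_eq]
  push_cast
  split_ifs <;> simp

/-- Words have no repetitions, so the decomposition around `otherEnd a` is unique, and its side
decides which of the two kinds of split occurs. -/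
theorem eq_of_eq {π'' : Pattern d} {a₂ b₂ : BandEnd d} (h : IsSplit π s a b π')
    (h₂ : IsSplit π s a₂ b₂ π'') : a₂ = a ∧ b₂ = b ∧ π'' = π' := by
  have ea : a₂ = a := by
    have := h.last_left.symm.trans h₂.last_left
    simpa using this.symm
  have eb : b₂ = b := by
    have := h.last_right.symm.trans h₂.last_right
    simpa using this.symm
  subst ea eb
  refine ⟨rfl, rfl, ?_⟩
  have hn := π.nodup_word
  have sides : π''.word s = π'.word s ∧ π''.word s.opp = π'.word s.opp := by
    cases h with
    | preserving u v₁ v₂ h1 h2 h3 h4 =>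
      cases h₂ with
      | preserving u' v₁' v₂' k1 k2 k3 k4 =>
        refine ⟨by rw [k3, h3, ← k1, ← h1], ?_⟩
        have e := h2.symm.trans k2
        have n2 := hn s.opp
        simp only [List.append_assoc] at e
        rw [h2] at n2
        simp only [List.append_assoc] at n2
        simp only [List.singleton_append] at e n2
        have hnot := (List.nodup_append.1 n2).2.2
        have hnot' := (List.nodup_cons.1 (List.nodup_append.1 n2).2.1).1
        have e3 := (List.append_cons_inj_of_notMem
          (fun hm => hnot _ hm _ List.mem_cons_self rfl) hnot').1 e
        rw [k4, h4, e3.1, List.append_cancel_right e3.2.2]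
      | reversing u₁' u₂' v' k1 k2 k3 k4 =>
        exact absurd (show otherEnd a₂ ∈ π.word s.opp by rw [h2]; simp)
          (π.notMem_opp (show otherEnd a₂ ∈ π.word s by rw [k1]; simp))
    | reversing u₁ u₂ v h1 h2 h3 h4 =>
      cases h₂ with
      | preserving u' v₁' v₂' k1 k2 k3 k4 =>
        exact absurd (show otherEnd a₂ ∈ π.word s.opp by rw [k2]; simp)
          (π.notMem_opp (show otherEnd a₂ ∈ π.word s by rw [h1]; simp))
      | reversing u₁' u₂' v' k1 k2 k3 k4 =>
        refine ⟨?_, by rw [k4, h4]; exact List.append_cancel_right (k2.symm.trans h2)⟩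
        have e := h1.symm.trans k1
        have n2 := hn s
        simp only [List.append_assoc] at e
        rw [h1] at n2
        simp only [List.append_assoc] at n2
        simp only [List.singleton_append] at e n2
        have hnot := (List.nodup_append.1 n2).2.2
        have hnot' := (List.nodup_cons.1 (List.nodup_append.1 n2).2.1).1
        have e3 := (List.append_cons_inj_of_notMem
          (fun hm => hnot _ hm _ List.mem_cons_self rfl) hnot').1 e
        rw [k3, h3, e3.1, List.append_cancel_right e3.2.2]
  refine Pattern.ext_word fun t => ?_
  rcases s.eq_or_eq_opp t with e | e
  · rw [e]; exact sides.1
  · rw [e]; exact sides.2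

end IsSplit
end BandExchange

/-! ### Neighbours in words and boundary circles -/

namespace BandExchange

variable {d : ℕ}

theorem pair_infix_append {α : Type*} {p q : α} {l₁ l₂ : List α} :
    [p, q] <:+: l₁ ++ l₂ ↔ [p, q] <:+: l₁ ∨ [p, q] <:+: l₂ ∨
      (l₁.getLast? = some p ∧ l₂.head? = some q) := by
  constructor
  · rintro ⟨x, y, h⟩
    rw [List.append_assoc] at h
    rcases List.append_eq_append_iff.1 h with ⟨z, rfl, h2⟩ | ⟨z, rfl, h2⟩
    · rcases z with _ | ⟨z₁, _ | ⟨z₂, z⟩⟩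
      · right; left; exact ⟨[], y, by simpa using h2⟩
      · simp only [List.cons_append, List.nil_append, List.cons.injEq] at h2
        right; right
        refine ⟨by rw [h2.1, List.getLast?_concat], by rw [← h2.2]; rfl⟩
      · simp only [List.cons_append, List.nil_append, List.cons.injEq] at h2
        left
        exact ⟨x, z, by rw [h2.1, h2.2.1]; simp⟩
    · right; left; exact ⟨z, y, by rw [h2]; simp⟩
  · rintro (h | h | ⟨h1, h2⟩)
    · exact h.trans (List.infix_append' [] l₁ l₂)
    · exact h.trans (List.IsSuffix.isInfix (List.suffix_append _ _))
    · obtain ⟨l, rfl⟩ := List.getLast?_eq_some_iff.1 h1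
      rcases l₂ with _ | ⟨x, l₂⟩
      · simp at h2
      · simp only [List.head?_cons, Option.some.injEq] at h2
        subst h2
        exact ⟨l, l₂, by simp⟩

theorem pair_infix_singleton {α : Type*} {p q x : α} : ¬ [p, q] <:+: [x] := by
  intro h; have := h.length_le; simp at this

/-- In a list without repetition, an element has a right neighbour unless it is the last one. -/
theorem exists_pair_infix {α : Type*} {l : List α} {p : α} (hp : p ∈ l)
    (h : l.getLast? ≠ some p) : ∃ q, [p, q] <:+: l := by
  obtain ⟨l₁, l₂, rfl⟩ := List.append_of_mem hp
  rcases l₂ with _ | ⟨q, l₂⟩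
  · rw [List.getLast?_concat] at h; exact absurd rfl h
  · exact ⟨q, l₁, l₂, by simp⟩

theorem exists_pair_infix_left {α : Type*} {l : List α} {q : α} (hq : q ∈ l)
    (h : l.head? ≠ some q) : ∃ p, [p, q] <:+: l := by
  obtain ⟨l₁, l₂, rfl⟩ := List.append_of_mem hq
  rcases List.eq_nil_or_concat l₁ with rfl | ⟨l₁, p, rfl⟩
  · simp at h
  · exact ⟨p, l₁, l₂, by simp⟩

theorem pair_infix_right_unique {α : Type*} {l : List α} (hl : l.Nodup) {p q q' : α}
    (h : [p, q] <:+: l) (h' : [p, q'] <:+: l) : q = q' := by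
  obtain ⟨x, y, rfl⟩ := h
  obtain ⟨x', y', h⟩ := h'
  simp only [List.append_assoc, List.cons_append, List.nil_append] at h hl
  have h3 := (List.nodup_cons.1 (List.nodup_append.1 hl).2.1).1
  rw [eq_comm] at h
  have := (List.append_cons_inj_of_notMem
    (fun hm => (List.nodup_append.1 hl).2.2 _ hm _ List.mem_cons_self rfl) h3).1 h
  have := this.2.2
  simp only [List.cons.injEq] at this
  exact this.1

theorem pair_infix_left_unique {α : Type*} {l : List α} (hl : l.Nodup) {p p' q : α}
    (h : [p, q] <:+: l) (h' : [p', q] <:+: l) : p = p' := by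
  have h1 : [q, p] <:+: l.reverse := by simpa using List.reverse_infix.2 h
  have h2 : [q, p'] <:+: l.reverse := by simpa using List.reverse_infix.2 h'
  exact pair_infix_right_unique (List.nodup_reverse.2 hl) h1 h2

theorem pair_infix_not_last {α : Type*} {l : List α} (hl : l.Nodup) {p q : α}
    (h : [p, q] <:+: l) : l.getLast? ≠ some p := by
  obtain ⟨x, y, rfl⟩ := h
  intro h
  have h1 : (q :: y).getLast? = some p := by
    rw [List.append_assoc, List.getLast?_append] at h
    simp only [List.cons_append, List.nil_append, List.getLast?_cons_cons] at h
    simpa [List.getLast?_cons] using h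
  have h2 : p ∈ q :: y := List.mem_of_getLast? h1
  simp only [List.append_assoc, List.cons_append, List.nil_append] at hl
  exact (List.nodup_cons.1 (List.nodup_append.1 hl).2.1).1 h2

theorem pair_infix_mem {α : Type*} {l : List α} {p q : α}
    (h : [p, q] <:+: l) : p ∈ l ∧ q ∈ l :=
  ⟨h.subset (by simp), h.subset (by simp)⟩

namespace Pattern

variable {π : Pattern d}

theorem SameCircle.refl (g : BandEnd d × Hand) : π.SameCircle g g := Relation.EqvGen.refl _

theorem SameCircle.symm {g g' : BandEnd d × Hand} (h : π.SameCircle g g') :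
    π.SameCircle g' g := Relation.EqvGen.symm _ _ h

theorem SameCircle.trans {g g' g'' : BandEnd d × Hand} (h : π.SameCircle g g')
    (h' : π.SameCircle g' g'') : π.SameCircle g g'' := Relation.EqvGen.trans _ _ _ h h'

theorem BoundaryStep.same {g g' : BandEnd d × Hand} (h : π.BoundaryStep g g') :
    π.SameCircle g g' := Relation.EqvGen.rel _ _ h

theorem same_right {s : Side} {a b : BandEnd d} (ha : (π.word s).getLast? = some a)
    (hb : (π.word s.opp).getLast? = some b) : π.SameCircle (a, .right) (b, .right) := by
  cases s
  · exact (BoundaryStep.rightEnd a b ha hb).same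
  · exact (BoundaryStep.rightEnd b a hb ha).same.symm

theorem same_left {s : Side} {a b : BandEnd d} (ha : (π.word s).head? = some a)
    (hb : (π.word s.opp).head? = some b) : π.SameCircle (a, .left) (b, .left) := by
  cases s
  · exact (BoundaryStep.leftEnd a b ha hb).same
  · exact (BoundaryStep.leftEnd b a hb ha).same.symm

/-- A set of boundary pieces closed under steps in both directions contains the circles it
meets. -/
theorem SameCircle.mem_iff {P : Set (BandEnd d × Hand)}
    (hP : ∀ g g', π.BoundaryStep g g' → (g ∈ P ↔ g' ∈ P)) {g g' : BandEnd d × Hand}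
    (h : π.SameCircle g g') : g ∈ P ↔ g' ∈ P := by
  induction h with
  | rel _ _ h => exact hP _ _ h
  | refl _ => rfl
  | symm _ _ _ ih => exact ih.symm
  | trans _ _ _ _ _ ih1 ih2 => exact ih1.trans ih2

/-- A relation that is compatible with steps is compatible with circles. -/
theorem SameCircle.map {π' : Pattern d} {F : BandEnd d × Hand → BandEnd d × Hand}
    (hF : ∀ g g', π.BoundaryStep g g' → π'.SameCircle (F g) (F g')) {g g' : BandEnd d × Hand}
    (h : π.SameCircle g g') : π'.SameCircle (F g) (F g') := by
  induction h with
  | rel _ _ h => exact hF _ _ h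
  | refl _ => exact .refl _
  | symm _ _ _ ih => exact ih.symm
  | trans _ _ _ _ _ ih1 ih2 => exact ih1.trans ih2

/-- Cusps, recorded by the end on their left, correspond to all ends other than the two rightmost
ones. Cusps can then be counted without reference to adjacency. -/
theorem exists_neighbours_iff {a : BandEnd d} :
    (∃ s b, π.Neighbours s a b) ↔ ∀ s, (π.word s).getLast? ≠ some a := by
  constructor
  · rintro ⟨s, b, h⟩ t ht
    have hm := List.mem_of_getLast? ht
    have := π.side_unique (pair_infix_mem h).1 hm
    subst this
    exact pair_infix_not_last (π.nodup_word _) h ht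
  · intro h
    rcases π.mem_or .top a with ha | ha
    · obtain ⟨q, hq⟩ := exists_pair_infix ha (h _)
      exact ⟨_, q, hq⟩
    · obtain ⟨q, hq⟩ := exists_pair_infix ha (h _)
      exact ⟨_, q, hq⟩

theorem band_same {s : Side} {a : BandEnd d} {h : Hand} (ha : a ∈ π.word s)
    (hb : otherEnd a ∈ π.word s.opp) : π.SameCircle (a, h) (otherEnd a, h) :=
  (BoundaryStep.preserving s a h ha hb).same

theorem band_same' {s : Side} {a : BandEnd d} {h : Hand} (ha : a ∈ π.word s)
    (hb : otherEnd a ∈ π.word s) : π.SameCircle (a, h) (otherEnd a, h.opp) :=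
  (BoundaryStep.reversing s a h ha hb).same

/-- If both rightmost ends belonged to one band, its two right edges would close up around the right
end of the interval to a circle without cusps. -/
theorem IsComplete.crit_fst_ne (hπ : π.IsComplete) {s : Side} {a b : BandEnd d}
    (ha : (π.word s).getLast? = some a) (hb : (π.word s.opp).getLast? = some b) :
    a.1 ≠ b.1 := by
  intro hab
  have ma := List.mem_of_getLast? ha
  have mb := List.mem_of_getLast? hb
  have hb' : b = otherEnd a := by
    rcases eq_or_eq_otherEnd hab.symm with e | e
    · exact absurd (e ▸ mb) (π.notMem_opp ma)
    · exact e
  subst hb'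
  have key : π.cuspCount (a, .right) = 0 := by
    have : {x : BandEnd d | (∃ s b, π.Neighbours s x b) ∧
        π.SameCircle (x, .right) (a, .right)} = ∅ := by
      refine Set.eq_empty_of_forall_notMem ?_
      rintro x ⟨h1, h2⟩
      rw [exists_neighbours_iff] at h1
      have hx : ∀ t c, c = a ∨ c = otherEnd a → ¬ ∃ y, π.Neighbours t c y := by
        rintro t c hc ⟨y, hy⟩
        have := exists_neighbours_iff.1 ⟨t, y, hy⟩
        rcases hc with rfl | rfl
        · exact this _ ha
        · exact this _ hb
      have hP := SameCircle.mem_iff (π := π) (P := {(a, .right), (otherEnd a, .right)}) ?_ h2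
      · simp only [Set.mem_insert_iff, Prod.mk.injEq, and_true, true_or, iff_true,
          Set.mem_singleton_iff] at hP
        rcases hP with rfl | rfl
        · exact h1 _ ha
        · exact h1 _ hb
      · intro g g' hs
        cases hs with
        | preserving t c h m1 m2 =>
          simp only [Set.mem_insert_iff, Prod.mk.injEq, Set.mem_singleton_iff]
          constructor
          · rintro (⟨rfl, rfl⟩ | ⟨rfl, rfl⟩) <;> simp
          · rintro (⟨h, rfl⟩ | ⟨h, rfl⟩)
            · rw [← h]; simp
            · have := congrArg otherEnd h; simp only [otherEnd_otherEnd] at this; simp [this]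
        | reversing t c h m1 m2 =>
          have : ∀ c, c = a ∨ c = otherEnd a → c ∈ π.word t → otherEnd c ∉ π.word t := by
            rintro c (rfl | rfl) hc
            · obtain rfl := π.side_unique ma hc
              intro h; exact π.notMem_opp h mb
            · obtain rfl := π.side_unique mb hc
              rw [otherEnd_otherEnd]
              exact π.notMem_opp ma
          simp only [Set.mem_insert_iff, Prod.mk.injEq, Set.mem_singleton_iff]
          constructor
          · rintro (⟨rfl, rfl⟩ | ⟨rfl, rfl⟩)
            · exact absurd m2 (this _ (.inl rfl) m1)
            · exact absurd m2 (this _ (.inr rfl) m1)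
          · rintro (⟨h, _⟩ | ⟨h, _⟩)
            · exact absurd m2 (this _ (.inr (by rw [← h]; simp)) m1)
            · exact absurd m2 (this _ (.inl (by simpa using congrArg otherEnd h)) m1)
        | cusp t c y hn =>
          simp only [Set.mem_insert_iff, Prod.mk.injEq, Set.mem_singleton_iff]
          constructor
          · rintro (⟨h, -⟩ | ⟨h, -⟩)
            · exact absurd ⟨y, hn⟩ (hx t c (.inl h))
            · exact absurd ⟨y, hn⟩ (hx t c (.inr h))
          · rintro (⟨_, h⟩ | ⟨_, h⟩) <;> simp at h
        | leftEnd c y h1 h2 => simp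
        | rightEnd c y h1 h2 =>
          have : (c = a ∧ y = otherEnd a) ∨ (c = otherEnd a ∧ y = a) := by
            cases s
            · simp only [Side.opp] at hb
              rw [ha] at h1; rw [hb] at h2
              simp only [Option.some.injEq] at h1 h2
              exact .inl ⟨h1.symm, h2.symm⟩
            · simp only [Side.opp] at hb
              rw [hb] at h1; rw [ha] at h2
              simp only [Option.some.injEq] at h1 h2
              exact .inr ⟨h1.symm, h2.symm⟩
          rcases this with ⟨rfl, rfl⟩ | ⟨rfl, rfl⟩ <;> simp
    rw [cuspCount, this, Set.ncard_empty]
  rcases hπ (a, .right) with h | h <;> omega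

end Pattern
end BandExchange

/-! ### Splits preserve completeness -/

namespace BandExchange

variable {d : ℕ}

namespace Pattern

/-- A criterion for transferring completeness along maps of boundary pieces. -/
theorem IsComplete.of_maps {π π' : Pattern d} (hc : π.IsComplete)
    (F F' : BandEnd d × Hand → BandEnd d × Hand)
    (hF : ∀ g g', π'.BoundaryStep g g' → π.SameCircle (F g) (F g'))
    (hF' : ∀ g g', π.BoundaryStep g g' → π'.SameCircle (F' g) (F' g'))
    (hFF : ∀ g, π'.SameCircle (F' (F g)) g) (θ : Equiv.Perm (BandEnd d))
    (hθ : ∀ x, (∀ s, (π'.word s).getLast? ≠ some x) ↔ ∀ s, (π.word s).getLast? ≠ some (θ x))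
    (hθF : ∀ x, (∀ s, (π'.word s).getLast? ≠ some x) →
      π.SameCircle (θ x, .right) (F (x, .right))) : π'.IsComplete := by
  intro g
  -- `F` and `F'` are compatible with circles, and `F'` undoes `F` up to circles, so lying on a
  -- common circle can be tested after `F`. The permutation `θ` matches the cusps themselves.
  have key : π'.cuspCount g = π.cuspCount (F g) := by
    unfold cuspCount
    rw [← Set.ncard_image_of_injective _ θ.injective]
    congr 1
    ext x
    obtain ⟨y, rfl⟩ := θ.surjective x
    simp only [Set.mem_image, EmbeddingLike.apply_eq_iff_eq, exists_eq_right, Set.mem_ofPred_eq]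
    rw [exists_neighbours_iff, exists_neighbours_iff, ← hθ y]
    refine and_congr_right fun hy => ?_
    constructor
    · intro h
      exact (hθF y hy).trans (h.map hF)
    · intro h
      have h1 := (((hθF y hy).symm.trans h).map hF')
      exact (hFF _).symm.trans (h1.trans (hFF g))
  rw [key]
  exact hc _

theorem forall_last_ne_iff {π : Pattern d} {s : Side} {a b x : BandEnd d}
    (ha : (π.word s).getLast? = some a) (hb : (π.word s.opp).getLast? = some b) :
    (∀ t, (π.word t).getLast? ≠ some x) ↔ x ≠ a ∧ x ≠ b := by
  constructor
  · intro h
    exact ⟨fun e => h s (e ▸ ha), fun e => h s.opp (e ▸ hb)⟩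
  · rintro ⟨h1, h2⟩ t
    rcases s.eq_or_eq_opp t with rfl | rfl
    · rw [ha]; simpa using h1.symm
    · rw [hb]; simpa using h2.symm

end Pattern

open Pattern

/-- Sliding `b` along the right edge of the band of `a` moves a cusp along its boundary circle
without altering the circles. Only right edges of the band of `a` have to be reassigned. -/
theorem IsSplit.isComplete_preserving {π π' : Pattern d} {s : Side} {a b : BandEnd d}
    (hc : π.IsComplete) {u v₁ v₂ : List (BandEnd d)}
    (h1 : π.word s = u ++ [a]) (h2 : π.word s.opp = v₁ ++ [otherEnd a] ++ v₂ ++ [b])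
    (h3 : π'.word s = u ++ [a]) (h4 : π'.word s.opp = v₁ ++ [otherEnd a, b] ++ v₂) :
    π'.IsComplete := by
  have hn := π.nodup_word s.opp
  have la : (π.word s).getLast? = some a := by rw [h1, List.getLast?_concat]
  have la' : (π'.word s).getLast? = some a := by rw [h3, List.getLast?_concat]
  have lb : (π.word s.opp).getLast? = some b := by rw [h2, List.getLast?_concat]
  have ma : a ∈ π.word s := List.mem_of_getLast? la
  have mo : otherEnd a ∈ π.word s.opp := by rw [h2]; simp
  have mb : b ∈ π.word s.opp := List.mem_of_getLast? lb
  -- With `v₂` empty, `b` already sits beside `otherEnd a` and the pattern does not change.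
  -- Otherwise `z` becomes the rightmost end in place of `b`.
  rcases List.eq_nil_or_concat v₂ with rfl | ⟨v₃, z, rfl⟩
  · have : π' = π := Pattern.ext_word fun t => by
      rcases s.eq_or_eq_opp t with rfl | rfl
      · rw [h1, h3]
      · rw [h2, h4]; simp
    rwa [this]
  rw [List.concat_eq_append] at h2 h4
  have lz' : (π'.word s.opp).getLast? = some z := by
    rw [h4, ← List.append_assoc, List.getLast?_concat]
  have mz : z ∈ π.word s.opp := by rw [h2]; simp
  have hmem : ∀ t x, x ∈ π'.word t ↔ x ∈ π.word t := by
    intro t x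
    rcases s.eq_or_eq_opp t with rfl | rfl
    · rw [h1, h3]
    · rw [h2, h4]; simp; tauto
  have hdisj := fun x (hx : x ∈ π.word s.opp) (e : x = a) => π.notMem_opp ma (e ▸ hx)
  have hoa := otherEnd_ne a
  have n1 : (v₁ ++ [otherEnd a]).Nodup := by
    rw [h2, List.append_assoc, List.nodup_append] at hn; exact hn.1
  have n2 : ∀ x ∈ v₁ ++ [otherEnd a], ∀ y ∈ (v₃ ++ [z]) ++ [b], x ≠ y := by
    rw [h2, List.append_assoc, List.nodup_append] at hn; exact hn.2.2
  have n3 : ((v₃ ++ [z]) ++ [b]).Nodup := by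
    rw [h2, List.append_assoc, List.nodup_append] at hn; exact hn.2.1
  have hzo : z ≠ otherEnd a := (n2 (otherEnd a) (by simp) z (by simp)).symm
  have hbo : b ≠ otherEnd a := (n2 (otherEnd a) (by simp) b (by simp)).symm
  have hzb : z ≠ b := (List.nodup_append.1 n3).2.2 z (by simp) b (by simp)
  have hza : z ≠ a := hdisj z mz
  have hba : b ≠ a := hdisj b mb
  have nb : ∀ p q, π.Neighbours s.opp p q ↔ [p, q] <:+: v₁ ++ [otherEnd a] ∨
      [p, q] <:+: v₃ ++ [z] ∨ (p = z ∧ q = b) ∨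
        (p = otherEnd a ∧ (v₃ ++ [z]).head? = some q) := by
    intro p q
    unfold Neighbours
    rw [h2, List.append_assoc, pair_infix_append, @pair_infix_append _ p q (v₃ ++ [z]) [b],
      List.getLast?_concat,
      List.getLast?_concat]
    have : ((v₃ ++ [z]) ++ [b]).head? = (v₃ ++ [z]).head? := by cases v₃ <;> simp
    rw [this]
    simp only [pair_infix_singleton, List.head?_cons, Option.some.injEq, false_or]
    rw [@eq_comm _ z p, @eq_comm _ b q, @eq_comm _ (otherEnd a) p]
    tauto
  have nb' : ∀ p q, π'.Neighbours s.opp p q ↔ [p, q] <:+: v₁ ++ [otherEnd a] ∨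
      [p, q] <:+: v₃ ++ [z] ∨ (p = b ∧ (v₃ ++ [z]).head? = some q) ∨
        (p = otherEnd a ∧ q = b) := by
    intro p q
    unfold Neighbours
    have : π'.word s.opp = (v₁ ++ [otherEnd a]) ++ ([b] ++ (v₃ ++ [z])) := by rw [h4]; simp
    rw [this, pair_infix_append, @pair_infix_append _ p q [b], List.getLast?_concat]
    simp only [pair_infix_singleton, List.getLast?_singleton, Option.some.injEq, false_or,
      List.singleton_append, List.head?_cons]
    rw [@eq_comm _ b p, @eq_comm _ b q, @eq_comm _ (otherEnd a) p]
    tauto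
  have np1 : ∀ p q, [p, q] <:+: v₁ ++ [otherEnd a] → p ≠ otherEnd a ∧ p ≠ a := by
    intro p q h
    refine ⟨fun e => pair_infix_not_last n1 h (by rw [List.getLast?_concat, e]), fun e => ?_⟩
    refine hdisj p ?_ e
    have := (pair_infix_mem h).1
    rw [h2]; simp only [List.mem_append] at this ⊢; tauto
  have np2 : ∀ p q, [p, q] <:+: v₃ ++ [z] → p ≠ otherEnd a ∧ p ≠ a := by
    intro p q h
    have hm := (pair_infix_mem h).1
    refine ⟨fun e => n2 (otherEnd a) (by simp) p (by simp at hm ⊢; tauto) e.symm, fun e => ?_⟩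
    refine hdisj p ?_ e
    rw [h2]; simp only [List.mem_append] at hm ⊢; tauto
  have nps : ∀ p q, π.Neighbours s p q → p ≠ otherEnd a ∧ p ≠ a := by
    intro p q h
    have hm := (pair_infix_mem h).1
    exact ⟨fun e => π.notMem_opp (e ▸ hm) mo,
      fun e => pair_infix_not_last (π.nodup_word s) h (by rw [la, e])⟩
  have nss : ∀ p q, π'.Neighbours s p q ↔ π.Neighbours s p q := by
    intro p q; unfold Neighbours; rw [h1, h3]
  have hds : ∀ t, (π'.word t).head? = (π.word t).head? := by
    intro t
    rcases s.eq_or_eq_opp t with rfl | rfl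
    · rw [h1, h3]
    · rw [h2, h4]; cases v₁ <;> simp
  classical
  -- equivalences along the common parts
  have bead : ∀ h, π.SameCircle (a, h) (otherEnd a, h) := fun h => band_same ma mo
  have bead' : ∀ h, π'.SameCircle (a, h) (otherEnd a, h) := fun h =>
    band_same ((hmem _ _).2 ma) ((hmem _ _).2 mo)
  have rend : π.SameCircle (a, .right) (b, .right) := same_right la lb
  have rend' : π'.SameCircle (a, .right) (z, .right) := same_right la' lz'
  have cusp : ∀ t p q, π.Neighbours t p q → π.SameCircle (p, .right) (q, .left) :=
    fun t p q h => (BoundaryStep.cusp t p q h).same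
  have cusp' : ∀ t p q, π'.Neighbours t p q → π'.SameCircle (p, .right) (q, .left) :=
    fun t p q h => (BoundaryStep.cusp t p q h).same
  -- The right edges of the band of `a` are joined across the right end of the interval to `z` in
  -- `π'`, but to `b` in `π`. `F` and `F'` send them to these respective edges.
  let F : BandEnd d × Hand → BandEnd d × Hand := fun g =>
    if g = (a, .right) ∨ g = (otherEnd a, .right) then (z, .right) else g
  let F' : BandEnd d × Hand → BandEnd d × Hand := fun g =>
    if g = (a, .right) ∨ g = (otherEnd a, .right) then (b, .right) else g
  have Fl : ∀ x, F (x, .left) = (x, .left) := fun x => by simp [F]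
  have Fl' : ∀ x, F' (x, .left) = (x, .left) := fun x => by simp [F']
  have Fr : ∀ x, x ≠ otherEnd a ∧ x ≠ a → F (x, .right) = (x, .right) := fun x hx => by
    simp [F, hx.1, hx.2]
  have Fr' : ∀ x, x ≠ otherEnd a ∧ x ≠ a → F' (x, .right) = (x, .right) := fun x hx => by
    simp [F', hx.1, hx.2]
  have Fo : F (otherEnd a, .right) = (z, .right) := by simp [F]
  have Fa : F (a, .right) = (z, .right) := by simp [F]
  have Fo' : F' (otherEnd a, .right) = (b, .right) := by simp [F']
  have Fa' : F' (a, .right) = (b, .right) := by simp [F']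
  have bandF : ∀ (G : BandEnd d × Hand → BandEnd d × Hand) (ρ : Pattern d),
      G (otherEnd a, .right) = G (a, .right) → (∀ x, G (x, .left) = (x, .left)) →
      (∀ x, x ≠ otherEnd a ∧ x ≠ a → G (x, .right) = (x, .right)) →
      a ∈ ρ.word s → otherEnd a ∈ ρ.word s.opp →
      (∀ x h k, ρ.SameCircle (x, h) (otherEnd x, k) → (x = a ∨ x = otherEnd a → k = h) →
        ρ.SameCircle (G (x, h)) (G (otherEnd x, k))) := by
    intro G ρ e1 e2 e3 _ _ x h k hs hk
    by_cases hx : x = a ∨ x = otherEnd a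
    · obtain rfl := hk hx
      cases k
      · rw [e2, e2]; exact hs
      · rcases hx with rfl | rfl
        · rw [e1]; exact .refl _
        · rw [otherEnd_otherEnd, e1]; exact .refl _
    · push Not at hx
      have hx' : otherEnd x ≠ otherEnd a ∧ otherEnd x ≠ a :=
        ⟨fun e => hx.1 (by simpa using congrArg otherEnd e),
          fun e => hx.2 (by rw [← e, otherEnd_otherEnd])⟩
      have e4 : ∀ h, G (x, h) = (x, h) := by
        intro h; cases h
        · exact e2 x
        · exact e3 x hx.symm
      have e5 : ∀ h, G (otherEnd x, h) = (otherEnd x, h) := by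
        intro h; cases h
        · exact e2 _
        · exact e3 _ hx'
      rw [e4, e5]; exact hs
  have norev : ∀ t x, x ∈ π.word t → otherEnd x ∈ π.word t → ¬ (x = a ∨ x = otherEnd a) := by
    rintro t x m1 m2 (rfl | rfl)
    · obtain rfl := π.side_unique ma m1
      exact π.notMem_opp m2 mo
    · rw [otherEnd_otherEnd] at m2
      obtain rfl := π.side_unique ma m2
      exact π.notMem_opp m1 mo
  -- The cusp right of `otherEnd a` in `π'` is the old cusp between `z` and `b`; the cusp right of
  -- `b` in `π'`, if any, is the old one right of `otherEnd a`. The end without a cusp changes from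
  -- `b` to `z`.
  refine hc.of_maps F F' ?_ ?_ ?_ (Equiv.swap b z * Equiv.swap (otherEnd a) b) ?_ ?_
  · intro g g' hs
    cases hs with
    | preserving t x h m1 m2 =>
      rw [hmem] at m1 m2
      exact bandF F π (by rw [Fo, Fa]) Fl Fr ma mo x h h (band_same m1 m2) fun _ => rfl
    | reversing t x h m1 m2 =>
      rw [hmem] at m1 m2
      exact bandF F π (by rw [Fo, Fa]) Fl Fr ma mo x h h.opp (band_same' m1 m2) fun e =>
        absurd e (norev t x m1 m2)
    | cusp t p q hpq =>
      rw [Fl]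
      rcases s.eq_or_eq_opp t with rfl | rfl
      · rw [nss] at hpq
        rw [Fr p (nps p q hpq)]
        exact cusp _ _ _ hpq
      · rcases (nb' p q).1 hpq with h | h | ⟨rfl, h⟩ | ⟨rfl, rfl⟩
        · rw [Fr p (np1 p q h)]
          exact cusp _ _ _ ((nb p q).2 (.inl h))
        · rw [Fr p (np2 p q h)]
          exact cusp _ _ _ ((nb p q).2 (.inr (.inl h)))
        · rw [Fr p ⟨hbo, hba⟩]
          exact rend.symm.trans ((bead _).trans (cusp _ _ _ ((nb _ _).2 (.inr (.inr (.inr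
            ⟨rfl, h⟩))))))
        · rw [Fo]
          exact cusp _ _ _ ((nb _ _).2 (.inr (.inr (.inl ⟨rfl, rfl⟩))))
    | leftEnd p q k1 k2 =>
      rw [Fl, Fl]
      rw [hds] at k1 k2
      exact (BoundaryStep.leftEnd p q k1 k2).same
    | rightEnd p q k1 k2 =>
      have : (p = a ∧ q = z) ∨ (p = z ∧ q = a) := by
        cases s
        · rw [la'] at k1
          simp only [Side.opp] at lz'
          rw [lz'] at k2
          left; simpa [eq_comm] using And.intro k1 k2
        · rw [la'] at k2
          simp only [Side.opp] at lz'
          rw [lz'] at k1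
          right; simpa [eq_comm] using And.intro k1 k2
      rcases this with ⟨rfl, rfl⟩ | ⟨rfl, rfl⟩
      · rw [Fa, Fr _ ⟨hzo, hza⟩]; exact .refl _
      · rw [Fa, Fr _ ⟨hzo, hza⟩]; exact .refl _
  · intro g g' hs
    cases hs with
    | preserving t x h m1 m2 =>
      rw [← hmem] at m1 m2
      exact bandF F' π' (by rw [Fo', Fa']) Fl' Fr' ((hmem _ _).2 ma) ((hmem _ _).2 mo) x h h
        (band_same m1 m2) fun _ => rfl
    | reversing t x h m1 m2 =>
      have := norev t x m1 m2
      rw [← hmem] at m1 m2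
      exact bandF F' π' (by rw [Fo', Fa']) Fl' Fr' ((hmem _ _).2 ma) ((hmem _ _).2 mo) x h h.opp
        (band_same' m1 m2) fun e => absurd e this
    | cusp t p q hpq =>
      rw [Fl']
      rcases s.eq_or_eq_opp t with rfl | rfl
      · rw [Fr' p (nps p q hpq)]
        rw [← nss] at hpq
        exact cusp' _ _ _ hpq
      · rcases (nb p q).1 hpq with h | h | ⟨rfl, rfl⟩ | ⟨rfl, h⟩
        · rw [Fr' p (np1 p q h)]
          exact cusp' _ _ _ ((nb' p q).2 (.inl h))
        · rw [Fr' p (np2 p q h)]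
          exact cusp' _ _ _ ((nb' p q).2 (.inr (.inl h)))
        · rw [Fr' p ⟨hzo, hza⟩]
          exact rend'.symm.trans ((bead' _).trans (cusp' _ _ _ ((nb' _ _).2 (.inr (.inr (.inr
            ⟨rfl, rfl⟩))))))
        · rw [Fo']
          exact cusp' _ _ _ ((nb' _ _).2 (.inr (.inr (.inl ⟨rfl, h⟩))))
    | leftEnd p q k1 k2 =>
      rw [Fl', Fl']
      rw [← hds] at k1 k2
      exact (BoundaryStep.leftEnd p q k1 k2).same
    | rightEnd p q k1 k2 =>
      have : (p = a ∧ q = b) ∨ (p = b ∧ q = a) := by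
        cases s
        · rw [la] at k1
          simp only [Side.opp] at lb
          rw [lb] at k2
          left; simpa [eq_comm] using And.intro k1 k2
        · rw [la] at k2
          simp only [Side.opp] at lb
          rw [lb] at k1
          right; simpa [eq_comm] using And.intro k1 k2
      rcases this with ⟨rfl, rfl⟩ | ⟨rfl, rfl⟩
      · rw [Fa', Fr' _ ⟨hbo, hba⟩]; exact .refl _
      · rw [Fa', Fr' _ ⟨hbo, hba⟩]; exact .refl _
  · rintro ⟨x, h⟩
    cases h
    · rw [Fl, Fl']; exact .refl _
    · by_cases hx : x ≠ otherEnd a ∧ x ≠ a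
      · rw [Fr x hx, Fr' x hx]; exact .refl _
      · have : x = otherEnd a ∨ x = a := by tauto
        rcases this with rfl | rfl
        · rw [Fo, Fr' _ ⟨hzo, hza⟩]
          exact rend'.symm.trans (bead' _)
        · rw [Fa, Fr' _ ⟨hzo, hza⟩]
          exact rend'.symm
  · intro x
    rw [forall_last_ne_iff la' lz', forall_last_ne_iff la lb]
    refine and_congr (not_congr ?_) (not_congr ?_)
    · rw [Equiv.Perm.mul_apply]
      constructor
      · rintro rfl
        rw [Equiv.swap_apply_of_ne_of_ne hoa.symm hba.symm, Equiv.swap_apply_of_ne_of_ne hba.symm hza.symm]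
      · intro h
        rw [Equiv.swap_apply_eq_iff, Equiv.swap_apply_of_ne_of_ne hba.symm hza.symm,
          Equiv.swap_apply_eq_iff, Equiv.swap_apply_of_ne_of_ne hoa.symm hba.symm] at h
        exact h
    · rw [Equiv.Perm.mul_apply]
      constructor
      · rintro rfl
        rw [Equiv.swap_apply_of_ne_of_ne hzo hzb, Equiv.swap_apply_right]
      · intro h
        rw [Equiv.swap_apply_eq_iff, Equiv.swap_apply_left,
          Equiv.swap_apply_eq_iff, Equiv.swap_apply_of_ne_of_ne hzo hzb] at h
        exact h
  · intro x hx
    rw [forall_last_ne_iff la' lz'] at hx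
    rw [Equiv.Perm.mul_apply]
    by_cases e1 : x = otherEnd a
    · subst e1
      rw [Equiv.swap_apply_left, Equiv.swap_apply_left, Fo]; exact .refl _
    by_cases e2 : x = b
    · subst e2
      rw [Equiv.swap_apply_right, Equiv.swap_apply_of_ne_of_ne hbo.symm hzo.symm,
        Fr _ ⟨hbo, hba⟩]
      exact (bead _).symm.trans rend
    rw [Equiv.swap_apply_of_ne_of_ne e1 e2, Equiv.swap_apply_of_ne_of_ne e2 hx.2,
      Fr _ ⟨e1, hx.1⟩]
    exact .refl _

end BandExchange

namespace BandExchange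

variable {d : ℕ}

open Pattern

theorem pair_infix_not_head {α : Type*} {l : List α} (hl : l.Nodup) {p q : α}
    (h : [p, q] <:+: l) : l.head? ≠ some q := by
  have h1 : [q, p] <:+: l.reverse := by simpa using List.reverse_infix.2 h
  simpa using pair_infix_not_last (List.nodup_reverse.2 hl) h1

/-- The end `b` is carried through a half-turn to the other side, so its left and right edges are
exchanged; the circles are otherwise the same. The side that loses `b` must stay nonempty for the
right end of the interval to join two ends. -/
theorem IsSplit.isComplete_reversing {π π' : Pattern d} {s : Side} {a b : BandEnd d}
    (hc : π.IsComplete) {u₁ u₂ v : List (BandEnd d)}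
    (h1 : π.word s = u₁ ++ [otherEnd a] ++ u₂ ++ [a]) (h2 : π.word s.opp = v ++ [b])
    (h3 : π'.word s = u₁ ++ [b, otherEnd a] ++ u₂ ++ [a]) (h4 : π'.word s.opp = v)
    (hv : v ≠ []) : π'.IsComplete := by
  have hns := π.nodup_word s
  have la : (π.word s).getLast? = some a := by rw [h1, List.getLast?_concat]
  have la' : (π'.word s).getLast? = some a := by rw [h3, List.getLast?_concat]
  have lb : (π.word s.opp).getLast? = some b := by rw [h2, List.getLast?_concat]
  have ma : a ∈ π.word s := List.mem_of_getLast? la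
  have mo : otherEnd a ∈ π.word s := by rw [h1]; simp
  have mb : b ∈ π.word s.opp := List.mem_of_getLast? lb
  have mb' : b ∈ π'.word s := by rw [h3]; simp
  obtain ⟨v', z, rfl⟩ := (List.eq_nil_or_concat v).resolve_left hv
  rw [List.concat_eq_append] at h2 h4
  have lz' : (π'.word s.opp).getLast? = some z := by rw [h4, List.getLast?_concat]
  have mz : z ∈ π.word s.opp := by rw [h2]; simp
  have hmem : ∀ t x, x ≠ b → (x ∈ π'.word t ↔ x ∈ π.word t) := by
    intro t x hx
    rcases s.eq_or_eq_opp t with rfl | rfl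
    · rw [h1, h3]; simp [hx]
    · rw [h2, h4]; simp [hx]
  have hdisj := fun x (hx : x ∈ π.word s.opp) y (hy : y ∈ π.word s) (e : x = y) =>
    π.notMem_opp hy (e ▸ hx)
  have hoa := otherEnd_ne a
  have hba : b ≠ a := hdisj b mb a ma
  have hbo : b ≠ otherEnd a := hdisj b mb _ mo
  have hza : z ≠ a := hdisj z mz a ma
  have hzo : z ≠ otherEnd a := hdisj z mz _ mo
  have hzb : z ≠ b := by
    have := π.nodup_word s.opp
    rw [h2] at this
    exact (List.nodup_append.1 this).2.2 z (by simp) b (by simp)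
  have hob : otherEnd b ≠ b := otherEnd_ne b
  have hoba : otherEnd b ≠ a := fun e => hbo (by rw [← e, otherEnd_otherEnd])
  have hobo : otherEnd b ≠ otherEnd a := fun e => hba (by simpa using congrArg otherEnd e)
  set w := [otherEnd a] ++ (u₂ ++ [a]) with hw
  have hs : π.word s = u₁ ++ w := by rw [h1, hw]; simp
  have hs' : π'.word s = u₁ ++ ([b] ++ w) := by rw [h3, hw]; simp
  have nw : w.Nodup := by rw [hs] at hns; exact (List.nodup_append.1 hns).2.1
  have nuw : ∀ x ∈ u₁, ∀ y ∈ w, x ≠ y := by rw [hs] at hns; exact (List.nodup_append.1 hns).2.2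
  have lw : w.getLast? = some a := by
    rw [hw, ← List.append_assoc, List.getLast?_concat]
  have hdw : w.head? = some (otherEnd a) := rfl
  have maw : a ∈ w := List.mem_of_getLast? lw
  have mow : otherEnd a ∈ w := by rw [hw]; simp
  have nb : ∀ p q, π.Neighbours s p q ↔ [p, q] <:+: u₁ ∨ [p, q] <:+: w ∨
      (u₁.getLast? = some p ∧ q = otherEnd a) := by
    intro p q
    unfold Neighbours
    rw [hs, pair_infix_append, hdw, Option.some.injEq, @eq_comm _ _ q]
  have nb' : ∀ p q, π'.Neighbours s p q ↔ [p, q] <:+: u₁ ∨ [p, q] <:+: w ∨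
      (u₁.getLast? = some p ∧ q = b) ∨ (p = b ∧ q = otherEnd a) := by
    intro p q
    unfold Neighbours
    rw [hs', pair_infix_append, @pair_infix_append _ p q [b] w, hdw]
    simp only [pair_infix_singleton, List.getLast?_singleton, Option.some.injEq, false_or,
      List.singleton_append, List.head?_cons]
    rw [@eq_comm _ b p, @eq_comm _ b q, @eq_comm _ (otherEnd a) q]
    tauto
  have nbo : ∀ p q, π.Neighbours s.opp p q ↔ π'.Neighbours s.opp p q ∨ (p = z ∧ q = b) := by
    intro p q
    unfold Neighbours
    rw [h2, h4, @pair_infix_append _ p q (v' ++ [z]) [b], List.getLast?_concat]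
    simp only [pair_infix_singleton, Option.some.injEq, false_or, List.head?_cons]
    rw [@eq_comm _ b q, @eq_comm _ z p]
  have npo : ∀ p q, π'.Neighbours s.opp p q →
      (p ≠ b ∧ p ≠ a) ∧ (q ≠ b ∧ q ≠ otherEnd a) := by
    intro p q h
    have hm := pair_infix_mem h
    have hm' : ∀ x, x ∈ π'.word s.opp → x ≠ b := fun x hx e => π'.notMem_opp mb' (e ▸ hx)
    have hp := hm' p hm.1
    have hq := hm' q hm.2
    exact ⟨⟨hp, hdisj p ((hmem _ _ hp).1 hm.1) _ ma⟩, ⟨hq, hdisj q ((hmem _ _ hq).1 hm.2) _ mo⟩⟩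
  have mus : ∀ x, x ∈ u₁ → x ≠ b ∧ x ≠ a ∧ x ≠ otherEnd a := fun x hx =>
    ⟨fun e => hdisj b mb x (by rw [hs]; simp [hx]) e.symm, nuw x hx a maw, nuw x hx _ mow⟩
  have npu : ∀ p q, [p, q] <:+: u₁ → (p ≠ b ∧ p ≠ a) ∧ (q ≠ b ∧ q ≠ otherEnd a) := by
    intro p q h
    have hm := pair_infix_mem h
    exact ⟨⟨(mus p hm.1).1, (mus p hm.1).2.1⟩, ⟨(mus q hm.2).1, (mus q hm.2).2.2⟩⟩
  have npw : ∀ p q, [p, q] <:+: w → (p ≠ b ∧ p ≠ a) ∧ (q ≠ b ∧ q ≠ otherEnd a) := by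
    intro p q h
    have hm := pair_infix_mem h
    have hb : ∀ x ∈ w, x ≠ b := fun x hx e => hdisj b mb x (by rw [hs]; simp [hx]) e.symm
    refine ⟨⟨hb p hm.1, fun e => pair_infix_not_last nw h (by rw [lw, e])⟩,
      ⟨hb q hm.2, fun e => pair_infix_not_head nw h (by rw [hdw, e])⟩⟩
  classical
  have bead : ∀ h, π.SameCircle (a, h) (otherEnd a, h.opp) := fun h => band_same' ma mo
  have bead' : ∀ h, π'.SameCircle (a, h) (otherEnd a, h.opp) := fun h =>
    band_same' ((hmem _ _ hba.symm).2 ma) ((hmem _ _ hbo.symm).2 mo)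
  have rend : π.SameCircle (a, .right) (b, .right) := same_right la lb
  have rend' : π'.SameCircle (a, .right) (z, .right) := same_right la' lz'
  have cusp : ∀ t p q, π.Neighbours t p q → π.SameCircle (p, .right) (q, .left) :=
    fun t p q h => (BoundaryStep.cusp t p q h).same
  have cusp' : ∀ t p q, π'.Neighbours t p q → π'.SameCircle (p, .right) (q, .left) :=
    fun t p q h => (BoundaryStep.cusp t p q h).same
  have zb : π.SameCircle (z, .right) (b, .left) := cusp _ _ _ ((nbo _ _).2 (.inr ⟨rfl, rfl⟩))
  have bo' : π'.SameCircle (b, .right) (otherEnd a, .left) :=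
    cusp' _ _ _ ((nb' _ _).2 (.inr (.inr (.inr ⟨rfl, rfl⟩))))
  -- The right edge of `a` and the left edge of `otherEnd a` form the edge along which `b` slides.
  -- The parameter `c` is the edge to which they are attached at the right end, after the flip of
  -- `b`.
  let F₀ : BandEnd d × Hand → BandEnd d × Hand → BandEnd d × Hand := fun c g =>
    if g.1 = b then (b, g.2.opp) else
      if g = (a, .right) ∨ g = (otherEnd a, .left) then c else g
  let F := F₀ (z, .right)
  let F' := F₀ (b, .left)
  have Gb : ∀ c h, F₀ c (b, h) = (b, h.opp) := fun c h => by simp [F₀]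
  have Ga : ∀ c, F₀ c (a, .right) = c := fun c => by simp [F₀, hba.symm]
  have Go : ∀ c, F₀ c (otherEnd a, .left) = c := fun c => by simp [F₀, hbo.symm]
  have Gr : ∀ c x, x ≠ b ∧ x ≠ a → F₀ c (x, .right) = (x, .right) := fun c x hx => by
    simp [F₀, hx.1, hx.2]
  have Gl : ∀ c x, x ≠ b ∧ x ≠ otherEnd a → F₀ c (x, .left) = (x, .left) := fun c x hx => by
    simp [F₀, hx.1, hx.2]
  have Gx : ∀ c x h, x ≠ b → x ≠ a → x ≠ otherEnd a → F₀ c (x, h) = (x, h) := fun c x h k1 k2 k3 => by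
    simp [F₀, k1, k2, k3]
  have bandA : ∀ (ρ : Pattern d) c x h, (∀ h, ρ.SameCircle (a, h) (otherEnd a, h.opp)) →
      (x = a ∨ x = otherEnd a) → ρ.SameCircle (F₀ c (x, h)) (F₀ c (otherEnd x, h.opp)) := by
    rintro ρ c x h hρ (rfl | rfl)
    · cases h
      · rw [Gl _ _ ⟨hba.symm, hoa.symm⟩]
        exact (hρ _).trans (by rw [show Hand.left.opp = .right from rfl, Gr _ _ ⟨hbo.symm, hoa⟩]; exact .refl _)
      · rw [show Hand.right.opp = .left from rfl, Ga, Go]; exact .refl _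
    · rw [otherEnd_otherEnd]
      cases h
      · rw [show Hand.left.opp = .right from rfl, Ga, Go]; exact .refl _
      · rw [show Hand.right.opp = .left from rfl, Gl _ _ ⟨hba.symm, hoa.symm⟩,
          Gr _ _ ⟨hbo.symm, hoa⟩]
        exact (hρ .left).symm
  have bandB : ∀ (ρ : Pattern d) c h k, ρ.SameCircle (b, h.opp) (otherEnd b, k) →
      ρ.SameCircle (F₀ c (b, h)) (F₀ c (otherEnd b, k)) := by
    intro ρ c h k hρ
    rw [Gb, Gx c _ _ hob hoba hobo]; exact hρ
  have norevA : ∀ t x, x ∈ π.word t → otherEnd x ∈ π.word t.opp → x ≠ a ∧ x ≠ otherEnd a := by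
    intro t x m1 m2
    constructor
    · rintro rfl
      obtain rfl := π.side_unique ma m1
      exact π.notMem_opp mo m2
    · rintro rfl
      rw [otherEnd_otherEnd] at m2
      obtain rfl := π.side_unique mo m1
      exact π.notMem_opp ma m2
  have oa_ne : ∀ x, x ≠ a ∧ x ≠ otherEnd a → otherEnd x ≠ a ∧ otherEnd x ≠ otherEnd a :=
    fun x hx => ⟨fun e => hx.2 (by rw [← e, otherEnd_otherEnd]),
      fun e => hx.1 (by simpa using congrArg otherEnd e)⟩
  -- the band of `b`
  have bpres : ∀ t, b ∈ π'.word t → otherEnd b ∈ π'.word t.opp →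
      ∀ h : Hand, π.SameCircle (b, h.opp) (otherEnd b, h) := by
    intro t m1 m2 h
    obtain rfl := π'.side_unique mb' m1
    rw [hmem _ _ hob] at m2
    simpa using band_same' (h := h.opp) mb m2
  have brev : ∀ t, b ∈ π'.word t → otherEnd b ∈ π'.word t →
      ∀ h : Hand, π.SameCircle (b, h.opp) (otherEnd b, h.opp) := by
    intro t m1 m2 h
    obtain rfl := π'.side_unique mb' m1
    rw [hmem _ _ hob] at m2
    exact band_same mb (by rwa [Side.opp_opp])
  have bpres' : ∀ t, b ∈ π.word t → otherEnd b ∈ π.word t.opp →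
      ∀ h : Hand, π'.SameCircle (b, h.opp) (otherEnd b, h) := by
    intro t m1 m2 h
    obtain rfl := π.side_unique mb m1
    rw [← hmem _ _ hob, Side.opp_opp] at m2
    simpa using band_same' (h := h.opp) mb' m2
  have brev' : ∀ t, b ∈ π.word t → otherEnd b ∈ π.word t →
      ∀ h : Hand, π'.SameCircle (b, h.opp) (otherEnd b, h.opp) := by
    intro t m1 m2 h
    obtain rfl := π.side_unique mb m1
    rw [← hmem _ _ hob] at m2
    exact band_same mb' m2
  -- The new cusp between `b` and `otherEnd a` corresponds to the old one between `z` and `b`. The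
  -- cusp on the left of `otherEnd a`, if any, passes to the left of `b` and keeps its recording
  -- end.
  refine hc.of_maps F F' ?_ ?_ ?_ (Equiv.swap b z) ?_ ?_
  · intro g g' hst
    cases hst with
    | preserving t x h m1 m2 =>
      by_cases e1 : x = b
      · subst e1
        exact bandB π _ h h (bpres t m1 m2 h)
      by_cases e2 : otherEnd x = b
      · have e3 : x = otherEnd b := by rw [← e2, otherEnd_otherEnd]
        subst e3
        rw [otherEnd_otherEnd] at m2 ⊢
        exact (bandB π _ h h (bpres t.opp m2 (by rwa [Side.opp_opp]) h)).symm
      rw [hmem _ _ e1] at m1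
      rw [hmem _ _ e2] at m2
      have hx := norevA t x m1 m2
      have hx' := oa_ne x hx
      simp only [F]
      rw [Gx _ _ _ e1 hx.1 hx.2, Gx _ _ _ e2 hx'.1 hx'.2]
      exact band_same m1 m2
    | reversing t x h m1 m2 =>
      by_cases e1 : x = b
      · subst e1
        exact bandB π _ h h.opp (brev t m1 m2 h)
      by_cases e2 : otherEnd x = b
      · have e3 : x = otherEnd b := by rw [← e2, otherEnd_otherEnd]
        subst e3
        rw [otherEnd_otherEnd] at m2 ⊢
        have := bandB π (z, .right) h.opp h (by simpa using brev t m2 m1 h.opp)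
        exact this.symm
      rw [hmem _ _ e1] at m1
      rw [hmem _ _ e2] at m2
      by_cases hx : x = a ∨ x = otherEnd a
      · exact bandA π _ x h bead hx
      · push Not at hx
        have hx' := oa_ne x hx
        simp only [F]
        rw [Gx _ _ _ e1 hx.1 hx.2, Gx _ _ _ e2 hx'.1 hx'.2]
        exact band_same' m1 m2
    | cusp t p q hpq =>
      simp only [F]
      rcases s.eq_or_eq_opp t with rfl | rfl
      · rcases (nb' p q).1 hpq with h | h | ⟨h, rfl⟩ | ⟨rfl, rfl⟩
        · rw [Gr _ p (npu p q h).1, Gl _ q (npu p q h).2]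
          exact cusp _ _ _ ((nb p q).2 (.inl h))
        · rw [Gr _ p (npw p q h).1, Gl _ q (npw p q h).2]
          exact cusp _ _ _ ((nb p q).2 (.inr (.inl h)))
        · have := mus p (List.mem_of_getLast? h)
          rw [Gr _ p ⟨this.1, this.2.1⟩, Gb]
          exact (cusp _ _ _ ((nb p _).2 (.inr (.inr ⟨h, rfl⟩)))).trans
            ((bead .right).symm.trans rend)
        · rw [Gb, Go]
          exact zb.symm
      · have h := npo p q hpq
        rw [Gr _ p h.1, Gl _ q h.2]
        exact cusp _ _ _ ((nbo p q).2 (.inl hpq))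
    | leftEnd p q k1 k2 =>
      obtain ⟨p', q', kp, kq, hcase⟩ : ∃ p' q', (π'.word s).head? = some p' ∧
          (π'.word s.opp).head? = some q' ∧ ((p = p' ∧ q = q') ∨ (p = q' ∧ q = p')) := by
        cases s
        · exact ⟨p, q, k1, k2, .inl ⟨rfl, rfl⟩⟩
        · exact ⟨q, p, k2, k1, .inr ⟨rfl, rfl⟩⟩
      have goal : π.SameCircle (F (p', .left)) (F (q', .left)) := by
        have hq1 : (π.word s.opp).head? = some q' := by
          rw [h2, ← h4]
          rw [List.head?_append, kq]; rfl
        have hq2 : q' ≠ b ∧ q' ≠ otherEnd a := by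
          have hm := List.mem_of_head? kq
          have e : q' ≠ b := fun e => π'.notMem_opp mb' (e ▸ hm)
          exact ⟨e, hdisj q' ((hmem _ _ e).1 hm) _ mo⟩
        simp only [F]
        rw [Gl _ q' hq2]
        rcases u₁ with _ | ⟨x, u₁⟩
        · rw [hs'] at kp
          simp only [List.nil_append, List.singleton_append, List.head?_cons,
            Option.some.injEq] at kp
          subst kp
          rw [Gb]
          refine (rend.symm.trans (bead .right)).trans (same_left ?_ hq1)
          rw [hs]; rfl
        · rw [hs'] at kp
          simp only [List.cons_append, List.head?_cons, Option.some.injEq] at kp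
          subst kp
          have := mus x (by simp)
          rw [Gl _ x ⟨this.1, this.2.2⟩]
          refine same_left ?_ hq1
          rw [hs]; rfl
      rcases hcase with ⟨rfl, rfl⟩ | ⟨rfl, rfl⟩
      · exact goal
      · exact goal.symm
    | rightEnd p q k1 k2 =>
      have : (p = a ∧ q = z) ∨ (p = z ∧ q = a) := by
        cases s
        · rw [la'] at k1
          simp only [Side.opp] at lz'
          rw [lz'] at k2
          left; simpa [eq_comm] using And.intro k1 k2
        · rw [la'] at k2
          simp only [Side.opp] at lz'
          rw [lz'] at k1
          right; simpa [eq_comm] using And.intro k1 k2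
      simp only [F]
      rcases this with ⟨rfl, rfl⟩ | ⟨rfl, rfl⟩
      · rw [Ga, Gr _ _ ⟨hzb, hza⟩]; exact .refl _
      · rw [Ga, Gr _ _ ⟨hzb, hza⟩]; exact .refl _
  · intro g g' hst
    cases hst with
    | preserving t x h m1 m2 =>
      by_cases e1 : x = b
      · subst e1
        exact bandB π' _ h h (bpres' t m1 m2 h)
      by_cases e2 : otherEnd x = b
      · have e3 : x = otherEnd b := by rw [← e2, otherEnd_otherEnd]
        subst e3
        rw [otherEnd_otherEnd] at m2 ⊢
        exact (bandB π' _ h h (bpres' t.opp m2 (by rwa [Side.opp_opp]) h)).symm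
      have hx := norevA t x m1 m2
      rw [← hmem _ _ e1] at m1
      rw [← hmem _ _ e2] at m2
      have hx' := oa_ne x hx
      simp only [F']
      rw [Gx _ _ _ e1 hx.1 hx.2, Gx _ _ _ e2 hx'.1 hx'.2]
      exact band_same m1 m2
    | reversing t x h m1 m2 =>
      by_cases e1 : x = b
      · subst e1
        exact bandB π' _ h h.opp (brev' t m1 m2 h)
      by_cases e2 : otherEnd x = b
      · have e3 : x = otherEnd b := by rw [← e2, otherEnd_otherEnd]
        subst e3
        rw [otherEnd_otherEnd] at m2 ⊢
        have := bandB π' (b, .left) h.opp h (by simpa using brev' t m2 m1 h.opp)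
        exact this.symm
      rw [← hmem _ _ e1] at m1
      rw [← hmem _ _ e2] at m2
      by_cases hx : x = a ∨ x = otherEnd a
      · exact bandA π' _ x h bead' hx
      · push Not at hx
        have hx' := oa_ne x hx
        simp only [F']
        rw [Gx _ _ _ e1 hx.1 hx.2, Gx _ _ _ e2 hx'.1 hx'.2]
        exact band_same' m1 m2
    | cusp t p q hpq =>
      simp only [F']
      rcases s.eq_or_eq_opp t with rfl | rfl
      · rcases (nb p q).1 hpq with h | h | ⟨h, rfl⟩
        · rw [Gr _ p (npu p q h).1, Gl _ q (npu p q h).2]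
          exact cusp' _ _ _ ((nb' p q).2 (.inl h))
        · rw [Gr _ p (npw p q h).1, Gl _ q (npw p q h).2]
          exact cusp' _ _ _ ((nb' p q).2 (.inr (.inl h)))
        · have := mus p (List.mem_of_getLast? h)
          rw [Gr _ p ⟨this.1, this.2.1⟩, Go]
          exact cusp' _ _ _ ((nb' p _).2 (.inr (.inr (.inl ⟨h, rfl⟩))))
      · rcases (nbo p q).1 hpq with hpq | ⟨rfl, rfl⟩
        · have h := npo p q hpq
          rw [Gr _ p h.1, Gl _ q h.2]
          exact cusp' _ _ _ hpq
        · rw [Gb, Gr _ _ ⟨hzb, hza⟩]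
          exact rend'.symm.trans ((bead' .right).trans bo'.symm)
    | leftEnd p q k1 k2 =>
      obtain ⟨p', q', kp, kq, hcase⟩ : ∃ p' q', (π.word s).head? = some p' ∧
          (π.word s.opp).head? = some q' ∧ ((p = p' ∧ q = q') ∨ (p = q' ∧ q = p')) := by
        cases s
        · exact ⟨p, q, k1, k2, .inl ⟨rfl, rfl⟩⟩
        · exact ⟨q, p, k2, k1, .inr ⟨rfl, rfl⟩⟩
      have goal : π'.SameCircle (F' (p', .left)) (F' (q', .left)) := by
        have hq1 : (π'.word s.opp).head? = some q' := by
          rw [h2] at kq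
          rw [h4]
          cases v' <;> simpa using kq
        have hq2 : q' ≠ b ∧ q' ≠ otherEnd a := by
          have hm := List.mem_of_head? hq1
          have e : q' ≠ b := fun e => π'.notMem_opp mb' (e ▸ hm)
          exact ⟨e, hdisj q' ((hmem _ _ e).1 hm) _ mo⟩
        simp only [F']
        rw [Gl _ q' hq2]
        rcases u₁ with _ | ⟨x, u₁⟩
        · rw [hs] at kp
          rw [List.nil_append, hdw] at kp
          simp only [Option.some.injEq] at kp
          subst kp
          rw [Go]
          refine same_left ?_ hq1
          rw [hs']; rfl
        · rw [hs] at kp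
          simp only [List.cons_append, List.head?_cons, Option.some.injEq] at kp
          subst kp
          have := mus x (by simp)
          rw [Gl _ x ⟨this.1, this.2.2⟩]
          refine same_left ?_ hq1
          rw [hs']; rfl
      rcases hcase with ⟨rfl, rfl⟩ | ⟨rfl, rfl⟩
      · exact goal
      · exact goal.symm
    | rightEnd p q k1 k2 =>
      have : (p = a ∧ q = b) ∨ (p = b ∧ q = a) := by
        cases s
        · rw [la] at k1
          simp only [Side.opp] at lb
          rw [lb] at k2
          left; simpa [eq_comm] using And.intro k1 k2
        · rw [la] at k2
          simp only [Side.opp] at lb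
          rw [lb] at k1
          right; simpa [eq_comm] using And.intro k1 k2
      simp only [F']
      rcases this with ⟨rfl, rfl⟩ | ⟨rfl, rfl⟩
      · rw [Ga, Gb]; exact .refl _
      · rw [Ga, Gb]; exact .refl _
  · rintro ⟨x, h⟩
    simp only [F, F']
    by_cases e1 : x = b
    · subst e1
      rw [Gb, Gb, Hand.opp_opp]; exact .refl _
    have hz := Gr (b, .left) z ⟨hzb, hza⟩
    have hz2 : π'.SameCircle (otherEnd a, .left) (z, .right) :=
      (bead' .right).symm.trans rend'
    cases h
    · by_cases e2 : x = otherEnd a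
      · subst e2
        rw [Go, hz]; exact hz2.symm
      · rw [Gl _ x ⟨e1, e2⟩, Gl _ x ⟨e1, e2⟩]; exact .refl _
    · by_cases e2 : x = a
      · subst e2
        rw [Ga, hz]; exact rend'.symm
      · rw [Gr _ x ⟨e1, e2⟩, Gr _ x ⟨e1, e2⟩]; exact .refl _
  · intro x
    rw [forall_last_ne_iff la' lz', forall_last_ne_iff la lb]
    refine and_congr (not_congr ?_) (not_congr ?_)
    · rw [Equiv.swap_apply_eq_iff, Equiv.swap_apply_of_ne_of_ne hba.symm hza.symm]
    · rw [Equiv.swap_apply_eq_iff, Equiv.swap_apply_left]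
  · intro x hx
    rw [forall_last_ne_iff la' lz'] at hx
    simp only [F]
    by_cases e2 : x = b
    · subst e2
      rw [Equiv.swap_apply_left, Gb]
      exact zb
    rw [Equiv.swap_apply_of_ne_of_ne e2 hx.2, Gr _ x ⟨e2, hx.1⟩]
    exact .refl _

/-- Completeness is preserved by splits. -/
theorem IsSplit.isComplete {π π' : Pattern d} {s : Side} {a b : BandEnd d}
    (h : IsSplit π s a b π') (hc : π.IsComplete) (hv : π'.word s.opp ≠ []) : π'.IsComplete := by
  cases h with
  | preserving u v₁ v₂ h1 h2 h3 h4 => exact isComplete_preserving hc h1 h2 h3 h4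
  | reversing u₁ u₂ v h1 h2 h3 h4 => exact isComplete_reversing hc h1 h2 h3 h4 (h4 ▸ hv)

end BandExchange

/-! ### Parity: no classical block at either end of a complete pattern -/

namespace BandExchange

variable {d : ℕ}

theorem ncard_le_of_rel {α : Type*} [Finite α] {S T : Set α} (R : α → α → Prop)
    (h : ∀ x ∈ S, ∃ y ∈ T, R x y) (hi : ∀ x x' y, R x y → R x' y → x = x') :
    S.ncard ≤ T.ncard := by
  choose! f hf using h
  refine Set.ncard_le_ncard_of_injOn f (fun x hx => (hf x hx).1) ?_ (Set.toFinite T)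
  intro x hx x' hx' e
  exact hi x x' (f x) (hf x hx).2 (by rw [e]; exact (hf x' hx').2)

theorem even_ncard_of_otherEnd {S : Set (BandEnd d)} (h : ∀ x ∈ S, otherEnd x ∈ S) :
    Even S.ncard := by
  classical
  rw [Set.ncard_eq_toFinset_card S (Set.toFinite S), ← ZMod.natCast_eq_zero_iff_even]
  have := Finset.sum_involution (s := (Set.toFinite S).toFinset) (f := fun _ => (1 : ZMod 2))
    (fun x _ => otherEnd x) (fun _ _ => by decide) (fun x _ _ => otherEnd_ne x)
    (fun x hx => by simpa using h x (by simpa using hx)) (fun x _ => otherEnd_otherEnd x)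
  simpa using this

namespace Pattern

variable {π : Pattern d}

theorem even_ncard_diff_pair {α : Type*} [Finite α] {S : Set α} {x y : α} (hS : Even S.ncard)
    (hxy : x ≠ y) (h : x ∈ S ↔ y ∈ S) : Even (S \ {x, y}).ncard := by
  by_cases hx : x ∈ S
  · have h1 : ({x, y} : Set α) ⊆ S := by
      rintro z (rfl | rfl)
      · exact hx
      · exact h.1 hx
    rw [Set.ncard_sdiff h1, Set.ncard_pair hxy]
    rcases hS with ⟨k, hk⟩
    exact ⟨k - 1, by omega⟩
  · have hy : y ∉ S := fun hy => hx (h.2 hy)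
    have : S \ {x, y} = S := by
      ext z
      simp only [Set.mem_sdiff, Set.mem_insert_iff, Set.mem_singleton_iff, and_iff_left_iff_imp]
      rintro hz (rfl | rfl)
      · exact hx hz
      · exact hy hz
    rwa [this]

/-- A complete pattern has no initial part that is closed under the bands and consists of bands
joining the top to the bottom. -/
theorem IsComplete.no_classical_prefix (hπ : π.IsComplete) {X Y : Side → List (BandEnd d)}
    (hw : ∀ s, π.word s = X s ++ Y s) (hX : ∀ s, ∀ x ∈ X s, otherEnd x ∈ X s.opp)
    (hne : X .top ≠ []) (hY : (∀ s, Y s = []) ∨ ∀ s, Y s ≠ []) : False := by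
  classical
  have hmX : ∀ s x, x ∈ X s → x ∈ π.word s := fun s x hx => by rw [hw]; simp [hx]
  have hmY : ∀ s x, x ∈ Y s → x ∈ π.word s := fun s x hx => by rw [hw]; simp [hx]
  have hdXY : ∀ s x, x ∈ X s → x ∉ Y s := fun s x hx hy => by
    have := π.nodup_word s
    rw [hw, List.nodup_append] at this
    exact this.2.2 x hx x hy rfl
  have hnX : ∀ s, X s ≠ [] := by
    obtain ⟨x, hx⟩ := List.exists_mem_of_ne_nil _ hne
    intro s
    cases s
    · exact hne
    · exact List.ne_nil_of_mem (hX _ x hx)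
  set D : Set (BandEnd d) := {x | ∃ s, x ∈ X s} with hD
  have hDX : ∀ s x, x ∈ π.word s → x ∈ D → x ∈ X s := by
    rintro s x hx ⟨t, ht⟩
    have := π.side_unique hx (hmX t x ht)
    exact this ▸ ht
  have hDo : ∀ x, x ∈ D → otherEnd x ∈ D := fun x ⟨s, hs⟩ => ⟨_, hX s x hs⟩
  have hDo' : ∀ x, x ∈ D ↔ otherEnd x ∈ D :=
    fun x => ⟨hDo x, fun h => by simpa using hDo _ h⟩
  have hrev : ∀ s x, x ∈ π.word s → otherEnd x ∈ π.word s → x ∉ D := by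
    rintro s x h1 h2 hx
    have := hX s x (hDX s x h1 hx)
    exact π.notMem_opp h2 (hmX _ _ this)
  have hband : ∀ h x, x ∈ D → π.SameCircle (x, h) (otherEnd x, h) := fun h x ⟨s, hs⟩ =>
    band_same (hmX s x hs) (hmX _ _ (hX s x hs))
  set F : Side → BandEnd d := fun s => (X s).head (hnX s) with hF
  have hFh : ∀ s, (π.word s).head? = some (F s) := fun s => by
    rw [hw, List.head?_append, List.head?_eq_some_head (hnX s)]; rfl
  have hFX : ∀ s, F s ∈ X s := fun s => List.head_mem _
  set L : Side → BandEnd d := fun s => (X s).getLast (hnX s) with hL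
  have hLX : ∀ s, L s ∈ X s := fun s => List.getLast_mem _
  have htb : ∀ x y, x ∈ X .top → y ∈ X .bot → x ≠ y := fun x y hx hy e =>
    π.notMem_opp (hmX _ _ hx) (hmX .bot _ (e ▸ hy))
  -- The circle examined is the one that passes around the left end of the interval.
  set g : BandEnd d × Hand := (F .top, .left) with hg
  have hFg : ∀ s, π.SameCircle (F s, .left) g := by
    intro s
    cases s
    · exact .refl _
    · exact same_left (s := .bot) (hFh _) (hFh _)
  -- Bands of the block join top to bottom, so an edge and its continuation at the other end of the
  -- band have the same hand. The fixed-point-free involution `otherEnd` thus acts on `r` and on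
  -- `l`, and both are even, whereas a circle must have an odd number of cusps.
  set r : Set (BandEnd d) := {x | x ∈ D ∧ π.SameCircle (x, .right) g} with hr
  set l : Set (BandEnd d) := {x | x ∈ D ∧ π.SameCircle (x, .left) g} with hl
  have er : Even r.ncard := even_ncard_of_otherEnd fun x hx =>
    ⟨hDo x hx.1, (hband _ x hx.1).symm.trans hx.2⟩
  have lo : ∀ x, x ∈ l → otherEnd x ∈ l := fun x hx =>
    ⟨hDo x hx.1, (hband _ x hx.1).symm.trans hx.2⟩
  have el : Even l.ncard := even_ncard_of_otherEnd lo
  -- neighbours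
  have nbX : ∀ s x y, π.Neighbours s x y → y ∈ X s → [x, y] <:+: X s := by
    intro s x y h hy
    unfold Neighbours at h
    rw [hw, pair_infix_append] at h
    rcases h with h | h | h
    · exact h
    · exact absurd (pair_infix_mem h).2 (hdXY s y hy)
    · exact absurd (List.mem_of_head? h.2) (hdXY s y hy)
  have nbL : ∀ s x y, π.Neighbours s x y → x ∈ X s → x ≠ L s → [x, y] <:+: X s := by
    intro s x y h hx hxL
    unfold Neighbours at h
    rw [hw, pair_infix_append] at h
    rcases h with h | h | h
    · exact h
    · exact absurd (pair_infix_mem h).1 (hdXY s x hx)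
    · rw [List.getLast?_eq_some_getLast (hnX s), Option.some.injEq] at h
      exact absurd h.1.symm hxL
  have nX : ∀ s, (X s).Nodup := fun s => by
    have := π.nodup_word s
    rw [hw, List.nodup_append] at this; exact this.1
  have infixN : ∀ s x y, [x, y] <:+: X s → π.Neighbours s x y := fun s x y h => by
    unfold Neighbours; rw [hw, pair_infix_append]; exact .inl h
  have hcs : ∀ s x y, π.Neighbours s x y → π.SameCircle (x, .right) (y, .left) := fun s x y h =>
    (BoundaryStep.cusp s x y h).same
  have hcount : r \ {L .top, L .bot} ⊆ r := Set.sdiff_subset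
  -- A cusp inside the block matches the right edge of one end with the left edge of the next.
  -- Unmatched are only the right edges of the two last ends and the left edges of the two first
  -- ends.
  have card_eq : (r \ {L .top, L .bot}).ncard = (l \ {F .top, F .bot}).ncard := by
    apply le_antisymm
    · refine ncard_le_of_rel (fun x y => ∃ s, π.Neighbours s x y) ?_ ?_
      · rintro x ⟨⟨⟨s, hs⟩, hx⟩, hx2⟩
        have hxL : x ≠ L s := by
          rintro rfl; apply hx2; cases s <;> simp
        obtain ⟨y, hy⟩ := exists_pair_infix hs
          (by rw [List.getLast?_eq_some_getLast (hnX s)]; simpa using hxL.symm)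
        refine ⟨y, ⟨⟨⟨s, (pair_infix_mem hy).2⟩, (hcs s x y (infixN s x y hy)).symm.trans hx⟩, ?_⟩,
          s, infixN s x y hy⟩
        have hys := (pair_infix_mem hy).2
        rintro (e | e)
        · have hs2 : y ∈ X .top := e ▸ hFX _
          obtain rfl := π.side_unique (hmX _ _ hys) (hmX _ _ hs2)
          exact pair_infix_not_head (nX _) hy (by rw [e, List.head?_eq_some_head (hnX _)])
        · have e : y = F .bot := e
          have hs2 : y ∈ X .bot := e ▸ hFX _
          obtain rfl := π.side_unique (hmX _ _ hys) (hmX _ _ hs2)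
          exact pair_infix_not_head (nX _) hy (by rw [e, List.head?_eq_some_head (hnX _)])
      · rintro x x' y ⟨s, h⟩ ⟨t, h'⟩
        obtain rfl := π.side_unique (pair_infix_mem h).2 (pair_infix_mem h').2
        exact pair_infix_left_unique (π.nodup_word _) h h'
    · refine ncard_le_of_rel (fun y x => ∃ s, π.Neighbours s x y) ?_ ?_
      · rintro y ⟨⟨⟨s, hs⟩, hy⟩, hy2⟩
        have hyF : y ≠ F s := by
          rintro rfl; apply hy2; cases s <;> simp
        obtain ⟨x, hx⟩ := exists_pair_infix_left hs
          (by rw [List.head?_eq_some_head (hnX s)]; simpa using hyF.symm)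
        refine ⟨x, ⟨⟨⟨s, (pair_infix_mem hx).1⟩, (hcs s x y (infixN s x y hx)).trans hy⟩, ?_⟩,
          s, infixN s x y hx⟩
        have hxs := (pair_infix_mem hx).1
        rintro (e | e)
        · have hs2 : x ∈ X .top := e ▸ hLX _
          obtain rfl := π.side_unique (hmX _ _ hxs) (hmX _ _ hs2)
          exact pair_infix_not_last (nX _) hx (by rw [e, List.getLast?_eq_some_getLast (hnX _)])
        · have e : x = L .bot := e
          have hs2 : x ∈ X .bot := e ▸ hLX _
          obtain rfl := π.side_unique (hmX _ _ hxs) (hmX _ _ hs2)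
          exact pair_infix_not_last (nX _) hx (by rw [e, List.getLast?_eq_some_getLast (hnX _)])
      · rintro y y' x ⟨s, h⟩ ⟨t, h'⟩
        obtain rfl := π.side_unique (pair_infix_mem h).1 (pair_infix_mem h').1
        exact pair_infix_right_unique (π.nodup_word _) h h'
  have Fl : ∀ s, F s ∈ l := fun s => ⟨⟨s, hFX s⟩, hFg s⟩
  have hFne : F .top ≠ F .bot := htb _ _ (hFX _) (hFX _)
  have hLne : L .top ≠ L .bot := htb _ _ (hLX _) (hLX _)
  have el' : Even (l \ {F .top, F .bot}).ncard :=
    even_ncard_diff_pair el hFne (by simp [Fl])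
  have er' : Even (r \ {L .top, L .bot}).ncard := card_eq ▸ el'
  have hc3 : π.cuspCount g = 1 ∨ π.cuspCount g = 3 := hπ g
  -- the circle is confined to the initial part
  have conf : (∀ s, Y s = []) ∨ (L .top ∉ r ∧ L .bot ∉ r) →
      ∀ x, π.SameCircle (x, .right) g → x ∈ D := by
    intro hcase x hx
    have hP := SameCircle.mem_iff (π := π) (P := {p | p.1 ∈ D ∧ π.SameCircle p g}) ?_ hx
    · have : g ∈ {p : BandEnd d × Hand | p.1 ∈ D ∧ π.SameCircle p g} := ⟨⟨_, hFX _⟩, .refl _⟩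
      exact (hP.2 this).1
    · intro p p' hs
      have hss := hs.same
      have : p.1 ∈ D → π.SameCircle p g → p'.1 ∈ D := by
        intro h1 h2
        cases hs with
        | preserving t c h m1 m2 => exact hDo _ h1
        | reversing t c h m1 m2 => exact absurd h1 (hrev t c m1 m2)
        | cusp t c y hn =>
          have hcX := hDX t c (pair_infix_mem hn).1 h1
          rcases hcase with hcase | hcase
          · have := (pair_infix_mem hn).2
            rw [hw, hcase, List.append_nil] at this
            exact ⟨t, this⟩
          · have hcL : c ≠ L t := by
              rintro rfl
              cases t
              · exact hcase.1 ⟨h1, h2⟩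
              · exact hcase.2 ⟨h1, h2⟩
            exact ⟨t, (pair_infix_mem (nbL t c y hn hcX hcL)).2⟩
        | leftEnd c y k1 k2 =>
          rw [hFh] at k2
          simp only [Option.some.injEq] at k2
          exact ⟨.bot, k2 ▸ hFX _⟩
        | rightEnd c y k1 k2 =>
          rcases hcase with hcase | hcase
          · have := List.mem_of_getLast? k2
            rw [hw, hcase, List.append_nil] at this
            exact ⟨_, this⟩
          · by_cases hYe : ∀ s, Y s = []
            · have := List.mem_of_getLast? k2
              rw [hw, hYe, List.append_nil] at this
              exact ⟨_, this⟩
            · have hY := hY.resolve_left hYe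
              rw [hw, List.getLast?_append, List.getLast?_eq_some_getLast (hY _)] at k1
              simp only [Option.some_or, Option.some.injEq] at k1
              have m : c ∈ Y .top := k1 ▸ List.getLast_mem _
              exact absurd m (hdXY _ _ (hDX _ _ (hmY _ _ m) h1))
      have this' : p'.1 ∈ D → π.SameCircle p' g → p.1 ∈ D := by
        intro h1 h2
        cases hs with
        | preserving t c h m1 m2 => exact (hDo' _).2 h1
        | reversing t c h m1 m2 =>
          exact absurd h1 (hrev t _ m2 (by rwa [otherEnd_otherEnd]))
        | cusp t c y hn =>
          have hyX := hDX t y (pair_infix_mem hn).2 h1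
          exact ⟨t, (pair_infix_mem (nbX t c y hn hyX)).1⟩
        | leftEnd c y k1 k2 =>
          rw [hFh] at k1
          simp only [Option.some.injEq] at k1
          exact ⟨.top, k1 ▸ hFX _⟩
        | rightEnd c y k1 k2 =>
          rcases hY with hY | hY
          · have := List.mem_of_getLast? k1
            rw [hw, hY, List.append_nil] at this
            exact ⟨_, this⟩
          · rw [hw, List.getLast?_append, List.getLast?_eq_some_getLast (hY _)] at k2
            simp only [Option.some_or, Option.some.injEq] at k2
            have m : y ∈ Y .bot := k2 ▸ List.getLast_mem _
            exact absurd m (hdXY _ _ (hDX _ _ (hmY _ _ m) h1))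
      exact ⟨fun h => ⟨this h.1 h.2, hss.symm.trans h.2⟩,
        fun h => ⟨this' h.1 h.2, hss.trans h.2⟩⟩
  rcases hY with hY | hY
  · -- everything is classical
    have hlast : ∀ s, (π.word s).getLast? = some (L s) := fun s => by
      rw [hw, hY, List.append_nil, List.getLast?_eq_some_getLast (hnX s)]
    have : {x : BandEnd d | (∃ s b, π.Neighbours s x b) ∧ π.SameCircle (x, .right) g} =
        r \ {L .top, L .bot} := by
      ext x
      simp only [Set.mem_ofPred_eq, Set.mem_sdiff, exists_neighbours_iff, hr]
      rw [forall_last_ne_iff (hlast .top) (hlast .bot)]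
      simp only [Set.mem_insert_iff, Set.mem_singleton_iff, not_or]
      exact ⟨fun h => ⟨⟨conf (.inl hY) x h.2, h.2⟩, h.1⟩, fun h => ⟨h.2, h.1.2⟩⟩
    rw [cuspCount, this] at hc3
    rcases hc3 with h | h <;> rw [h] at er' <;> exact absurd er' (by decide)
  · have hcusp : ∀ x ∈ D, ∃ s b, π.Neighbours s x b := by
      rintro x ⟨s, hx⟩
      rw [exists_neighbours_iff]
      intro t ht
      have hm := List.mem_of_getLast? ht
      obtain rfl := π.side_unique (hmX _ _ hx) hm
      rw [hw, List.getLast?_append, List.getLast?_eq_some_getLast (hY _)] at ht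
      simp only [Option.some_or, Option.some.injEq] at ht
      exact hdXY _ _ hx (ht ▸ List.getLast_mem _)
    have hrsub : r ⊆ {x : BandEnd d | (∃ s b, π.Neighbours s x b) ∧
        π.SameCircle (x, .right) g} := fun x hx => ⟨hcusp x hx.1, hx.2⟩
    have hrle : r.ncard ≤ 3 := by
      have := Set.ncard_le_ncard hrsub (Set.toFinite _)
      unfold cuspCount at hc3
      omega
    by_cases hLL : L .top ∉ r ∧ L .bot ∉ r
    · have : {x : BandEnd d | (∃ s b, π.Neighbours s x b) ∧ π.SameCircle (x, .right) g} = r :=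
        Set.Subset.antisymm (fun x hx => ⟨conf (.inr hLL) x hx.2, hx.2⟩) hrsub
      rw [cuspCount, this] at hc3
      rcases hc3 with h | h <;> rw [h] at er <;> exact absurd er (by decide)
    · obtain ⟨s₀, hs₀⟩ : ∃ s, L s ∈ r := by
        by_contra! hcon
        exact hLL ⟨hcon .top, hcon .bot⟩
      have hlt : (r \ {L .top, L .bot}).ncard < r.ncard := by
        refine Set.ncard_lt_ncard ?_ (Set.toFinite _)
        refine ⟨Set.sdiff_subset, fun h => ?_⟩
        have := (h hs₀).2
        cases s₀ <;> simp at this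
      -- An even `r` of size at most three has at most two elements. Removing the last ends, one of
      -- which lies in `r`, leaves an even and smaller number, hence zero.
      have h0 : (l \ {F .top, F .bot}).ncard = 0 := by
        rw [← card_eq]
        obtain ⟨k, hk⟩ := er
        obtain ⟨k', hk'⟩ := er'
        omega
      rw [Set.ncard_eq_zero (Set.toFinite _), Set.sdiff_eq_empty] at h0
      -- the boundary pieces on the left form a circle of their own
      have hP := SameCircle.mem_iff (π := π) (P := {p | p.1 ∈ l ∧ p.2 = .left}) ?_ hs₀.2
      · have := hP.2 ⟨Fl _, rfl⟩
        exact absurd this.2 (by simp)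
      · intro p p' hs
        cases hs with
        | preserving t c h m1 m2 =>
          simp only [Set.mem_ofPred_eq]
          refine and_congr_left fun _ => ⟨lo _, fun h => by simpa using lo _ h⟩
        | reversing t c h m1 m2 =>
          have h1 : c ∉ l := fun h => hrev t c m1 m2 h.1
          have h2 : otherEnd c ∉ l := fun h => hrev t _ m2 (by rwa [otherEnd_otherEnd]) h.1
          simp only [Set.mem_ofPred_eq, h1, h2, false_and]
        | cusp t c y hn =>
          have : y ∉ l := by
            intro hy
            have hyt := (pair_infix_mem hn).2
            have : y = F t := by
              rcases h0 hy with e | e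
              · obtain rfl := π.side_unique hyt (hmX _ _ (e ▸ hFX .top))
                exact e
              · have e : y = F .bot := e
                obtain rfl := π.side_unique hyt (hmX _ _ (e ▸ hFX .bot))
                exact e
            exact pair_infix_not_head (π.nodup_word t) hn (by rw [hFh, this])
          simp [this]
        | leftEnd c y k1 k2 =>
          rw [hFh, Option.some.injEq] at k1 k2
          subst k1 k2
          simp [Fl]
        | rightEnd c y k1 k2 => simp

/-- The reflection of a pattern in a vertical line. -/
def mirror (π : Pattern d) : Pattern d where
  word s := (π.word s).reverse
  nodup := by
    have := π.nodup
    rw [List.nodup_append] at this ⊢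
    simpa using this
  mem a := by
    have := π.mem a
    rw [List.mem_append] at this ⊢
    simpa using this

theorem mirror_neighbours {s : Side} {a b : BandEnd d} :
    π.mirror.Neighbours s a b ↔ π.Neighbours s b a := by
  unfold Neighbours mirror
  simp only
  rw [← List.reverse_infix, List.reverse_reverse]
  simp

theorem mirror_mirror : π.mirror.mirror = π :=
  ext_word fun s => by simp [mirror]

theorem sameCircle_of_mirror {g g' : BandEnd d × Hand} (h : π.mirror.SameCircle g g') :
    π.SameCircle (g.1, g.2.opp) (g'.1, g'.2.opp) := by
  refine h.map (F := fun g => (g.1, g.2.opp)) ?_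
  intro g g' hs
  have hm : ∀ s x, x ∈ π.mirror.word s ↔ x ∈ π.word s := fun s x => by simp [mirror]
  cases hs with
  | preserving s a h m1 m2 => rw [hm] at m1 m2; exact band_same m1 m2
  | reversing s a h m1 m2 => rw [hm] at m1 m2; exact band_same' m1 m2
  | cusp s a b hn =>
    rw [mirror_neighbours] at hn
    exact (BoundaryStep.cusp s b a hn).same.symm
  | leftEnd a b h1 h2 =>
    simp only [mirror, List.head?_reverse] at h1 h2
    exact (BoundaryStep.rightEnd a b h1 h2).same
  | rightEnd a b h1 h2 =>
    simp only [mirror, List.getLast?_reverse] at h1 h2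
    exact (BoundaryStep.leftEnd a b h1 h2).same

theorem mirror_sameCircle_iff {g g' : BandEnd d × Hand} :
    π.mirror.SameCircle g g' ↔ π.SameCircle (g.1, g.2.opp) (g'.1, g'.2.opp) := by
  refine ⟨sameCircle_of_mirror, fun h => ?_⟩
  have h2 : π.mirror.mirror.SameCircle (g.1, g.2.opp) (g'.1, g'.2.opp) := by
    rw [mirror_mirror]; exact h
  simpa using sameCircle_of_mirror h2

/-- Reflection exchanges the hands, and a cusp becomes recorded by its other end; adjacency matches
the two ways of recording. -/
theorem IsComplete.mirror (hπ : π.IsComplete) : π.mirror.IsComplete := by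
  intro g
  have : π.mirror.cuspCount g = π.cuspCount (g.1, g.2.opp) := by
    unfold cuspCount
    simp only [mirror_neighbours, mirror_sameCircle_iff]
    apply le_antisymm
    · refine ncard_le_of_rel (fun x y => ∃ s, π.Neighbours s y x) ?_ ?_
      · rintro x ⟨⟨s, y, h⟩, hx⟩
        exact ⟨y, ⟨⟨s, x, h⟩, (BoundaryStep.cusp s y x h).same.trans hx⟩, s, h⟩
      · rintro x x' y ⟨s, h⟩ ⟨t, h'⟩
        obtain rfl := π.side_unique (pair_infix_mem h).1 (pair_infix_mem h').1
        exact pair_infix_right_unique (π.nodup_word _) h h'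
    · refine ncard_le_of_rel (fun y x => ∃ s, π.Neighbours s y x) ?_ ?_
      · rintro y ⟨⟨s, x, h⟩, hy⟩
        exact ⟨x, ⟨⟨s, y, h⟩, (BoundaryStep.cusp s y x h).same.symm.trans hy⟩, s, h⟩
      · rintro x x' y ⟨s, h⟩ ⟨t, h'⟩
        obtain rfl := π.side_unique (pair_infix_mem h).2 (pair_infix_mem h').2
        exact pair_infix_left_unique (π.nodup_word _) h h'
  rw [this]
  exact hπ _

/-- A complete pattern has no final part that is closed under the bands and consists of bands
joining the top to the bottom. -/
theorem IsComplete.no_classical_suffix (hπ : π.IsComplete) {X Y : Side → List (BandEnd d)}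
    (hw : ∀ s, π.word s = Y s ++ X s) (hX : ∀ s, ∀ x ∈ X s, otherEnd x ∈ X s.opp)
    (hne : X .top ≠ []) (hY : (∀ s, Y s = []) ∨ ∀ s, Y s ≠ []) : False := by
  refine hπ.mirror.no_classical_prefix (X := fun s => (X s).reverse)
    (Y := fun s => (Y s).reverse) ?_ ?_ ?_ ?_
  · intro s; simp [Pattern.mirror, hw]
  · intro s x hx
    simpa using hX s x (by simpa using hx)
  · simpa using hne
  · simpa using hY

end Pattern
end BandExchange

namespace BandExchange

variable {d : ℕ}

/-! ### Elementary matrices as operations on vectors -/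

/-- The vector `(1 + M_{αβ}) x`. -/
def grow {R : Type*} [Ring R] (α β : Fin d) (x : Fin d → R) : Fin d → R :=
  Function.update x α (x α + x β)

/-- The vector `(1 + M_{αβ})⁻¹ x`. -/
def shrink {R : Type*} [Ring R] (α β : Fin d) (x : Fin d → R) : Fin d → R :=
  Function.update x α (x α - x β)

theorem grow_shrink {R : Type*} [Ring R] {α β : Fin d} (h : α ≠ β) (x : Fin d → R) :
    grow α β (shrink α β x) = x := by
  ext γ
  by_cases hγ : γ = α
  · subst hγ; simp [grow, shrink, h.symm]
  · simp [grow, shrink, hγ]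

theorem shrink_grow {R : Type*} [Ring R] {α β : Fin d} (h : α ≠ β) (x : Fin d → R) :
    shrink α β (grow α β x) = x := by
  ext γ
  by_cases hγ : γ = α
  · subst hγ; simp [grow, shrink, h.symm]
  · simp [grow, shrink, hγ]

theorem grow_same {R : Type*} [Ring R] (α β : Fin d) (x : Fin d → R) :
    grow α β x α = x α + x β := by simp [grow]

theorem grow_of_ne {R : Type*} [Ring R] {α β γ : Fin d} (h : γ ≠ α) (x : Fin d → R) :
    grow α β x γ = x γ := by simp [grow, h]

theorem shrink_same {R : Type*} [Ring R] (α β : Fin d) (x : Fin d → R) :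
    shrink α β x α = x α - x β := by simp [shrink]

theorem shrink_of_ne {R : Type*} [Ring R] {α β γ : Fin d} (h : γ ≠ α) (x : Fin d → R) :
    shrink α β x γ = x γ := by simp [shrink, h]

theorem grow_eq_add {R : Type*} [Ring R] (α β : Fin d) (x : Fin d → R) :
    grow α β x = x + Pi.single α (x β) := by
  ext γ
  by_cases hγ : γ = α
  · subst hγ; simp [grow]
  · simp [grow, hγ]

/-- `(1 + M_{αβ})ᵀ q`, the row vector `q` multiplied by the elementary matrix, is
`grow β α q`. -/
theorem grow_dotProduct (α β : Fin d) (q x : Fin d → ℝ) :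
    grow β α q ⬝ᵥ x = q ⬝ᵥ grow α β x := by
  rw [grow_eq_add, grow_eq_add, add_dotProduct, dotProduct_add, single_dotProduct,
    dotProduct_single]

theorem splitMatrix_mulVec (α β : Fin d) (x : Fin d → ℝ) :
    (splitMatrix α β).mulVec x = grow α β x := by
  rw [splitMatrix, Matrix.add_mulVec, Matrix.one_mulVec, grow_eq_add]
  congr 1
  ext γ
  simp [Matrix.single_mulVec, Pi.single_apply, Function.update_apply]

theorem vecMul_splitMatrix (α β : Fin d) (q : Fin d → ℝ) :
    Matrix.vecMul q (splitMatrix α β) = grow β α q := by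
  refine dotProduct_eq _ _ fun x => ?_
  rw [← Matrix.dotProduct_mulVec, splitMatrix_mulVec, grow_dotProduct]

/-! ### Existence of splits -/

namespace Pattern

theorem exists_of_perm (π : Pattern d) (s : Side) (X Y : List (BandEnd d))
    (h : (X ++ Y).Perm (π.word s ++ π.word s.opp)) :
    ∃ π' : Pattern d, π'.word s = X ∧ π'.word s.opp = Y := by
  cases s
  · refine ⟨⟨fun t => match t with | .top => X | .bot => Y, ?_, ?_⟩, rfl, rfl⟩
    · exact h.nodup_iff.2 π.nodup
    · intro a; exact h.mem_iff.2 (π.mem a)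
  · have h' : (Y ++ X).Perm (π.word .top ++ π.word .bot) :=
      List.perm_append_comm.trans (h.trans List.perm_append_comm)
    refine ⟨⟨fun t => match t with | .top => Y | .bot => X, ?_, ?_⟩, rfl, rfl⟩
    · exact h'.nodup_iff.2 π.nodup
    · intro a; exact h'.mem_iff.2 (π.mem a)

theorem exists_isSplit (π : Pattern d) {s : Side} {a b : BandEnd d}
    (ha : (π.word s).getLast? = some a) (hb : (π.word s.opp).getLast? = some b)
    (hab : a.1 ≠ b.1) : ∃ π', IsSplit π s a b π' := by
  obtain ⟨u, hu⟩ := List.getLast?_eq_some_iff.1 ha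
  obtain ⟨v, hv⟩ := List.getLast?_eq_some_iff.1 hb
  rcases π.mem_or s (otherEnd a) with h | h
  · have h' : otherEnd a ∈ u := by
      rw [hu] at h
      simpa [otherEnd_ne] using h
    obtain ⟨u₁, u₂, rfl⟩ := List.append_of_mem h'
    obtain ⟨π', h1, h2⟩ := π.exists_of_perm s (u₁ ++ [b, otherEnd a] ++ u₂ ++ [a]) v (by
      rw [hu, hv, List.perm_iff_count]
      intro x
      simp only [List.count_append, List.count_cons, List.count_nil]
      ring)
    exact ⟨π', .reversing u₁ u₂ v (by rw [hu]; simp) hv h1 h2⟩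
  · have h' : otherEnd a ∈ v := by
      rw [hv] at h
      have : otherEnd a ≠ b := fun e => hab (by rw [← e]; rfl)
      simpa [this] using h
    obtain ⟨v₁, v₂, rfl⟩ := List.append_of_mem h'
    obtain ⟨π', h1, h2⟩ := π.exists_of_perm s (u ++ [a]) (v₁ ++ [otherEnd a, b] ++ v₂) (by
      rw [hu, hv, List.perm_iff_count]
      intro x
      simp only [List.count_append, List.count_cons, List.count_nil]
      ring)
    exact ⟨π', .preserving u v₁ v₂ hu (by rw [hv]; simp) h1 h2⟩

instance : Finite (Pattern d) := by
  classical
  let f : Pattern d → {l : List (BandEnd d) // l.Nodup} × {l : List (BandEnd d) // l.Nodup} :=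
    fun π => (⟨π.word .top, π.nodup_word _⟩, ⟨π.word .bot, π.nodup_word _⟩)
  refine Finite.of_injective f fun π π' h => ext_word fun s => ?_
  simp only [f, Prod.mk.injEq, Subtype.mk.injEq] at h
  cases s
  · exact h.1
  · exact h.2

end Pattern

instance : Finite (NonClassical d) := Subtype.finite
instance : Finite (ReducedType d) := Quotient.finite _

theorem IsSplit.coef_eq_grow {π π' : Pattern d} {s : Side} {a b : BandEnd d}
    (h : IsSplit π s a b π') : π'.coef = grow b.1 a.1 π.coef := by
  ext γ
  rw [h.coef_eq, grow_eq_add, Pi.add_apply, Pi.single_apply]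

/-! ### Admissible splits and generic widths -/

section

variable [NeZero d]

theorem Pattern.word_ne_nil_of_recurrent {π : Pattern d} (h : π.IsRecurrent) (s : Side) :
    π.word s ≠ [] := by
  obtain ⟨w, hw, hs⟩ := h
  have hs' : π.total w s = π.total w s.opp := by
    cases s
    · exact hs
    · exact hs.symm
  intro h0
  have h1 : π.total w s = 0 := by simp [Pattern.total, h0]
  have hm : ((0 : Fin d), false) ∈ π.word s.opp := by
    rcases π.mem_or s ((0 : Fin d), false) with h | h
    · rw [h0] at h; simp at h
    · exact h
  have h2 : 0 < π.total w s.opp := by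
    rw [Pattern.total_eq_sum]
    exact Finset.sum_pos (fun a _ => hw a.1) ⟨_, List.mem_toFinset.2 hm⟩
  linarith

/-- The rightmost end on a side. -/
def Pattern.crit (π : Pattern d) (s : Side) : BandEnd d := ((π.word s).getLast?).getD (0, false)

/-- With all coefficients zero, the whole pattern would be a classical block. -/
theorem Pattern.exists_coef_ne_zero {π : Pattern d} (h : π.IsComplete) : ∃ α, π.coef α ≠ 0 := by
  by_contra! hcon
  have h0 : ∀ α, π.sgn α = 0 := fun α => by
    have := hcon α
    simpa [Pattern.coef] using this
  refine h.no_classical_prefix (X := π.word) (Y := fun _ => []) (by simp)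
    (fun s x hx => Pattern.preserving_of_sgn (h0 _) hx) ?_ (.inl fun _ => rfl)
  rcases π.mem_or .top ((0 : Fin d), false) with h | h
  · exact List.ne_nil_of_mem h
  · exact List.ne_nil_of_mem (Pattern.preserving_of_sgn (s := .bot) (h0 _) h)

namespace NonClassical

theorem last_eq (π : NonClassical d) (s : Side) :
    (π.1.word s).getLast? = some (π.1.crit s) := by
  have := Pattern.word_ne_nil_of_recurrent π.2.1 s
  unfold Pattern.crit
  rw [List.getLast?_eq_some_getLast this]; rfl

/-- The band of the rightmost end on a side. -/
def win (π : NonClassical d) (s : Side) : Fin d := (π.1.crit s).1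

theorem win_ne (π : NonClassical d) (s : Side) : π.win s ≠ π.win s.opp :=
  π.2.2.crit_fst_ne (π.last_eq s) (π.last_eq s.opp)

/-- The coefficient vector is nonzero and orthogonal to a strictly positive vector, so both signs
occur. -/
theorem exists_coef (π : NonClassical d) : (∃ α, π.1.coef α = 1) ∧ ∃ α, π.1.coef α = -1 := by
  obtain ⟨w, h1, h2⟩ := π.2.1
  rw [Pattern.switchCondition_iff] at h2
  obtain ⟨α, hα⟩ := Pattern.exists_coef_ne_zero π.2.2
  have hneg : ∃ α, π.1.coef α < 0 := by
    by_contra! hcon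
    have : 0 < π.1.coef ⬝ᵥ w :=
      Finset.sum_pos' (fun i _ => mul_nonneg (hcon i) (h1 i).le)
        ⟨α, Finset.mem_univ _, mul_pos (lt_of_le_of_ne (hcon α) hα.symm) (h1 α)⟩
    linarith
  have hpos : ∃ α, 0 < π.1.coef α := by
    by_contra! hcon
    have : π.1.coef ⬝ᵥ w < 0 :=
      Finset.sum_neg' (fun i _ => mul_nonpos_of_nonpos_of_nonneg (hcon i) (h1 i).le)
        ⟨α, Finset.mem_univ _, mul_neg_of_neg_of_pos (lt_of_le_of_ne (hcon α) hα) (h1 α)⟩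
    linarith
  obtain ⟨β, hβ⟩ := hneg
  obtain ⟨γ, hγ⟩ := hpos
  constructor
  · refine ⟨γ, ?_⟩
    rcases π.1.coef_mem γ with h | h | h <;> simp [h] at hγ ⊢
    linarith
  · refine ⟨β, ?_⟩
    rcases π.1.coef_mem β with h | h | h <;> simp [h] at hβ ⊢
    linarith

/-- The split on side `s` leads to a non-classical exchange. -/
def Valid (π : NonClassical d) (s : Side) : Prop :=
  ∃ π' : NonClassical d, IsSplit π.1 s (π.1.crit s) (π.1.crit s.opp) π'.1

open Classical in
/-- The outcome of the split on side `s`. -/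
noncomputable def next (π : NonClassical d) (s : Side) : NonClassical d :=
  if h : π.Valid s then h.choose else π

theorem Valid.isSplit {π : NonClassical d} {s : Side} (h : π.Valid s) :
    IsSplit π.1 s (π.1.crit s) (π.1.crit s.opp) (π.next s).1 := by
  rw [next, dif_pos h]
  exact h.choose_spec

theorem Valid.of_isSplit {π π' : NonClassical d} {s : Side} {a b : BandEnd d}
    (h : IsSplit π.1 s a b π'.1) :
    π.Valid s ∧ a = π.1.crit s ∧ b = π.1.crit s.opp ∧ π' = π.next s := by
  have ha : a = π.1.crit s := by
    have := h.last_left.symm.trans (π.last_eq s); simpa using this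
  have hb : b = π.1.crit s.opp := by
    have := h.last_right.symm.trans (π.last_eq s.opp); simpa using this
  subst ha hb
  have hv : π.Valid s := ⟨π', h⟩
  exact ⟨hv, rfl, rfl, Subtype.ext (hv.isSplit.eq_of_eq h).2.2⟩

theorem Valid.coef_next {π : NonClassical d} {s : Side} (h : π.Valid s) :
    (π.next s).1.coef = grow (π.win s.opp) (π.win s) π.1.coef :=
  h.isSplit.coef_eq_grow

/-- The new widths are positive and solve the new switch condition, so the outcome is recurrent.
Recurrence makes both words nonempty, which is what the transfer of completeness requires. -/
theorem valid_of_pos (π : NonClassical d) {s : Side} {x : Fin d → ℝ} (hx : ∀ α, 0 < x α)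
    (hc : π.1.coef ⬝ᵥ x = 0) (hlt : x (π.win s.opp) < x (π.win s)) : π.Valid s := by
  obtain ⟨π', h⟩ := π.1.exists_isSplit (π.last_eq s) (π.last_eq s.opp) (π.win_ne s)
  have hrec : π'.IsRecurrent := by
    refine ⟨shrink (π.win s) (π.win s.opp) x, fun α => ?_, ?_⟩
    · by_cases hα : α = π.win s
      · subst hα; rw [shrink_same]; linarith
      · rw [shrink_of_ne hα]; exact hx α
    · rw [Pattern.switchCondition_iff, h.coef_eq_grow]
      change grow (π.win s.opp) (π.win s) _ ⬝ᵥ _ = 0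
      rw [grow_dotProduct, grow_shrink (π.win_ne s), hc]
  exact ⟨⟨π', hrec, h.isComplete π.2.2 (Pattern.word_ne_nil_of_recurrent hrec _)⟩, h⟩

open Classical in
/-- The side of the wider critical band. -/
noncomputable def sideOf (π : NonClassical d) (x : Fin d → ℝ) : Side :=
  if x (π.win .bot) < x (π.win .top) then .top else .bot

theorem sideOf_eq (π : NonClassical d) {x : Fin d → ℝ} {s : Side}
    (h : x (π.win s.opp) < x (π.win s)) : π.sideOf x = s := by
  unfold sideOf
  cases s
  · exact if_pos h
  · exact if_neg (by simp only [Side.opp] at h; linarith)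

/-- Positive widths satisfying the switch condition and no other rational relation. -/
def generic (π : NonClassical d) : Set (Fin d → ℝ) :=
  {x | (∀ α, 0 < x α) ∧ π.1.coef ⬝ᵥ x = 0 ∧
    ∀ g : Fin d → ℤ, (fun α => (g α : ℝ)) ⬝ᵥ x = 0 → ∃ r : ℝ, ∀ α, (g α : ℝ) = r * π.1.coef α}

/-- Equal critical widths are a rational relation, so the coefficients would be supported on the two
critical bands with opposite signs. The outcome of an admissible split would then have coefficients
of only one sign, contrary to `exists_coef`. -/
theorem lt_of_mem_generic {π : NonClassical d} (hv : ∃ s, π.Valid s) {x : Fin d → ℝ}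
    (hx : x ∈ π.generic) : x (π.win (π.sideOf x).opp) < x (π.win (π.sideOf x)) := by
  rcases lt_trichotomy (x (π.win .bot)) (x (π.win .top)) with h | h | h
  · rw [π.sideOf_eq (s := .top) h]; exact h
  · exfalso
    have hne := π.win_ne .top
    simp only [Side.opp] at hne
    obtain ⟨r, hr⟩ := hx.2.2 (Pi.single (π.win .top) 1 - Pi.single (π.win .bot) 1) (by
      have : (fun α => (((Pi.single (π.win .top) 1 - Pi.single (π.win .bot) 1 : Fin d → ℤ) α : ℤ) : ℝ))
          = Pi.single (π.win .top) 1 - Pi.single (π.win .bot) 1 := by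
        ext α; simp [Pi.single_apply]
      rw [this, sub_dotProduct, single_dotProduct, single_dotProduct, h]
      ring)
    obtain ⟨s, hs⟩ := hv
    have hc : ∀ α, α ≠ π.win .top → α ≠ π.win .bot → r * π.1.coef α = 0 := fun α h1 h2 => by
      rw [← hr α]; simp [h1, h2]
    have ht : 1 = r * π.1.coef (π.win .top) := by rw [← hr]; simp [hne]
    have hb : -1 = r * π.1.coef (π.win .bot) := by rw [← hr]; simp [hne.symm]
    have hr0 : r ≠ 0 := by rintro rfl; simp at ht
    have hsum : π.1.coef (π.win .bot) = - π.1.coef (π.win .top) := by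
      apply mul_left_cancel₀ hr0; linarith
    have hz : ∀ α, α ≠ π.win .top → α ≠ π.win .bot → π.1.coef α = 0 := fun α h1 h2 =>
      (mul_eq_zero.1 (hc α h1 h2)).resolve_left hr0
    have hn := (π.next s).exists_coef
    rw [hs.coef_next] at hn
    obtain ⟨⟨α, hα⟩, β, hβ⟩ := hn
    have hsame : ∀ γ, grow (π.win s.opp) (π.win s) π.1.coef γ = 0 ∨
        grow (π.win s.opp) (π.win s) π.1.coef γ = π.1.coef (π.win s) := by
      intro γ
      cases s
      · simp only [Side.opp]
        by_cases h1 : γ = π.win .bot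
        · left; subst h1; rw [grow_same, hsum]; ring
        · rw [grow_of_ne h1]
          by_cases h2 : γ = π.win .top
          · right; rw [h2]
          · left; exact hz γ h2 h1
      · simp only [Side.opp]
        by_cases h1 : γ = π.win .top
        · left; subst h1; rw [grow_same, hsum]; ring
        · rw [grow_of_ne h1]
          by_cases h2 : γ = π.win .bot
          · right; rw [h2]
          · left; exact hz γ h1 h2
    rcases hsame α with h1 | h1 <;> rcases hsame β with h2 | h2 <;> linarith
  · rw [π.sideOf_eq (s := .bot) h]; exact h

/-- The split matrix is invertible over the integers, so integral relations before and after the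
split correspond to each other, and so do multiples of the coefficient vectors. -/
theorem Valid.shrink_mem {π : NonClassical d} {s : Side} (h : π.Valid s) {x : Fin d → ℝ}
    (hx : x ∈ π.generic) (hlt : x (π.win s.opp) < x (π.win s)) :
    shrink (π.win s) (π.win s.opp) x ∈ (π.next s).generic := by
  have hne := π.win_ne s
  refine ⟨fun α => ?_, ?_, fun g hg => ?_⟩
  · by_cases hα : α = π.win s
    · subst hα; rw [shrink_same]; linarith
    · rw [shrink_of_ne hα]; exact hx.1 α
  · rw [h.coef_next, grow_dotProduct, grow_shrink hne, hx.2.1]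
  · obtain ⟨r, hr⟩ := hx.2.2 (shrink (π.win s.opp) (π.win s) g) (by
      rw [← hg]
      conv_rhs => rw [show (fun α => (g α : ℝ)) = grow (π.win s.opp) (π.win s)
        (fun α => ((shrink (π.win s.opp) (π.win s) g α : ℤ) : ℝ)) by
          ext α
          by_cases hα : α = π.win s.opp
          · subst hα; rw [grow_same, shrink_same, shrink_of_ne hne]; push_cast; ring
          · rw [grow_of_ne hα, shrink_of_ne hα]]
      rw [grow_dotProduct, grow_shrink hne])
    refine ⟨r, fun α => ?_⟩
    rw [h.coef_next]
    by_cases hα : α = π.win s.opp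
    · subst hα
      have h1 := hr (π.win s.opp)
      have h2 := hr (π.win s)
      rw [shrink_same] at h1
      rw [shrink_of_ne hne] at h2
      push_cast at h1
      rw [grow_same]; linarith
    · rw [grow_of_ne hα, ← hr, shrink_of_ne hα]

theorem Valid.grow_mem {π : NonClassical d} {s : Side} (h : π.Valid s) {y : Fin d → ℝ}
    (hy : y ∈ (π.next s).generic) :
    grow (π.win s) (π.win s.opp) y ∈ π.generic ∧
      π.sideOf (grow (π.win s) (π.win s.opp) y) = s := by
  have hne := π.win_ne s
  have hlt : grow (π.win s) (π.win s.opp) y (π.win s.opp) <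
      grow (π.win s) (π.win s.opp) y (π.win s) := by
    rw [grow_same, grow_of_ne hne.symm]; linarith [hy.1 (π.win s)]
  refine ⟨⟨fun α => ?_, ?_, fun g hg => ?_⟩, π.sideOf_eq hlt⟩
  · by_cases hα : α = π.win s
    · subst hα; rw [grow_same]; exact add_pos (hy.1 _) (hy.1 _)
    · rw [grow_of_ne hα]; exact hy.1 α
  · rw [← grow_dotProduct, ← h.coef_next, hy.2.1]
  · rw [← grow_dotProduct] at hg
    obtain ⟨r, hr⟩ := hy.2.2 (grow (π.win s.opp) (π.win s) g) (by
      rw [← hg]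
      congr 1
      ext α
      by_cases hα : α = π.win s.opp
      · subst hα; rw [grow_same, grow_same]; push_cast; ring
      · rw [grow_of_ne hα, grow_of_ne hα])
    refine ⟨r, fun α => ?_⟩
    rw [h.coef_next] at hr
    have h2 := hr (π.win s)
    rw [grow_of_ne hne, grow_of_ne hne] at h2
    by_cases hα : α = π.win s.opp
    · subst hα
      have h1 := hr (π.win s.opp)
      rw [grow_same, grow_same] at h1
      push_cast at h1
      linarith
    · have := hr α
      rwa [grow_of_ne hα, grow_of_ne hα] at this

end NonClassical
end

end BandExchange

namespace BandExchange

open MeasureTheory Matrix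
open scoped ENNReal

variable {d : ℕ}

/-! ### Volume on a hyperplane -/

theorem shear_measurePreserving {k v : Fin d → ℝ} (h : k ⬝ᵥ v = 0) :
    MeasurePreserving (fun x : Fin d → ℝ => x + (k ⬝ᵥ x) • v) volume volume := by
  have hm : Measurable (fun x : Fin d → ℝ => x + (k ⬝ᵥ x) • v) := by
    simp only [dotProduct]; fun_prop
  refine ⟨hm, ?_⟩
  let f : Module.Dual ℝ (Fin d → ℝ) := dotProductBilin ℝ ℝ k
  have hf : f v = 0 := h
  have hd := LinearEquiv.transvection.det_eq_one hf
  let T : (Fin d → ℝ) →ₗ[ℝ] (Fin d → ℝ) := (LinearEquiv.transvection hf : _ ≃ₗ[ℝ] _)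
  have hT : (T : (Fin d → ℝ) → Fin d → ℝ) = fun x => x + (k ⬝ᵥ x) • v := by
    ext x; rfl
  have hdet : LinearMap.det T = 1 := by
    rw [← LinearEquiv.coe_det, hd]; rfl
  have := Measure.map_linearMap_addHaar_eq_smul_addHaar (volume : Measure (Fin d → ℝ)) (f := T)
    (by rw [hdet]; exact one_ne_zero)
  rw [hT, hdet] at this
  simpa using this

/-- The projection to the hyperplane `c ⬝ᵥ x = 0` along `u`. -/
def hyperProj (c u x : Fin d → ℝ) : Fin d → ℝ := x - (c ⬝ᵥ x) • u

theorem measurable_dotProduct (c : Fin d → ℝ) : Measurable fun x : Fin d → ℝ => c ⬝ᵥ x := by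
  simp only [dotProduct]; fun_prop

theorem measurable_hyperProj (c u : Fin d → ℝ) : Measurable (hyperProj c u) :=
  measurable_id.sub ((measurable_dotProduct c).smul_const u)

/-- The volume on the hyperplane `c ⬝ᵥ x = 0` given by the volume of a slab with side `u`. -/
noncomputable def slabVolume (c u : Fin d → ℝ) : Measure (Fin d → ℝ) :=
  (volume.restrict {x | c ⬝ᵥ x ∈ Set.Icc 0 1}).map (hyperProj c u)

theorem measurableSet_slab (c : Fin d → ℝ) :
    MeasurableSet {x : Fin d → ℝ | c ⬝ᵥ x ∈ Set.Icc (0 : ℝ) 1} :=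
  measurable_dotProduct c measurableSet_Icc

/-- A shear along the hyperplane takes one side of the slab to the other. The freedom in `u` later
allows a direction adapted to each computation. -/
theorem slabVolume_eq {c u u' : Fin d → ℝ} (h : c ⬝ᵥ u = 1) (h' : c ⬝ᵥ u' = 1) :
    slabVolume c u = slabVolume c u' := by
  have hs := shear_measurePreserving (k := c) (v := u' - u) (by rw [dotProduct_sub, h, h', sub_self])
  have hc : ∀ x : Fin d → ℝ, c ⬝ᵥ (x + (c ⬝ᵥ x) • (u' - u)) = c ⬝ᵥ x := fun x => by
    rw [dotProduct_add, dotProduct_smul, dotProduct_sub, h, h']; simp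
  have hs2 := hs.restrict_preimage (measurableSet_slab c)
  have hpre : (fun x : Fin d → ℝ => x + (c ⬝ᵥ x) • (u' - u)) ⁻¹' {x | c ⬝ᵥ x ∈ Set.Icc (0 : ℝ) 1}
      = {x | c ⬝ᵥ x ∈ Set.Icc (0 : ℝ) 1} := by
    ext x; simp only [Set.mem_preimage, Set.mem_ofPred_eq, hc]
  rw [hpre] at hs2
  unfold slabVolume
  conv_rhs => rw [← hs2.map_eq]
  rw [Measure.map_map (measurable_hyperProj c u') hs.measurable]
  congr 1
  ext x i
  simp only [hyperProj, Function.comp_apply, hc, Pi.sub_apply, Pi.add_apply, Pi.smul_apply, smul_eq_mul]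
  ring

theorem slabVolume_dotProduct_ne {c u : Fin d → ℝ} (h : c ⬝ᵥ u = 1) :
    slabVolume c u {x | c ⬝ᵥ x ≠ 0} = 0 := by
  have hm : MeasurableSet {x : Fin d → ℝ | c ⬝ᵥ x ≠ 0} :=
    (measurable_dotProduct c) (measurableSet_singleton 0).compl
  rw [slabVolume, Measure.map_apply (measurable_hyperProj c u) hm]
  have : hyperProj c u ⁻¹' {x | c ⬝ᵥ x ≠ 0} = ∅ := by
    ext x
    simp [hyperProj, dotProduct_sub, h]
  rw [this, measure_empty]

/-- Pulling back along the projection gives the kernel of `g - (g ⬝ᵥ u) • c`, a proper subspace. -/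
theorem slabVolume_hyperplane {c u g : Fin d → ℝ} (hg : ∀ r : ℝ, g ≠ r • c) :
    slabVolume c u {x | g ⬝ᵥ x = 0} = 0 := by
  have hm : MeasurableSet {x : Fin d → ℝ | g ⬝ᵥ x = 0} :=
    (measurable_dotProduct g) (measurableSet_singleton 0)
  rw [slabVolume, Measure.map_apply (measurable_hyperProj c u) hm]
  refine le_antisymm ((Measure.restrict_apply_le _ _).trans ?_) zero_le
  set k : Fin d → ℝ := g - (g ⬝ᵥ u) • c with hk
  have hpre : hyperProj c u ⁻¹' {x | g ⬝ᵥ x = 0} = ((LinearMap.ker (dotProductBilin ℝ ℝ k) :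
      Submodule ℝ (Fin d → ℝ)) : Set (Fin d → ℝ)) := by
    ext x
    simp only [Set.mem_preimage, Set.mem_ofPred_eq, hyperProj, SetLike.mem_coe, LinearMap.mem_ker,
      dotProductBilin_apply_apply, dotProduct_sub, dotProduct_smul, hk, sub_dotProduct,
      smul_dotProduct, smul_eq_mul]
    rw [mul_comm]
  rw [hpre]
  refine (Measure.addHaar_submodule _ _ ?_).le
  intro htop
  have hk0 : k ⬝ᵥ k = 0 := by
    have : k ∈ LinearMap.ker (dotProductBilin ℝ ℝ k) := by rw [htop]; trivial
    simpa using this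
  rw [dotProduct_self_eq_zero, hk, sub_eq_zero] at hk0
  exact hg _ hk0

theorem measurable_grow (α β : Fin d) : Measurable (grow α β : (Fin d → ℝ) → Fin d → ℝ) := by
  have : (grow α β : (Fin d → ℝ) → Fin d → ℝ) = fun x => x + Pi.single α (x β) := by
    ext x; rw [grow_eq_add]
  rw [this]
  refine measurable_pi_iff.2 fun i => ?_
  simp only [Pi.add_apply, Pi.single_apply]
  split_ifs <;> fun_prop

theorem measurable_shrink (α β : Fin d) : Measurable (shrink α β : (Fin d → ℝ) → Fin d → ℝ) := by
  refine measurable_pi_iff.2 fun i => ?_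
  simp only [shrink, Function.update_apply]
  split_ifs <;> fun_prop

/-- The elementary matrix as a measurable equivalence. -/
def growEquiv {α β : Fin d} (h : α ≠ β) : (Fin d → ℝ) ≃ᵐ (Fin d → ℝ) where
  toFun := grow α β
  invFun := shrink α β
  left_inv := shrink_grow h
  right_inv := grow_shrink h
  measurable_toFun := measurable_grow α β
  measurable_invFun := measurable_shrink α β

theorem grow_measurePreserving {α β : Fin d} (h : α ≠ β) :
    MeasurePreserving (grow α β : (Fin d → ℝ) → Fin d → ℝ) volume volume := by
  have := shear_measurePreserving (k := Pi.single β 1) (v := Pi.single α (1 : ℝ))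
    (by simp [h.symm])
  convert this using 2 with x
  rw [grow_eq_add]
  ext i
  simp [Pi.single_apply]

/-- The elementary matrix preserves Lebesgue measure and maps the slab of the transposed functional
to the slab of `c`. -/
theorem slabVolume_grow {α β : Fin d} (h : α ≠ β) (c u : Fin d → ℝ) (B : Set (Fin d → ℝ)) :
    slabVolume c u (grow α β '' B) = slabVolume (grow β α c) (shrink α β u) B := by
  have hlin : ∀ (x y : Fin d → ℝ) (r : ℝ), grow α β (x - r • y) = grow α β x - r • grow α β y := by
    intro x y r
    ext i
    by_cases hi : i = α
    · subst hi; simp [grow_same]; ring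
    · simp [grow_of_ne hi]
  have hmap : (slabVolume (grow β α c) (shrink α β u)).map (grow α β) = slabVolume c u := by
    unfold slabVolume
    rw [Measure.map_map (measurable_grow α β) (measurable_hyperProj _ _)]
    have hs2 := (grow_measurePreserving h).restrict_preimage (measurableSet_slab c)
    conv_rhs => rw [← hs2.map_eq]
    rw [Measure.map_map (measurable_hyperProj _ _) (measurable_grow α β)]
    congr 1
    · ext x i
      simp only [Function.comp_apply, hyperProj, hlin, grow_shrink h, grow_dotProduct]
    · congr 1
      ext x; simp [grow_dotProduct]
  rw [← hmap]
  change (Measure.map (growEquiv h) _) _ = _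
  rw [MeasurableEquiv.map_apply]
  congr 1
  exact Set.preimage_image_eq _ (growEquiv h).injective

/-- The volume on the hyperplane `c ⬝ᵥ x = 0`. -/
noncomputable def hyperVolume (c : Fin d → ℝ) : Measure (Fin d → ℝ) :=
  slabVolume c ((c ⬝ᵥ c)⁻¹ • c)

/-- A vector with entries `0`, `1`, `-1`, the last two of which occur. -/
structure IsSign (c : Fin d → ℝ) : Prop where
  mem : ∀ α, c α = 0 ∨ c α = 1 ∨ c α = -1
  pos : ∃ α, c α = 1
  neg : ∃ α, c α = -1

theorem hyperVolume_eq {c u : Fin d → ℝ} (h : c ⬝ᵥ u = 1) : hyperVolume c = slabVolume c u := by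
  refine slabVolume_eq ?_ h
  have h0 : c ⬝ᵥ c ≠ 0 := by
    rw [Ne, dotProduct_self_eq_zero]
    rintro rfl
    simp at h
  rw [dotProduct_smul, smul_eq_mul, inv_mul_cancel₀ h0]

theorem IsSign.exists_one {c : Fin d → ℝ} (hc : IsSign c) : ∃ u, c ⬝ᵥ u = 1 := by
  obtain ⟨α, h⟩ := hc.pos
  exact ⟨Pi.single α 1, by simp [h]⟩

theorem hyperVolume_grow {c : Fin d → ℝ} (hc : IsSign c) {α β : Fin d} (h : α ≠ β)
    (B : Set (Fin d → ℝ)) :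
    hyperVolume c (grow α β '' B) = hyperVolume (grow β α c) B := by
  obtain ⟨u, hu⟩ := hc.exists_one
  rw [hyperVolume_eq hu, slabVolume_grow h, hyperVolume_eq (u := shrink α β u)]
  rw [grow_dotProduct, grow_shrink h, hu]

/-! ### The volume of the simplex-like body `x ≥ 0`, `q ⬝ᵥ x ≤ 1` -/

/-- The least value of `q` where `c` takes the value `v`. -/
noncomputable def minOn (c q : Fin d → ℝ) (v : ℝ) : ℝ := sInf (q '' {t | c t = v})

theorem exists_minOn {c : Fin d → ℝ} (q : Fin d → ℝ) {v : ℝ} (h : ∃ t, c t = v) :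
    ∃ t, c t = v ∧ q t = minOn c q v := by
  have hne : (q '' {t | c t = v}).Nonempty := by
    obtain ⟨t, ht⟩ := h
    exact ⟨q t, t, ht, rfl⟩
  obtain ⟨t, ht, e⟩ := hne.csInf_mem (Set.toFinite _)
  exact ⟨t, ht, e⟩

theorem minOn_le {c : Fin d → ℝ} (q : Fin d → ℝ) {v : ℝ} {t : Fin d} (h : c t = v) :
    minOn c q v ≤ q t :=
  csInf_le (Set.toFinite _).bddBelow ⟨t, h, rfl⟩

/-- The least value of `q` on vectors `x ≥ 0` of the hyperplane with `x α = 1`. -/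
noncomputable def hat (c q : Fin d → ℝ) (α : Fin d) : ℝ :=
  q α + if c α = 1 then minOn c q (-1) else if c α = -1 then minOn c q 1 else 0

/-- The least value of `hat c q` on the support of `c`. -/
noncomputable def minRev (c q : Fin d → ℝ) : ℝ := minOn c q 1 + minOn c q (-1)

theorem hat_of_zero {c q : Fin d → ℝ} {α : Fin d} (h : c α = 0) : hat c q α = q α := by
  simp [hat, h]

theorem hat_of_one {c q : Fin d → ℝ} {α : Fin d} (h : c α = 1) :
    hat c q α = q α + minOn c q (-1) := by
  simp [hat, h]

theorem hat_of_neg_one {c q : Fin d → ℝ} {α : Fin d} (h : c α = -1) :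
    hat c q α = q α + minOn c q 1 := by
  simp [hat, h]; norm_num

theorem minRev_le_hat {c q : Fin d → ℝ} (hc : IsSign c) {α : Fin d} (h : c α ≠ 0) :
    minRev c q ≤ hat c q α := by
  rcases hc.mem α with h' | h' | h'
  · exact absurd h' h
  · rw [hat_of_one h', minRev]; linarith [minOn_le q h']
  · rw [hat_of_neg_one h', minRev]; linarith [minOn_le q h']

theorem minOn_pos {c q : Fin d → ℝ} {v : ℝ} (h : ∃ t, c t = v) (hq : ∀ α, 0 < q α) :
    0 < minOn c q v := by
  obtain ⟨t, _, e⟩ := exists_minOn q h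
  rw [← e]; exact hq t

theorem le_hat {c q : Fin d → ℝ} (hc : IsSign c) (hq : ∀ α, 0 < q α) (α : Fin d) :
    q α ≤ hat c q α := by
  rcases hc.mem α with h | h | h
  · rw [hat_of_zero h]
  · rw [hat_of_one h]; linarith [minOn_pos hc.neg hq]
  · rw [hat_of_neg_one h]; linarith [minOn_pos hc.pos hq]

theorem hat_pos {c q : Fin d → ℝ} (hc : IsSign c) (hq : ∀ α, 0 < q α) (α : Fin d) :
    0 < hat c q α := (hq α).trans_le (le_hat hc hq α)

theorem minRev_pos {c q : Fin d → ℝ} (hc : IsSign c) (hq : ∀ α, 0 < q α) : 0 < minRev c q :=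
  add_pos (minOn_pos hc.pos hq) (minOn_pos hc.neg hq)

theorem sum_pos_eq_sum_neg {c x : Fin d → ℝ} (hc : IsSign c) (hx : c ⬝ᵥ x = 0) :
    (∑ α with c α = 1, x α) = ∑ α with c α = -1, x α := by
  have : c ⬝ᵥ x = (∑ α with c α = 1, x α) - ∑ α with c α = -1, x α := by
    rw [dotProduct, Finset.sum_filter, Finset.sum_filter, ← Finset.sum_sub_distrib]
    refine Finset.sum_congr rfl fun α _ => ?_
    rcases hc.mem α with h | h | h <;> simp [h] <;> norm_num
  linarith

/-- By the switch condition, the bands of the sign opposite to `α` have total width at least `x α`,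
and each unit of it costs at least the least norm there. This extra cost is the second summand of
`hat`. -/
theorem hat_mul_le {c q x : Fin d → ℝ} (hc : IsSign c) (hq : ∀ α, 0 < q α) (hx : ∀ α, 0 ≤ x α)
    (hcx : c ⬝ᵥ x = 0) (α : Fin d) : hat c q α * x α ≤ q ⬝ᵥ x := by
  have hsum := sum_pos_eq_sum_neg hc hcx
  have key : ∀ v : ℝ, c α ≠ v → (∃ t, c t = v) → x α ≤ ∑ β with c β = v, x β →
      (q α + minOn c q v) * x α ≤ q ⬝ᵥ x := by
    intro v hv hex hle
    have h1 : minOn c q v * x α ≤ ∑ β with c β = v, q β * x β :=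
      calc minOn c q v * x α ≤ minOn c q v * ∑ β with c β = v, x β :=
            mul_le_mul_of_nonneg_left hle (minOn_pos hex hq).le
        _ = ∑ β with c β = v, minOn c q v * x β := Finset.mul_sum ..
        _ ≤ _ := Finset.sum_le_sum fun β hβ =>
            mul_le_mul_of_nonneg_right (minOn_le q (by simpa using hβ)) (hx β)
    have h2 : q α * x α + ∑ β with c β = v, q β * x β ≤ q ⬝ᵥ x := by
      have hnot : α ∉ Finset.univ.filter fun β => c β = v := by simpa using hv
      rw [← Finset.sum_insert (f := fun β => q β * x β) hnot]
      exact Finset.sum_le_sum_of_subset_of_nonneg (Finset.subset_univ _)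
        fun β _ _ => mul_nonneg (hq β).le (hx β)
    linarith [add_mul (q α) (minOn c q v) (x α)]
  rcases hc.mem α with h | h | h
  · rw [hat_of_zero h]
    exact Finset.single_le_sum (f := fun β => q β * x β)
      (fun β _ => mul_nonneg (hq β).le (hx β)) (Finset.mem_univ α)
  · rw [hat_of_one h]
    refine key (-1) (by rw [h]; norm_num) hc.neg ?_
    rw [← hsum]
    exact Finset.single_le_sum (f := x) (fun β _ => hx β) (by simpa using h)
  · rw [hat_of_neg_one h]
    refine key 1 (by rw [h]; norm_num) hc.pos ?_
    rw [hsum]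
    exact Finset.single_le_sum (f := x) (fun β _ => hx β) (by simpa using h)

/-- The extremal vector on which the minimum in the definition of `hat` is attained. -/
theorem exists_ray {c : Fin d → ℝ} (hc : IsSign c) (q : Fin d → ℝ) (α : Fin d) :
    ∃ v : Fin d → ℝ, (∀ β, v β = 0 ∨ v β = 1) ∧ c ⬝ᵥ v = 0 ∧ v α = 1 ∧ q ⬝ᵥ v = hat c q α ∧
      ∀ w : Fin d → ℝ, (∀ β, 0 ≤ w β ∧ w β ≤ 1) → w ⬝ᵥ v ≤ 2 := by
  have key : ∀ β, c α + c β = 0 → α ≠ β → q β + q α = hat c q α →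
      ∃ v : Fin d → ℝ, (∀ β, v β = 0 ∨ v β = 1) ∧ c ⬝ᵥ v = 0 ∧ v α = 1 ∧ q ⬝ᵥ v = hat c q α ∧
      ∀ w : Fin d → ℝ, (∀ β, 0 ≤ w β ∧ w β ≤ 1) → w ⬝ᵥ v ≤ 2 := by
    intro β h1 h2 h3
    refine ⟨Pi.single α 1 + Pi.single β 1, fun γ => ?_, ?_, ?_, ?_, fun w hw => ?_⟩
    · by_cases e : γ = α
      · right; subst e; simp [h2]
      · by_cases e' : γ = β
        · right; subst e'; simp [e]
        · left; simp [e, e']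
    · rw [dotProduct_add, dotProduct_single, dotProduct_single]; linarith
    · simp [h2]
    · rw [dotProduct_add, dotProduct_single, dotProduct_single]; linarith
    · rw [dotProduct_add, dotProduct_single, dotProduct_single]
      linarith [(hw α).2, (hw β).2]
  rcases hc.mem α with h | h | h
  · refine ⟨Pi.single α 1, fun γ => ?_, by simp [h], by simp, by simp [hat_of_zero h],
      fun w hw => ?_⟩
    · by_cases e : γ = α
      · right; subst e; simp
      · left; simp [e]
    · rw [dotProduct_single]; linarith [(hw α).2]
  · obtain ⟨β, hβ, e⟩ := exists_minOn q hc.neg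
    refine key β (by rw [h, hβ]; norm_num) ?_ (by rw [hat_of_one h, e]; ring)
    rintro rfl; rw [h] at hβ; norm_num at hβ
  · obtain ⟨β, hβ, e⟩ := exists_minOn q hc.pos
    refine key β (by rw [h, hβ]; norm_num) ?_ (by rw [hat_of_neg_one h, e]; ring)
    rintro rfl; rw [h] at hβ; norm_num at hβ

/-- The cone `x ≥ 0` cut off by `q ⬝ᵥ x ≤ 1`. -/
def body (q : Fin d → ℝ) : Set (Fin d → ℝ) := {x | (∀ α, 0 ≤ x α) ∧ q ⬝ᵥ x ≤ 1}

theorem measurableSet_body (q : Fin d → ℝ) : MeasurableSet (body q) := by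
  have : body q = (⋂ α, {x | 0 ≤ x α}) ∩ {x | q ⬝ᵥ x ≤ 1} := by
    ext x; simp [body]
  rw [this]
  exact (MeasurableSet.iInter fun α =>
    measurableSet_le measurable_const (measurable_pi_apply α)).inter
    (measurableSet_le (measurable_dotProduct q) measurable_const)

/-- With the slab in direction `t`, a shear makes `c ⬝ᵥ x` the coordinate `t`. It ranges over the
unit interval, and the side of the box in direction `t` drops out. -/
theorem hyperVolume_box_le {c r : Fin d → ℝ} {t : Fin d} (ht : c t = 1) :
    hyperVolume c {x | ∀ α, 0 ≤ x α ∧ x α ≤ r α} ≤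
      ∏ α ∈ Finset.univ.erase t, ENNReal.ofReal (r α) := by
  have hu : c ⬝ᵥ Pi.single t 1 = 1 := by simp [ht]
  rw [hyperVolume_eq hu, slabVolume, Measure.map_apply (measurable_hyperProj _ _),
    Measure.restrict_apply' (measurableSet_slab c)]
  swap
  · simp only [Set.ofPred_forall]
    exact MeasurableSet.iInter fun α =>
      (measurableSet_le measurable_const (measurable_pi_apply α)).inter
        (measurableSet_le (measurable_pi_apply α) measurable_const)
  have hs := shear_measurePreserving (k := c - Pi.single t 1) (v := Pi.single t (1 : ℝ))
    (by simp [ht])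
  set R : Set (Fin d → ℝ) := Set.univ.pi fun α => if α = t then Set.Icc 0 1 else Set.Icc 0 (r α)
    with hR
  have hRm : MeasurableSet R := MeasurableSet.univ_pi fun α => by
    split_ifs <;> exact measurableSet_Icc
  have hsub : hyperProj c (Pi.single t 1) ⁻¹' {x | ∀ α, 0 ≤ x α ∧ x α ≤ r α} ∩
      {x | c ⬝ᵥ x ∈ Set.Icc (0 : ℝ) 1} ⊆
      (fun x : Fin d → ℝ => x + ((c - Pi.single t 1) ⬝ᵥ x) • Pi.single t (1 : ℝ)) ⁻¹' R := by
    rintro x ⟨h1, h2⟩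
    simp only [Set.mem_preimage, hR, Set.mem_univ_pi]
    intro α
    by_cases hα : α = t
    · subst hα
      simpa [sub_dotProduct] using h2
    · have := h1 α
      simpa [hα, hyperProj] using this
  refine (measure_mono hsub).trans ?_
  rw [hs.measure_preimage hRm.nullMeasurableSet, hR, volume_pi_pi,
    ← Finset.mul_prod_erase _ _ (Finset.mem_univ t)]
  simp only [if_true, Real.volume_Icc, sub_zero, ENNReal.ofReal_one, one_mul]
  refine (Finset.prod_congr rfl fun α hα => ?_).le
  rw [if_neg (Finset.ne_of_mem_erase hα), Real.volume_Icc, sub_zero]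

theorem prod_erase_hat {c q : Fin d → ℝ} (hc : IsSign c) (hq : ∀ α, 0 < q α) {t : Fin d}
    (ht : c t = 1) (htq : q t = minOn c q 1) :
    ∏ α ∈ Finset.univ.erase t, (hat c q α)⁻¹ = minRev c q / ∏ α, hat c q α := by
  rw [← Finset.mul_prod_erase _ _ (Finset.mem_univ t), hat_of_one ht, htq,
    Finset.prod_inv_distrib, ← minRev]
  have := (minRev_pos hc hq).ne'
  have h2 : (∏ α ∈ Finset.univ.erase t, hat c q α) ≠ 0 :=
    Finset.prod_ne_zero_iff.2 fun α _ => (hat_pos hc hq α).ne'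
  field_simp

/-- By `hat_mul_le` the body lies in a box with sides `1 / hat`. The coordinate dropped is one where
the weight is least on the support of `c`, namely `minRev`. -/
theorem hyperVolume_body_le {c q : Fin d → ℝ} (hc : IsSign c) (hq : ∀ α, 0 < q α) :
    hyperVolume c (body q) ≤ ENNReal.ofReal (minRev c q / ∏ α, hat c q α) := by
  obtain ⟨t, ht, htq⟩ := exists_minOn q hc.pos
  obtain ⟨u, hu⟩ := hc.exists_one
  have hnull : hyperVolume c {x | c ⬝ᵥ x ≠ 0} = 0 := by
    rw [hyperVolume_eq hu]; exact slabVolume_dotProduct_ne hu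
  calc hyperVolume c (body q)
      ≤ hyperVolume c ({x | ∀ α, 0 ≤ x α ∧ x α ≤ (hat c q α)⁻¹} ∪ {x | c ⬝ᵥ x ≠ 0}) := by
        refine measure_mono fun x hx => ?_
        by_cases h : c ⬝ᵥ x = 0
        · left
          intro α
          refine ⟨hx.1 α, ?_⟩
          rw [← one_div, le_div_iff₀ (hat_pos hc hq α), mul_comm]
          exact (hat_mul_le hc hq hx.1 h α).trans hx.2
        · right; exact h
    _ ≤ hyperVolume c {x | ∀ α, 0 ≤ x α ∧ x α ≤ (hat c q α)⁻¹} + 0 := by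
        rw [← hnull]; exact measure_union_le _ _
    _ ≤ ∏ α ∈ Finset.univ.erase t, ENNReal.ofReal (hat c q α)⁻¹ := by
        rw [add_zero]; exact hyperVolume_box_le ht
    _ = _ := by
        rw [← ENNReal.ofReal_prod_of_nonneg fun α _ => (inv_pos.2 (hat_pos hc hq α)).le,
          prod_erase_hat hc hq ht htq]

/-- The body contains all combinations of the `d - 1` extremal rays of the bands other than `t` with
coefficients in a box of sides `1 / (d * hat)`, each term costing at most `1 / d`. -/
theorem le_hyperVolume_body {c q : Fin d → ℝ} (hc : IsSign c) (hq : ∀ α, 0 < q α) :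
    ENNReal.ofReal (((d : ℝ)⁻¹) ^ (d - 1) * (minRev c q / ∏ α, hat c q α)) ≤
      hyperVolume c (body q) := by
  obtain ⟨t, ht, htq⟩ := exists_minOn q hc.pos
  obtain ⟨b, hb, hbq⟩ := exists_minOn q hc.neg
  have htb : t ≠ b := by rintro rfl; rw [ht] at hb; norm_num at hb
  have hu : c ⬝ᵥ Pi.single t 1 = 1 := by simp [ht]
  have hd : (0 : ℝ) < d := by
    have : 0 < d := t.pos
    exact_mod_cast this
  -- `t` and `b` are cheapest bands of the two signs. Each band of coefficient -1 is completed by an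
  -- equal width of `t`, each one of coefficient 1 other than `t` by an equal width of `b`; both
  -- completions are shears.
  set k₁ : Fin d → ℝ := fun α => if c α = -1 then 1 else 0 with hk₁
  set k₂ : Fin d → ℝ := fun α => if c α = 1 ∧ α ≠ t then 1 else 0 with hk₂
  have hs₁ := shear_measurePreserving (k := k₁) (v := Pi.single t (1 : ℝ))
    (by simp [hk₁, ht]; norm_num)
  have hs₂ := shear_measurePreserving (k := k₂) (v := Pi.single b (1 : ℝ))
    (by simp [hk₂, hb]; norm_num)
  have hs := hs₂.comp hs₁
  set r : Fin d → ℝ := fun α => (d : ℝ)⁻¹ * (hat c q α)⁻¹ with hr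
  have hr0 : ∀ α, 0 ≤ r α := fun α =>
    mul_nonneg (inv_nonneg.2 hd.le) (inv_nonneg.2 (hat_pos hc hq α).le)
  set R : Set (Fin d → ℝ) := Set.univ.pi fun α => if α = t then Set.Icc 0 1 else Set.Icc 0 (r α)
    with hR
  have hRvol : volume R = ENNReal.ofReal (((d : ℝ)⁻¹) ^ (d - 1) *
      (minRev c q / ∏ α, hat c q α)) := by
    rw [hR, volume_pi_pi, ← Finset.mul_prod_erase _ _ (Finset.mem_univ t)]
    simp only [if_true, Real.volume_Icc, sub_zero, ENNReal.ofReal_one, one_mul]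
    rw [← prod_erase_hat hc hq ht htq]
    have : ((d : ℝ)⁻¹) ^ (d - 1) * ∏ α ∈ Finset.univ.erase t, (hat c q α)⁻¹ =
        ∏ α ∈ Finset.univ.erase t, r α := by
      rw [hr, Finset.prod_mul_distrib, Finset.prod_const, Finset.card_erase_of_mem
        (Finset.mem_univ t), Finset.card_univ, Fintype.card_fin]
    rw [this, ENNReal.ofReal_prod_of_nonneg fun α _ => hr0 α]
    refine Finset.prod_congr rfl fun α hα => ?_
    rw [if_neg (Finset.ne_of_mem_erase hα), Real.volume_Icc, sub_zero]
  rw [← hRvol, hyperVolume_eq hu, slabVolume,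
    Measure.map_apply (measurable_hyperProj _ _) (measurableSet_body q),
    Measure.restrict_apply' (measurableSet_slab c)]
  have hpre := hs.measure_preimage ((measurable_hyperProj c (Pi.single t 1)
    (measurableSet_body q)).inter (measurableSet_slab c)).nullMeasurableSet
  rw [← hpre]
  refine measure_mono fun y hy => ?_
  have hyt : 0 ≤ y t ∧ y t ≤ 1 := by have := hy t (Set.mem_univ t); simpa using this
  have hyr : ∀ α, α ≠ t → 0 ≤ y α ∧ y α ≤ r α := fun α hα => by
    have := hy α (Set.mem_univ α); simpa [hα] using this
  have hy0 : ∀ α, 0 ≤ y α := fun α => by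
    by_cases h : α = t
    · subst h; exact hyt.1
    · exact (hyr α h).1
  have hk₂t : k₂ t = 0 := by simp [hk₂]
  set X : Fin d → ℝ := y + (k₁ ⬝ᵥ y) • Pi.single t 1 + (k₂ ⬝ᵥ y) • Pi.single b 1 with hX
  have hcomp : ((fun x : Fin d → ℝ => x + (k₂ ⬝ᵥ x) • Pi.single b (1 : ℝ)) ∘
      fun x : Fin d → ℝ => x + (k₁ ⬝ᵥ x) • Pi.single t (1 : ℝ)) y = X := by
    simp only [Function.comp_apply, hX]
    congr 2
    rw [dotProduct_add, dotProduct_smul, dotProduct_single, hk₂t]; simp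
  have hk₁0 : 0 ≤ k₁ ⬝ᵥ y := Finset.sum_nonneg fun α _ =>
    mul_nonneg (by simp only [hk₁]; split_ifs <;> norm_num) (hy0 α)
  have hk₂0 : 0 ≤ k₂ ⬝ᵥ y := Finset.sum_nonneg fun α _ =>
    mul_nonneg (by simp only [hk₂]; split_ifs <;> norm_num) (hy0 α)
  have hcX : c ⬝ᵥ X = y t := by
    rw [hX, dotProduct_add, dotProduct_add, dotProduct_smul, dotProduct_smul, dotProduct_single,
      dotProduct_single, ht, hb]
    have : c = Pi.single t 1 - k₁ + k₂ := by
      ext α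
      simp only [Pi.add_apply, Pi.sub_apply, hk₁, hk₂, Pi.single_apply]
      by_cases e : α = t
      · subst e; simp [ht]; norm_num
      · rcases hc.mem α with h | h | h <;> simp [h, e] <;> norm_num
    conv_lhs => enter [1, 1]; rw [this]
    rw [add_dotProduct, sub_dotProduct, single_dotProduct]
    simp only [smul_eq_mul]; ring
  rw [Set.mem_preimage, hcomp]
  refine ⟨?_, by rw [Set.mem_ofPred_eq, hcX]; exact hyt⟩
  rw [Set.mem_preimage, hyperProj, hcX]
  constructor
  · intro α
    simp only [hX, Pi.sub_apply, Pi.add_apply, Pi.smul_apply, smul_eq_mul, Pi.single_apply]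
    by_cases e : α = t
    · subst e
      simp [htb, hk₁0]
    · by_cases e' : α = b
      · subst e'; simp [e]; linarith [hy0 α]
      · simp [e, e']; exact hy0 α
  · rw [dotProduct_sub, dotProduct_smul, dotProduct_single, hX, dotProduct_add, dotProduct_add,
      dotProduct_smul, dotProduct_smul, dotProduct_single, dotProduct_single]
    -- The projection removes `y t`, and what remains is the cost of the rays, one weight `hat` for
    -- each unit of `y`.
    have hsum : q ⬝ᵥ y + (k₁ ⬝ᵥ y) • (q t * 1) + (k₂ ⬝ᵥ y) • (q b * 1) - y t • (q t * 1) =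
        ∑ α ∈ Finset.univ.erase t, hat c q α * y α := by
      have h1 : q ⬝ᵥ y = q t * y t + ∑ α ∈ Finset.univ.erase t, q α * y α := by
        rw [Finset.add_sum_erase _ (fun α => q α * y α) (Finset.mem_univ t)]; rfl
      have h2 : k₁ ⬝ᵥ y = ∑ α ∈ Finset.univ.erase t, k₁ α * y α := by
        rw [dotProduct, ← Finset.add_sum_erase _ _ (Finset.mem_univ t)]
        have : k₁ t = 0 := by simp [hk₁, ht]; norm_num
        rw [this]; ring
      have h3 : k₂ ⬝ᵥ y = ∑ α ∈ Finset.univ.erase t, k₂ α * y α := by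
        rw [dotProduct, ← Finset.add_sum_erase _ _ (Finset.mem_univ t)]
        rw [hk₂t]; ring
      rw [h1, h2, h3]
      simp only [smul_eq_mul, mul_one]
      have : ∀ A B C D : ℝ, A + D + B + C - A = D + B + C := by intros; ring
      rw [mul_comm (y t), this, Finset.sum_mul, Finset.sum_mul, ← Finset.sum_add_distrib,
        ← Finset.sum_add_distrib]
      refine Finset.sum_congr rfl fun α hα => ?_
      have hα := Finset.ne_of_mem_erase hα
      rcases hc.mem α with h | h | h
      · rw [hat_of_zero h]; simp [hk₁, hk₂, h]
      · rw [hat_of_one h, ← hbq]; simp [hk₁, hk₂, h, hα]; norm_num; ring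
      · rw [hat_of_neg_one h, ← htq]; simp [hk₁, hk₂, h]; norm_num; ring
    rw [hsum]
    calc ∑ α ∈ Finset.univ.erase t, hat c q α * y α ≤ ∑ α ∈ Finset.univ.erase t, (d : ℝ)⁻¹ := by
          refine Finset.sum_le_sum fun α hα => ?_
          have := (hyr α (Finset.ne_of_mem_erase hα)).2
          calc hat c q α * y α ≤ hat c q α * r α :=
                mul_le_mul_of_nonneg_left this (hat_pos hc hq α).le
            _ = (d : ℝ)⁻¹ := by
                rw [hr]; field_simp [(hat_pos hc hq α).ne']
      _ ≤ 1 := by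
          rw [Finset.sum_const, Finset.card_erase_of_mem (Finset.mem_univ t), Finset.card_univ,
            Fintype.card_fin, nsmul_eq_mul, ← div_eq_mul_inv, div_le_one hd]
          exact_mod_cast Nat.sub_le d 1

end BandExchange

namespace BandExchange

open MeasureTheory Filter
open scoped ENNReal

variable {d : ℕ}

/-! ### Sets determined by finitely many letters of a code -/

section Code

variable {X S : Type*} {code : X → ℕ → S}

/-- The points whose code agrees with that of `y` in the first `n` places. -/
def cylinder (code : X → ℕ → S) (n : ℕ) (y : X) : Set X := {x | ∀ i < n, code x i = code y i}

/-- Membership in `A` depends only on the first `n` letters of the code. -/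
def Determined (code : X → ℕ → S) (n : ℕ) (A : Set X) : Prop :=
  ∀ x y, (∀ i < n, code x i = code y i) → x ∈ A → y ∈ A

theorem cylinder_eq {n : ℕ} {x y : X} (h : x ∈ cylinder code n y) :
    cylinder code n y = cylinder code n x := by
  ext w
  exact ⟨fun hw i hi => (hw i hi).trans (h i hi).symm, fun hw i hi => (hw i hi).trans (h i hi)⟩

theorem Determined.mono {n m : ℕ} {A : Set X} (h : Determined code n A) (hnm : n ≤ m) :
    Determined code m A := fun x y hxy hx => h x y (fun i hi => hxy i (hi.trans_le hnm)) hx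

theorem Determined.compl {n : ℕ} {A : Set X} (h : Determined code n A) : Determined code n Aᶜ :=
  fun x y hxy hx hy => hx (h y x (fun i hi => (hxy i hi).symm) hy)

theorem Determined.iInter {ι : Sort*} {n : ℕ} {A : ι → Set X}
    (h : ∀ i, Determined code n (A i)) : Determined code n (⋂ i, A i) :=
  fun x y hxy hx => Set.mem_iInter.2 fun i => h i x y hxy (Set.mem_iInter.1 hx i)

theorem Determined.cylinder_subset {n : ℕ} {A : Set X} (h : Determined code n A) {y : X}
    (hy : y ∈ A) : cylinder code n y ⊆ A :=
  fun x hx => h y x (fun i hi => (hx i hi).symm) hy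

theorem Determined.eq_iUnion {n : ℕ} (A : Set X) :
    A = ⋃ v : Fin n → S, A ∩ {x | ∀ i : Fin n, code x i = v i} := by
  ext x
  simp only [Set.mem_iUnion, Set.mem_inter_iff, Set.mem_ofPred_eq]
  exact ⟨fun h => ⟨fun i => code x i, h, fun _ => rfl⟩, fun ⟨_, h, _⟩ => h⟩

theorem Determined.inter_fiber {n : ℕ} {A : Set X} (h : Determined code n A) (v : Fin n → S) :
    A ∩ {x | ∀ i : Fin n, code x i = v i} = ∅ ∨
      ∃ y ∈ A, A ∩ {x | ∀ i : Fin n, code x i = v i} = cylinder code n y := by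
  rcases (A ∩ {x | ∀ i : Fin n, code x i = v i}).eq_empty_or_nonempty with h0 | ⟨y, hy, hv⟩
  · exact .inl h0
  · refine .inr ⟨y, hy, Set.Subset.antisymm (fun x hx i hi => ?_) fun x hx => ?_⟩
    · exact (hx.2 ⟨i, hi⟩).trans (hv ⟨i, hi⟩).symm
    · exact ⟨h.cylinder_subset hy hx, fun i => (hx i i.2).trans (hv i)⟩

variable [MeasurableSpace X] [Finite S]

theorem Determined.measurableSet (hcode : ∀ n y, MeasurableSet (cylinder code n y)) {n : ℕ}
    {A : Set X} (h : Determined code n A) : MeasurableSet A := by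
  rw [Determined.eq_iUnion (code := code) (n := n) A]
  refine MeasurableSet.iUnion fun v => ?_
  rcases h.inter_fiber v with h0 | ⟨y, _, hy⟩
  · rw [h0]; exact MeasurableSet.empty
  · rw [hy]; exact hcode n y

theorem Determined.measure_le (hcode : ∀ n y, MeasurableSet (cylinder code n y))
    {μ ν : Measure X} {n : ℕ} {A : Set X} (h : Determined code n A)
    (hle : ∀ y ∈ A, μ (cylinder code n y) ≤ ν (cylinder code n y)) : μ A ≤ ν A := by
  have hm : ∀ v : Fin n → S, MeasurableSet (A ∩ {x | ∀ i : Fin n, code x i = v i}) := fun v => by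
    rcases h.inter_fiber v with h0 | ⟨y, _, hy⟩
    · rw [h0]; exact MeasurableSet.empty
    · rw [hy]; exact hcode n y
  have hd : Pairwise (Function.onFun Disjoint
      fun v : Fin n → S => A ∩ {x | ∀ i : Fin n, code x i = v i}) := by
    intro v w hvw
    rw [Function.onFun, Set.disjoint_left]
    rintro x ⟨_, h1⟩ ⟨_, h2⟩
    exact hvw (funext fun i => (h1 i).symm.trans (h2 i))
  rw [Determined.eq_iUnion (code := code) (n := n) A, measure_iUnion hd hm, measure_iUnion hd hm]
  refine ENNReal.tsum_le_tsum fun v => ?_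
  rcases h.inter_fiber v with h0 | ⟨y, hyA, hy⟩
  · rw [h0]; simp
  · rw [hy]; exact hle y hyA

/-- Compare two measures on a set exhausted by cylinders on which they are compared. -/
theorem measure_iUnion_le_of_cylinder (hcode : ∀ n y, MeasurableSet (cylinder code n y))
    {μ ν : Measure X} {P : ℕ → Set X} (hP : ∀ n, Determined code n (P n))
    (hle : ∀ n, ∀ y ∈ P n, μ (cylinder code n y) ≤ ν (cylinder code n y)) :
    μ (⋃ n, P n) ≤ ν (⋃ n, P n) := by
  have hD : ∀ n, Determined code n (disjointed P n) := fun n x y hxy hx => by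
    rw [disjointed_eq_inter_compl] at hx ⊢
    refine ⟨hP n x y hxy hx.1, Set.mem_iInter₂.2 fun j hj => ?_⟩
    exact ((hP j).compl.mono hj.le) x y hxy (Set.mem_iInter₂.1 hx.2 j hj)
  rw [← iUnion_disjointed, measure_iUnion (disjoint_disjointed P) fun n => (hD n).measurableSet hcode,
    measure_iUnion (disjoint_disjointed P) fun n => (hD n).measurableSet hcode]
  exact ENNReal.tsum_le_tsum fun n =>
    (hD n).measure_le hcode fun y hy => hle n y (disjointed_subset P n hy)

/-- If the events `A n` occur infinitely often and after each occurrence some later `G i` has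
conditional probability at least `c`, then the events `G i` occur infinitely often. -/
theorem frequently_of_frequently (hcode : ∀ n y, MeasurableSet (cylinder code n y))
    {μ : Measure X} [IsFiniteMeasure μ] {A G : ℕ → Set X} {L : ℕ}
    (hA : ∀ n, Determined code n (A n)) (hG : ∀ n, Determined code (n + L) (G n))
    (hio : ∀ᵐ x ∂μ, ∃ᶠ n in atTop, x ∈ A n) {c : ℝ≥0∞} (hc : c ≠ 0)
    (h : ∀ n, ∀ y ∈ A n, c * μ (cylinder code n y) ≤ μ (cylinder code n y ∩ ⋃ i ≥ n, G i)) :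
    ∀ᵐ x ∂μ, ∃ᶠ n in atTop, x ∈ G n := by
  have hGm : ∀ n, MeasurableSet (G n) := fun n => (hG n).measurableSet hcode
  -- `B N` is the event that no `G i` occurs from time `N` on.
  set B : ℕ → Set X := fun N => ⋂ i ≥ N, (G i)ᶜ with hB
  have hBm : ∀ N, MeasurableSet (B N) := fun N =>
    MeasurableSet.iInter fun i => MeasurableSet.iInter fun _ => (hGm i).compl
  suffices hnull : ∀ N, μ (B N) = 0 by
    have : ∀ᵐ x ∂μ, ∀ N, x ∉ B N := ae_all_iff.2 fun N => measure_eq_zero_iff_ae_notMem.1 (hnull N)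
    filter_upwards [this] with x hx
    rw [frequently_atTop]
    intro N
    have := hx N
    simp only [hB, Set.mem_iInter, Set.mem_compl_iff, not_forall, not_not] at this
    obtain ⟨i, hi, hxi⟩ := this
    exact ⟨i, hi, hxi⟩
  intro N
  set BB : ℕ → Set X := fun m => ⋂ i, ⋂ (_ : N ≤ i ∧ i < m), (G i)ᶜ with hBB
  have hBBd : ∀ m, Determined code (m + L) (BB m) := fun m =>
    Determined.iInter fun i => Determined.iInter fun hi => ((hG i).mono (by omega)).compl
  have hBsub : ∀ m, B N ⊆ BB m := fun m x hx => by
    simp only [hB, hBB, Set.mem_iInter] at hx ⊢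
    exact fun i hi => hx i hi.1
  have hBlim : B N = ⋂ m, BB m := by
    refine Set.Subset.antisymm (Set.subset_iInter hBsub) fun x hx => ?_
    simp only [hB, hBB, Set.mem_iInter] at hx ⊢
    exact fun i hi => hx (i + 1) i ⟨hi, Nat.lt_succ_self i⟩
  -- `BB m` depends on the first `m + L` letters only. Almost every point of `B N` meets some `A n`
  -- later than that, and on the cylinder of that moment a fraction of at least `c` is lost. Letting
  -- `m` grow forces `μ (B N) ≤ (1 - c) * μ (B N)`.
  have hstep : ∀ m, μ (B N) ≤ (1 - c) * μ (BB m) := fun m => by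
    set P : ℕ → Set X := fun n => {x | max (m + L) N ≤ n ∧ x ∈ A n ∧ x ∈ BB m} with hP
    have hPd : ∀ n, Determined code n (P n) := fun n x y hxy hx =>
      ⟨hx.1, hA n x y hxy hx.2.1, (hBBd m).mono ((le_max_left _ _).trans hx.1) x y hxy hx.2.2⟩
    have key := measure_iUnion_le_of_cylinder hcode (μ := μ.restrict (B N)) (ν := (1 - c) • μ) hPd
      (fun n y hy => by
        have hcy := hcode n y
        rw [Measure.restrict_apply hcy, Measure.smul_apply, smul_eq_mul]
        have hsub : cylinder code n y ∩ B N ⊆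
            cylinder code n y \ (cylinder code n y ∩ ⋃ i ≥ n, G i) := by
          rintro x ⟨h1, h2⟩
          refine ⟨h1, fun h3 => ?_⟩
          obtain ⟨i, hi, hx⟩ := Set.mem_iUnion₂.1 h3.2
          exact Set.mem_iInter₂.1 h2 i ((le_max_right _ _).trans (hy.1.trans hi)) hx
        refine (measure_mono hsub).trans ?_
        have hm2 : MeasurableSet (cylinder code n y ∩ ⋃ i ≥ n, G i) :=
          hcy.inter (MeasurableSet.iUnion fun i => MeasurableSet.iUnion fun _ => hGm i)
        rw [measure_sdiff Set.inter_subset_left hm2.nullMeasurableSet (measure_ne_top _ _),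
          ENNReal.sub_mul fun _ _ => measure_ne_top _ _, one_mul]
        exact tsub_le_tsub_left (h n y hy.2.1) _)
    have hPsub : ⋃ n, P n ⊆ BB m := Set.iUnion_subset fun n x hx => hx.2.2
    have hPae : ∀ᵐ x ∂μ, x ∈ B N → x ∈ ⋃ n, P n := by
      filter_upwards [hio] with x hx hxB
      obtain ⟨n, hn, hxn⟩ := (frequently_atTop.1 hx) (max (m + L) N)
      exact Set.mem_iUnion.2 ⟨n, hn, hxn, hBsub m hxB⟩
    calc μ (B N) ≤ μ.restrict (B N) (⋃ n, P n) := by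
          rw [Measure.restrict_apply' (hBm N)]
          refine measure_mono_ae ?_
          filter_upwards [hPae] with x hx hxB
          exact ⟨hx hxB, hxB⟩
      _ ≤ (1 - c) * μ (⋃ n, P n) := key
      _ ≤ (1 - c) * μ (BB m) := mul_le_mul_right (measure_mono hPsub) _
  have hlim : Tendsto (fun m => μ (BB m)) atTop (nhds (μ (B N))) := by
    rw [hBlim]
    refine tendsto_measure_iInter_atTop
      (fun m => ((hBBd m).measurableSet hcode).nullMeasurableSet) ?_ ⟨0, measure_ne_top _ _⟩
    intro m m' hmm x hx
    simp only [hBB, Set.mem_iInter] at hx ⊢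
    exact fun i hi => hx i ⟨hi.1, hi.2.trans_le hmm⟩
  have hle : μ (B N) ≤ (1 - c) * μ (B N) :=
    ge_of_tendsto' (ENNReal.Tendsto.const_mul hlim (.inr (by simp))) hstep
  by_contra hne
  have hlt : (1 - c) * μ (B N) < 1 * μ (B N) :=
    ENNReal.mul_lt_mul_left hne (measure_ne_top _ _)
      (ENNReal.sub_lt_self ENNReal.one_ne_top one_ne_zero hc)
  rw [one_mul] at hlt
  exact absurd hle hlt.not_ge

end Code

end BandExchange

namespace BandExchange

open MeasureTheory Filter Matrix
open scoped ENNReal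

variable {d : ℕ}

/-! ### Null sets of the volume on a hyperplane -/

theorem measurableSet_generic (π : NonClassical d) : MeasurableSet π.generic := by
  have : π.generic = (⋂ α, {x | 0 < x α}) ∩ ({x | π.1.coef ⬝ᵥ x = 0} ∩
      ⋂ g : Fin d → ℤ, {x | (fun α => (g α : ℝ)) ⬝ᵥ x = 0 →
        ∃ r : ℝ, ∀ α, (g α : ℝ) = r * π.1.coef α}) := by
    ext x; simp [NonClassical.generic]
  rw [this]
  refine (MeasurableSet.iInter fun α => measurableSet_lt measurable_const
    (measurable_pi_apply α)).inter ((measurable_dotProduct _ (measurableSet_singleton 0)).inter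
      (MeasurableSet.iInter fun g => ?_))
  by_cases h : ∃ r : ℝ, ∀ α, (g α : ℝ) = r * π.1.coef α
  · simp [h]
  · simp only [h, imp_false]
    exact (measurable_dotProduct _ (measurableSet_singleton 0)).compl

theorem hyperVolume_hyperplane {c g : Fin d → ℝ} (hg : ∀ r : ℝ, g ≠ r • c) :
    hyperVolume c {x | g ⬝ᵥ x = 0} = 0 := slabVolume_hyperplane hg

theorem hyperVolume_dotProduct_ne {c : Fin d → ℝ} (hc : IsSign c) :
    hyperVolume c {x | c ⬝ᵥ x ≠ 0} = 0 := by
  obtain ⟨u, hu⟩ := hc.exists_one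
  rw [hyperVolume_eq hu]; exact slabVolume_dotProduct_ne hu

theorem IsSign.single_ne {c : Fin d → ℝ} (hc : IsSign c) (α : Fin d) (r : ℝ) :
    (Pi.single α 1 : Fin d → ℝ) ≠ r • c := by
  intro h
  obtain ⟨β, hβ⟩ := hc.pos
  obtain ⟨γ, hγ⟩ := hc.neg
  have h1 := congrFun h β
  have h2 := congrFun h γ
  have h3 := congrFun h α
  simp only [Pi.smul_apply, smul_eq_mul, hβ, hγ, Pi.single_eq_same] at h1 h2 h3
  have hr : r ≠ 0 := by rintro rfl; simp at h3
  by_cases e : β = α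
  · have e' : γ ≠ α := by rintro rfl; subst e; rw [hβ] at hγ; norm_num at hγ
    rw [Pi.single_eq_of_ne e'] at h2
    exact hr (by linarith)
  · rw [Pi.single_eq_of_ne e] at h1
    exact hr (by linarith)

/-- The volume on the generic points `x` with `q ⬝ᵥ x ≤ 1`. -/
noncomputable def stageVolume (π : NonClassical d) (q : Fin d → ℝ) : Measure (Fin d → ℝ) :=
  (hyperVolume π.1.coef).restrict (π.generic ∩ {x | q ⬝ᵥ x ≤ 1})

theorem stageVolume_apply (π : NonClassical d) (q : Fin d → ℝ) (A : Set (Fin d → ℝ)) :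
    stageVolume π q A = hyperVolume π.1.coef (A ∩ (π.generic ∩ {x | q ⬝ᵥ x ≤ 1})) :=
  Measure.restrict_apply' ((measurableSet_generic π).inter
    (measurable_dotProduct q measurableSet_Iic))

theorem stageVolume_mem_generic (π : NonClassical d) (q : Fin d → ℝ) :
    ∀ᵐ x ∂stageVolume π q, x ∈ π.generic :=
  (ae_restrict_mem ((measurableSet_generic π).inter
    (measurable_dotProduct q measurableSet_Iic))).mono fun _ hx => hx.1

theorem exists_generic_of_ne_zero {π : NonClassical d} {q : Fin d → ℝ} {A : Set (Fin d → ℝ)}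
    (h : stageVolume π q A ≠ 0) : ∃ x ∈ A, x ∈ π.generic := by
  by_contra! hcon
  exact h (measure_mono_null (t := {x | ¬ x ∈ π.generic}) (fun x hx => hcon x hx)
    (ae_iff.1 (stageVolume_mem_generic π q)))

variable [NeZero d]

/-! ### The dynamics -/

theorem NonClassical.isSign (π : NonClassical d) : IsSign π.1.coef :=
  ⟨π.1.coef_mem, π.exists_coef.1, π.exists_coef.2⟩

variable (d) in
/-- A stage of the expansion: a combinatorial type, the norms of the columns of the matrix, and
the widths. -/
@[ext] structure Stage where
  typ : NonClassical d
  norm : Fin d → ℝ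
  width : Fin d → ℝ

namespace Stage

/-- The side of the wider critical band. -/
noncomputable def side (z : Stage d) : Side := z.typ.sideOf z.width

/-- The wider critical band. -/
noncomputable def winner (z : Stage d) : Fin d := z.typ.win z.side

/-- The narrower critical band. -/
noncomputable def loser (z : Stage d) : Fin d := z.typ.win z.side.opp

/-- Rauzy induction. -/
noncomputable def step (z : Stage d) : Stage d :=
  ⟨z.typ.next z.side, grow z.loser z.winner z.norm, shrink z.winner z.loser z.width⟩

theorem winner_ne_loser (z : Stage d) : z.winner ≠ z.loser := z.typ.win_ne _

/-- This invariant makes the truncation `q ⬝ᵥ x ≤ 1` compatible with splits, which is why norms are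
carried along with the widths. -/
theorem step_norm_dotProduct (z : Stage d) : z.step.norm ⬝ᵥ z.step.width = z.norm ⬝ᵥ z.width := by
  simp only [step]
  rw [grow_dotProduct, grow_shrink z.winner_ne_loser]

theorem iterate_norm_dotProduct (z : Stage d) (n : ℕ) :
    (step^[n] z).norm ⬝ᵥ (step^[n] z).width = z.norm ⬝ᵥ z.width := by
  induction n with
  | zero => rfl
  | succ n ih => rw [Function.iterate_succ_apply', step_norm_dotProduct, ih]

theorem step_norm_pos {z : Stage d} (h : ∀ α, 0 < z.norm α) (α : Fin d) : 0 < z.step.norm α := by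
  simp only [step]
  by_cases e : α = z.loser
  · subst e; rw [grow_same]; exact add_pos (h _) (h _)
  · rw [grow_of_ne e]; exact h α

theorem iterate_norm_pos {z : Stage d} (h : ∀ α, 0 < z.norm α) (n : ℕ) :
    ∀ α, 0 < (step^[n] z).norm α := by
  induction n with
  | zero => exact h
  | succ n ih => rw [Function.iterate_succ_apply']; exact step_norm_pos ih

/-- The sides of the first `n` splits agree. -/
def Agree (n : ℕ) (z z' : Stage d) : Prop := ∀ i < n, (step^[i] z).side = (step^[i] z').side

theorem agree_succ {n : ℕ} {z z' : Stage d} :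
    Agree (n + 1) z z' ↔ z.side = z'.side ∧ Agree n z.step z'.step := by
  refine ⟨fun h => ⟨h 0 n.succ_pos, fun i hi => ?_⟩, fun h i hi => ?_⟩
  · have := h (i + 1) (by omega)
    rwa [Function.iterate_succ_apply, Function.iterate_succ_apply] at this
  · cases i with
    | zero => exact h.1
    | succ i =>
      rw [Function.iterate_succ_apply, Function.iterate_succ_apply]
      exact h.2 i (by omega)

theorem Agree.symm {n : ℕ} {z z' : Stage d} (h : Agree n z z') : Agree n z' z :=
  fun i hi => (h i hi).symm

theorem Agree.mono {n m : ℕ} {z z' : Stage d} (h : Agree n z z') (hm : m ≤ n) : Agree m z z' :=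
  fun i hi => h i (hi.trans_le hm)

theorem Agree.iterate {n m : ℕ} {z z' : Stage d} (h : Agree (n + m) z z') :
    Agree m (step^[n] z) (step^[n] z') := fun i hi => by
  rw [← Function.iterate_add_apply, ← Function.iterate_add_apply]
  exact h _ (by omega)

theorem Agree.typ_eq {n : ℕ} {z z' : Stage d} (h : Agree n z z') (ht : z.typ = z'.typ) :
    (step^[n] z).typ = (step^[n] z').typ := by
  induction n with
  | zero => exact ht
  | succ n ih =>
    rw [Function.iterate_succ_apply', Function.iterate_succ_apply']
    simp only [step]
    rw [ih (h.mono n.le_succ), h n n.lt_succ_self]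

theorem winner_congr {z z' : Stage d} (ht : z.typ = z'.typ) (hs : z.side = z'.side) :
    z.winner = z'.winner := by
  simp only [winner, ht, hs]

theorem loser_congr {z z' : Stage d} (ht : z.typ = z'.typ) (hs : z.side = z'.side) :
    z.loser = z'.loser := by
  simp only [loser, ht, hs]

theorem Agree.norm_eq {n : ℕ} {z z' : Stage d} (h : Agree n z z') (ht : z.typ = z'.typ)
    (hn : z.norm = z'.norm) : (step^[n] z).norm = (step^[n] z').norm := by
  induction n with
  | zero => exact hn
  | succ n ih =>
    rw [Function.iterate_succ_apply', Function.iterate_succ_apply']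
    have h1 := (h.mono n.le_succ).typ_eq ht
    have h2 := h n n.lt_succ_self
    simp only [step]
    rw [ih (h.mono n.le_succ), winner_congr h1 h2, loser_congr h1 h2]

/-- The norms do not influence the types and the widths. -/
theorem iterate_congr {z z' : Stage d} (ht : z.typ = z'.typ) (hw : z.width = z'.width) (n : ℕ) :
    (step^[n] z).typ = (step^[n] z').typ ∧ (step^[n] z).width = (step^[n] z').width := by
  induction n with
  | zero => exact ⟨ht, hw⟩
  | succ n ih =>
    have hs : (step^[n] z).side = (step^[n] z').side := by simp only [side, ih.1, ih.2]
    rw [Function.iterate_succ_apply', Function.iterate_succ_apply']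
    simp only [step]
    rw [winner_congr ih.1 hs, loser_congr ih.1 hs, ih.1, ih.2, hs]
    exact ⟨rfl, rfl⟩

theorem agree_of_width {z z' : Stage d} (ht : z.typ = z'.typ) (hw : z.width = z'.width) (n : ℕ) :
    Agree n z z' := fun i _ => by
  obtain ⟨h1, h2⟩ := iterate_congr ht hw i
  simp only [side, h1, h2]

end Stage

/-- A set of types in which some split is possible from every type and which no split leaves. -/
structure IsClosedClass (G : Set (NonClassical d)) : Prop where
  exists_valid : ∀ π ∈ G, ∃ s, π.Valid s
  next_mem : ∀ π ∈ G, ∀ s, π.Valid s → π.next s ∈ G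

/-- The type belongs to `G`, the widths are generic and the norms are positive. -/
structure Stage.Good (G : Set (NonClassical d)) (z : Stage d) : Prop where
  typ_mem : z.typ ∈ G
  width_mem : z.width ∈ z.typ.generic
  norm_pos : ∀ α, 0 < z.norm α

namespace Stage

variable {G : Set (NonClassical d)}

theorem Good.loser_lt_winner (hG : IsClosedClass G) {z : Stage d} (hz : z.Good G) :
    z.width z.loser < z.width z.winner :=
  NonClassical.lt_of_mem_generic (hG.exists_valid _ hz.typ_mem) hz.width_mem

theorem Good.valid (hG : IsClosedClass G) {z : Stage d} (hz : z.Good G) : z.typ.Valid z.side :=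
  z.typ.valid_of_pos hz.width_mem.1 hz.width_mem.2.1 (hz.loser_lt_winner hG)

theorem Good.step (hG : IsClosedClass G) {z : Stage d} (hz : z.Good G) : z.step.Good G :=
  ⟨hG.next_mem _ hz.typ_mem _ (hz.valid hG),
    (hz.valid hG).shrink_mem hz.width_mem (hz.loser_lt_winner hG), step_norm_pos hz.norm_pos⟩

theorem Good.iterate (hG : IsClosedClass G) {z : Stage d} (hz : z.Good G) (n : ℕ) :
    (Stage.step^[n] z).Good G := by
  induction n with
  | zero => exact hz
  | succ n ih => rw [Function.iterate_succ_apply']; exact ih.step hG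

theorem Good.coef_step (hG : IsClosedClass G) {z : Stage d} (hz : z.Good G) :
    z.step.typ.1.coef = grow z.loser z.winner z.typ.1.coef :=
  (hz.valid hG).coef_next

end Stage

/-! ### Measures on the generic points -/

/-- Genericity can fail for a nonnegative vector only off the hyperplane or on countably many proper
subspaces of it: the coordinate ones and those of integral relations. -/
theorem hyperVolume_not_generic (π : NonClassical d) :
    hyperVolume π.1.coef {x | (∀ α, 0 ≤ x α) ∧ x ∉ π.generic} = 0 := by
  have hc := π.isSign
  have hsub : {x | (∀ α, 0 ≤ x α) ∧ x ∉ π.generic} ⊆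
      (⋃ α, {x | (Pi.single α 1 : Fin d → ℝ) ⬝ᵥ x = 0}) ∪ ({x | π.1.coef ⬝ᵥ x ≠ 0} ∪
      ⋃ g : {g : Fin d → ℤ // ∀ r : ℝ, (fun α => (g α : ℝ)) ≠ r • π.1.coef},
        {x | (fun α => (g.1 α : ℝ)) ⬝ᵥ x = 0}) := by
    rintro x ⟨h0, hx⟩
    by_contra hcon
    simp only [Set.mem_union, Set.mem_iUnion, Set.mem_ofPred_eq, not_or, not_exists, not_not,
      single_dotProduct, one_mul] at hcon
    obtain ⟨h1, h2, h3⟩ := hcon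
    refine hx ⟨fun α => lt_of_le_of_ne (h0 α) (Ne.symm (h1 α)), h2, fun g hg => ?_⟩
    by_contra hr
    push Not at hr
    refine h3 ⟨g, fun r e => ?_⟩ hg
    obtain ⟨α, hα⟩ := hr r
    exact hα (congrFun e α)
  refine measure_mono_null hsub (measure_union_null (measure_iUnion_null fun α => ?_)
    (measure_union_null (hyperVolume_dotProduct_ne hc) (measure_iUnion_null fun g => ?_)))
  · exact hyperVolume_hyperplane (hc.single_ne α)
  · exact hyperVolume_hyperplane g.2

theorem stageVolume_univ (π : NonClassical d) (q : Fin d → ℝ) :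
    stageVolume π q Set.univ = hyperVolume π.1.coef (body q) := by
  rw [stageVolume_apply, Set.univ_inter]
  refine le_antisymm (measure_mono fun x hx => ⟨fun α => (hx.1.1 α).le, hx.2⟩) ?_
  have : body q ⊆ (π.generic ∩ {x | q ⬝ᵥ x ≤ 1}) ∪ {x | (∀ α, 0 ≤ x α) ∧ x ∉ π.generic} := by
    rintro x ⟨h1, h2⟩
    by_cases h : x ∈ π.generic
    · exact .inl ⟨h, h2⟩
    · exact .inr ⟨h1, h⟩
  refine (measure_mono this).trans ((measure_union_le _ _).trans ?_)
  rw [hyperVolume_not_generic, add_zero]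

/-- The split maps the generic widths with winner on side `s` bijectively onto all generic widths of
the next type. It preserves hyperplane volume and turns the truncation by `q` into the one by the
new norms. -/
theorem stageVolume_step {π : NonClassical d} {s : Side} (h : π.Valid s) (q : Fin d → ℝ)
    (A : Set (Fin d → ℝ)) :
    stageVolume π q {x | π.sideOf x = s ∧ shrink (π.win s) (π.win s.opp) x ∈ A} =
      stageVolume (π.next s) (grow (π.win s.opp) (π.win s) q) A := by
  rw [stageVolume_apply, stageVolume_apply, h.coef_next,
    ← hyperVolume_grow π.isSign (π.win_ne s)]
  congr 1
  ext x
  constructor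
  · rintro ⟨⟨hs, hA⟩, hx, hq⟩
    have hlt := NonClassical.lt_of_mem_generic ⟨s, h⟩ hx
    rw [hs] at hlt
    refine ⟨_, ⟨hA, h.shrink_mem hx hlt, ?_⟩, grow_shrink (π.win_ne s) x⟩
    rw [Set.mem_ofPred_eq, grow_dotProduct, grow_shrink (π.win_ne s)]
    exact hq
  · rintro ⟨y, ⟨hA, hy, hq⟩, rfl⟩
    obtain ⟨h1, h2⟩ := h.grow_mem hy
    refine ⟨⟨h2, ?_⟩, h1, ?_⟩
    · rw [shrink_grow (π.win_ne s)]; exact hA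
    · rw [Set.mem_ofPred_eq, grow_dotProduct] at hq
      exact hq

/-- The Markov property: conditioned on the first `n` splits, the stage after them is distributed
like a fresh start. -/
theorem stageVolume_agree {G : Set (NonClassical d)} (hG : IsClosedClass G) {z : Stage d}
    (hz : z.Good G) (n : ℕ) (A : Set (Fin d → ℝ)) :
    stageVolume z.typ z.norm {x | Stage.Agree n ⟨z.typ, z.norm, x⟩ z ∧
      (Stage.step^[n] ⟨z.typ, z.norm, x⟩).width ∈ A} =
    stageVolume (Stage.step^[n] z).typ (Stage.step^[n] z).norm A := by
  induction n generalizing z with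
  | zero =>
    congr 1
    ext x
    simp [Stage.Agree]
  | succ n ih =>
    rw [Function.iterate_succ_apply, ← ih (hz.step hG)]
    have := stageVolume_step (hz.valid hG) z.norm
      {x | Stage.Agree n ⟨z.step.typ, z.step.norm, x⟩ z.step ∧
        (Stage.step^[n] ⟨z.step.typ, z.step.norm, x⟩).width ∈ A}
    refine Eq.trans ?_ this
    congr 1
    ext x
    simp only [Set.mem_ofPred_eq, Stage.agree_succ, Function.iterate_succ_apply]
    have key : z.typ.sideOf x = z.side → Stage.step ⟨z.typ, z.norm, x⟩ = ⟨z.step.typ, z.step.norm,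
        shrink (z.typ.win z.side) (z.typ.win z.side.opp) x⟩ := fun h => by
      simp only [Stage.step, Stage.side, Stage.winner, Stage.loser] at h ⊢
      rw [h]
    constructor
    · rintro ⟨⟨h1, h2⟩, h3⟩
      rw [key h1] at h2 h3
      exact ⟨h1, h2, h3⟩
    · rintro ⟨h1, h2, h3⟩
      rw [key h1]
      exact ⟨⟨h1, h2⟩, h3⟩

theorem isFiniteMeasure_stageVolume (π : NonClassical d) {q : Fin d → ℝ} (hq : ∀ α, 0 < q α) :
    IsFiniteMeasure (stageVolume π q) :=
  ⟨by
    rw [stageVolume_univ]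
    exact (hyperVolume_body_le π.isSign hq).trans_lt ENNReal.ofReal_lt_top⟩

instance : Finite Side :=
  Finite.of_injective (fun s : Side => decide (s = .top)) fun s t h => by
    cases s <;> cases t <;> simp at h ⊢

theorem measurableSet_sideOf (π : NonClassical d) (s : Side) :
    MeasurableSet {x | π.sideOf x = s} := by
  have ht : MeasurableSet {x : Fin d → ℝ | x (π.win .bot) < x (π.win .top)} :=
    measurableSet_lt (measurable_pi_apply _) (measurable_pi_apply _)
  cases s
  · convert ht using 1
    ext x
    simp [NonClassical.sideOf]
  · convert ht.compl using 1
    ext x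
    simp [NonClassical.sideOf]

/-- The sequence of sides of the splits, as a function of the initial widths. -/
noncomputable def sideCode (π : NonClassical d) (q x : Fin d → ℝ) (i : ℕ) : Side :=
  (Stage.step^[i] ⟨π, q, x⟩).side

theorem measurableSet_cylinder (π : NonClassical d) (q : Fin d → ℝ) (n : ℕ) (y : Fin d → ℝ) :
    MeasurableSet (cylinder (sideCode π q) n y) := by
  suffices h : ∀ (n : ℕ) (π : NonClassical d) (q : Fin d → ℝ) (w : ℕ → Side),
      MeasurableSet {x | ∀ i < n, sideCode π q x i = w i} from h n π q _
  clear y q π n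
  intro n
  induction n with
  | zero => intro π q w; simp
  | succ n ih =>
    intro π q w
    have : {x | ∀ i < n + 1, sideCode π q x i = w i} = {x | π.sideOf x = w 0} ∩
        shrink (π.win (w 0)) (π.win (w 0).opp) ⁻¹' {x | ∀ i < n, sideCode (π.next (w 0))
          (grow (π.win (w 0).opp) (π.win (w 0)) q) x i = w (i + 1)} := by
      ext x
      have key : π.sideOf x = w 0 → Stage.step ⟨π, q, x⟩ = ⟨π.next (w 0),
          grow (π.win (w 0).opp) (π.win (w 0)) q, shrink (π.win (w 0)) (π.win (w 0).opp) x⟩ :=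
        fun h => by simp only [Stage.step, Stage.side, Stage.winner, Stage.loser]; rw [h]
      simp only [Set.mem_inter_iff, Set.mem_preimage, Set.mem_ofPred_eq]
      constructor
      · intro h
        have h0 := h 0 n.succ_pos
        refine ⟨h0, fun i hi => ?_⟩
        have := h (i + 1) (by omega)
        rw [sideCode, Function.iterate_succ_apply, key h0] at this
        exact this
      · rintro ⟨h0, h⟩ i hi
        cases i with
        | zero => exact h0
        | succ i =>
          rw [sideCode, Function.iterate_succ_apply, key h0]
          exact h i (by omega)
    rw [this]
    exact (measurableSet_sideOf π (w 0)).inter (measurable_shrink _ _ (ih _ _ _))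

/-- If a property `E` of stages holds infinitely often and a stage with property `E` is followed by
one with property `F` with probability at least `c`, then `F` holds infinitely often. -/
theorem frequently_stage {G : Set (NonClassical d)} (hG : IsClosedClass G) {E F : Stage d → Prop}
    {L : ℕ} (hE : ∀ z z' : Stage d, z.typ = z'.typ → z.norm = z'.norm → E z → E z')
    (hF : ∀ z z' : Stage d, z.typ = z'.typ → z.norm = z'.norm → Stage.Agree L z z' → F z → F z')
    {c : ℝ≥0∞} (hc : c ≠ 0)
    (hprob : ∀ z : Stage d, z.Good G → E z → c * stageVolume z.typ z.norm Set.univ ≤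
      stageVolume z.typ z.norm {x | ∃ i, F (Stage.step^[i] ⟨z.typ, z.norm, x⟩)})
    {π : NonClassical d} (hπ : π ∈ G) {q : Fin d → ℝ} (hq : ∀ α, 0 < q α)
    (hio : ∀ᵐ x ∂stageVolume π q, ∃ᶠ n in atTop, E (Stage.step^[n] ⟨π, q, x⟩)) :
    ∀ᵐ x ∂stageVolume π q, ∃ᶠ n in atTop, F (Stage.step^[n] ⟨π, q, x⟩) := by
  have := isFiniteMeasure_stageVolume π hq
  refine frequently_of_frequently (code := sideCode π q) (measurableSet_cylinder π q)
    (A := fun n => {x | E (Stage.step^[n] ⟨π, q, x⟩)})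
    (G := fun n => {x | F (Stage.step^[n] ⟨π, q, x⟩)}) (L := L)
    (fun n x y hxy hx => ?_) (fun n x y hxy hx => ?_) hio hc fun n y hy => ?_
  · have ha : Stage.Agree n ⟨π, q, x⟩ ⟨π, q, y⟩ := hxy
    exact hE _ _ (ha.typ_eq rfl) (ha.norm_eq rfl rfl) hx
  · have ha : Stage.Agree (n + L) ⟨π, q, x⟩ ⟨π, q, y⟩ := hxy
    have ha' := ha.mono (Nat.le_add_right n L)
    exact hF _ _ (ha'.typ_eq rfl) (ha'.norm_eq rfl rfl) ha.iterate hx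
  -- The centre `y` need not be generic; a cylinder of positive volume can be recentred at a generic
  -- point, where the Markov property applies.
  · by_cases h0 : stageVolume π q (cylinder (sideCode π q) n y) = 0
    · rw [h0, mul_zero]; exact zero_le
    obtain ⟨y', hy', hyg⟩ := exists_generic_of_ne_zero h0
    have hcyl := cylinder_eq hy'
    have ha : Stage.Agree n ⟨π, q, y'⟩ ⟨π, q, y⟩ := hy'
    rw [hcyl]
    have hgood : Stage.Good G ⟨π, q, y'⟩ := ⟨hπ, hyg, hq⟩
    set z := Stage.step^[n] ⟨π, q, y'⟩ with hz
    have hzE : E z := hE _ _ (ha.typ_eq rfl).symm (ha.norm_eq rfl rfl).symm hy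
    have hp := hprob z (hgood.iterate hG n) hzE
    rw [← stageVolume_agree hG hgood n, ← stageVolume_agree hG hgood n] at hp
    refine Eq.trans_le ?_ (hp.trans (measure_mono ?_))
    · exact congrArg (fun A => c * stageVolume π q A)
        (Set.ext fun x => ⟨fun h => ⟨h, trivial⟩, fun h => h.1⟩)
    · rintro x ⟨h1, i, hi⟩
      refine ⟨h1, Set.mem_iUnion₂.2 ⟨i + n, Nat.le_add_left n i, ?_⟩⟩
      rw [Set.mem_ofPred_eq, Function.iterate_add_apply]
      have : (Stage.step^[n] ⟨π, q, x⟩) = ⟨z.typ, z.norm, (Stage.step^[n] ⟨π, q, x⟩).width⟩ :=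
        Stage.ext (h1.typ_eq rfl) (h1.norm_eq rfl rfl) rfl
      rw [this]
      exact hi

end BandExchange

namespace BandExchange

open Filter Matrix
open scoped Topology

variable {d : ℕ}

/-! ### Every band is critical infinitely often -/

/-- `e` occurs in the list weakly to the left of an entry that satisfies `P`. -/
def LeftOf {α : Type*} (P : α → Prop) : List α → α → Prop
  | [], _ => False
  | a :: l, e => (e = a ∧ ∃ f ∈ a :: l, P f) ∨ LeftOf P l e

theorem leftOf_append {α : Type*} {P : α → Prop} {l r : List α} {e : α} :
    LeftOf P (l ++ r) e ↔ (e ∈ l ∧ ∃ f ∈ r, P f) ∨ LeftOf P l e ∨ LeftOf P r e := by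
  induction l with
  | nil => simp [LeftOf]
  | cons a l ih =>
    simp only [List.cons_append, LeftOf, ih, List.mem_cons, List.mem_append, or_and_right,
      exists_or]
    generalize (∃ x, x = a ∧ P x) = A
    generalize (∃ x ∈ l, P x) = B
    generalize (∃ x ∈ r, P x) = C
    tauto

theorem LeftOf.mem {α : Type*} {P : α → Prop} {l : List α} {e : α} (h : LeftOf P l e) : e ∈ l := by
  induction l with
  | nil => exact h.elim
  | cons a l ih =>
    rcases h with h | h
    · rw [h.1]; exact List.mem_cons_self
    · exact List.mem_cons_of_mem _ (ih h)

theorem leftOf_concat {α : Type*} {P : α → Prop} {l : List α} {b e : α} (hb : ¬ P b) :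
    LeftOf P (l ++ [b]) e ↔ LeftOf P l e := by
  rw [leftOf_append]; simp [LeftOf, hb]

theorem eq_filter_append_filter {α : Type*} {P : α → Prop} [DecidablePred P] {l : List α}
    (h : ∀ e, LeftOf P l e → P e) :
    l = l.filter (fun e => P e) ++ l.filter (fun e => ¬ P e) := by
  induction l with
  | nil => rfl
  | cons a l ih =>
    by_cases ha : P a
    · rw [List.filter_cons_of_pos (by simpa using ha), List.filter_cons_of_neg (by simpa using ha),
        List.cons_append, ← ih fun e he => h e (.inr he)]
    · have hl : ∀ f ∈ l, ¬ P f := fun f hf hP =>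
        ha (h a (.inl ⟨rfl, f, List.mem_cons_of_mem _ hf, hP⟩))
      rw [List.filter_eq_nil_iff.2, List.filter_eq_self.2, List.nil_append]
      · intro f hf
        rcases List.mem_cons.1 hf with rfl | hf
        · simpa using ha
        · simpa using hl f hf
      · intro f hf
        rcases List.mem_cons.1 hf with rfl | hf
        · simpa using ha
        · simpa using hl f hf

/-- The ends that lie weakly to the left of an end with property `P`. -/
def Pattern.leftEnds (π : Pattern d) (P : BandEnd d → Prop) : Set (BandEnd d) :=
  {e | ∃ s, LeftOf P (π.word s) e}

theorem Side.exists_iff (s : Side) {p : Side → Prop} : (∃ t, p t) ↔ p s ∨ p s.opp := by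
  constructor
  · rintro ⟨t, ht⟩
    rcases Side.eq_or_eq_opp s t with rfl | rfl
    · exact .inl ht
    · exact .inr ht
  · rintro (h | h)
    · exact ⟨_, h⟩
    · exact ⟨_, h⟩

/-- The only end that moves is the rightmost end `b`, which is not in `P`. All other ends keep their
relative order on each side, so none stops having a `P`-end to its right. -/
theorem IsSplit.leftEnds_subset {π π' : Pattern d} {s : Side} {a b : BandEnd d}
    (h : IsSplit π s a b π') {P : BandEnd d → Prop} (hb : ¬ P b) :
    π.leftEnds P ⊆ π'.leftEnds P := by
  intro e he
  simp only [Pattern.leftEnds, Set.mem_ofPred_eq, Side.exists_iff s] at he ⊢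
  cases h with
  | preserving u v₁ v₂ h1 h2 h3 h4 =>
    rw [h1, h2, leftOf_concat hb] at he
    rw [h3, h4]
    refine he.imp_right fun h => ?_
    rw [show v₁ ++ [otherEnd a, b] ++ v₂ = v₁ ++ [otherEnd a] ++ ([b] ++ v₂) by simp]
    rw [leftOf_append] at h ⊢
    rcases h with ⟨h, f, hf, hP⟩ | h | h
    · exact .inl ⟨h, f, by simp [hf], hP⟩
    · exact .inr (.inl h)
    · exact .inr (.inr (leftOf_append.2 (.inr (.inr h))))
  | reversing u₁ u₂ v h1 h2 h3 h4 =>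
    rw [h1, h2, leftOf_concat hb] at he
    rw [h3, h4]
    refine he.imp_left fun h => ?_
    rw [show u₁ ++ [b, otherEnd a] ++ u₂ ++ [a] = u₁ ++ ([b] ++ ([otherEnd a] ++ u₂ ++ [a])) by simp]
    rw [show u₁ ++ [otherEnd a] ++ u₂ ++ [a] = u₁ ++ ([otherEnd a] ++ u₂ ++ [a]) by simp] at h
    rw [leftOf_append] at h ⊢
    rcases h with ⟨h, f, hf, hP⟩ | h | h
    · exact .inl ⟨h, f, List.mem_append_right _ hf, hP⟩
    · exact .inr (.inl h)
    · exact .inr (.inr (leftOf_append.2 (.inr (.inr h))))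

/-- Were `otherEnd a` to the left of a `P`-end, `b` would be inserted to the left of that end as
well. It was rightmost and did not belong to the set before, so the set would grow strictly. -/
theorem IsSplit.otherEnd_notMem_leftEnds {π π' : Pattern d} {s : Side} {a b : BandEnd d}
    (h : IsSplit π s a b π') {P : BandEnd d → Prop} (ha : ¬ P (otherEnd a)) (hb : ¬ P b)
    (ha' : ¬ P a) (hsub : π'.leftEnds P ⊆ π.leftEnds P) : otherEnd a ∉ π.leftEnds P := by
  have hbn : b ∉ π.leftEnds P := by
    rintro ⟨t, ht⟩
    have hbm := h.mem_right
    rcases Side.eq_or_eq_opp s t with rfl | rfl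
    · exact π.notMem_opp ht.mem hbm
    · obtain ⟨v, hv⟩ := List.getLast?_eq_some_iff.1 h.last_right
      rw [hv, leftOf_concat hb] at ht
      have hn := π.nodup_word s.opp
      rw [hv, List.nodup_append] at hn
      exact hn.2.2 _ ht.mem _ (by simp) rfl
  intro hmem
  refine hbn (hsub ?_)
  simp only [Pattern.leftEnds, Set.mem_ofPred_eq, Side.exists_iff s] at hmem ⊢
  cases h with
  | preserving u v₁ v₂ h1 h2 h3 h4 =>
    right
    have h5 : LeftOf P (v₁ ++ [otherEnd a] ++ v₂) (otherEnd a) := by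
      rcases hmem with h | h
      · exact (π.notMem_opp h.mem (by rw [h2]; simp)).elim
      · rwa [h2, leftOf_concat hb] at h
    rw [h4, show v₁ ++ [otherEnd a, b] ++ v₂ = v₁ ++ [otherEnd a] ++ ([b] ++ v₂) by simp]
    have hnd := π.nodup_word s.opp
    rw [h2] at hnd
    rw [leftOf_append, leftOf_concat ha] at h5
    rcases h5 with ⟨_, f, hf, hP⟩ | h | h
    · refine leftOf_append.2 (.inr (.inr (leftOf_append.2 (.inl ⟨by simp, f, hf, hP⟩))))
    · exfalso
      have := h.mem
      simp only [List.nodup_append, List.mem_append, List.mem_singleton] at hnd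
      exact hnd.1.1.2.2 _ this _ rfl rfl
    · exfalso
      have := h.mem
      simp only [List.nodup_append, List.mem_append, List.mem_singleton] at hnd
      exact hnd.1.2.2 _ (.inr rfl) _ this rfl
  | reversing u₁ u₂ v h1 h2 h3 h4 =>
    left
    have h5 : LeftOf P (u₁ ++ [otherEnd a] ++ u₂) (otherEnd a) := by
      rcases hmem with h | h
      · rwa [h1, leftOf_concat ha'] at h
      · exact (π.notMem_opp (s := s) (by rw [h1]; simp) h.mem).elim
    rw [h3, show u₁ ++ [b, otherEnd a] ++ u₂ ++ [a] = u₁ ++ ([b] ++ ([otherEnd a] ++ u₂ ++ [a]))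
      by simp]
    have hnd := π.nodup_word s
    rw [h1] at hnd
    rw [leftOf_append, leftOf_concat ha] at h5
    rcases h5 with ⟨_, f, hf, hP⟩ | h | h
    · exact leftOf_append.2 (.inr (.inr (leftOf_append.2 (.inl ⟨by simp, f, by simp [hf], hP⟩))))
    · exfalso
      have := h.mem
      simp only [List.nodup_append, List.mem_append, List.mem_singleton] at hnd
      exact hnd.1.1.2.2 _ this _ rfl rfl
    · exfalso
      have := h.mem
      simp only [List.nodup_append, List.mem_append, List.mem_singleton] at hnd
      exact hnd.1.2.2 _ (.inr rfl) _ this rfl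

theorem IsSplit.last_left_after {π π' : Pattern d} {s : Side} {a b : BandEnd d}
    (h : IsSplit π s a b π') : (π'.word s).getLast? = some a := by
  cases h with
  | preserving u v₁ v₂ h1 h2 h3 h4 => rw [h3]; exact List.getLast?_concat
  | reversing u₁ u₂ v h1 h2 h3 h4 => rw [h3]; exact List.getLast?_concat

theorem Stage.Good.width_pos {G : Set (NonClassical d)} {z : Stage d} (hz : z.Good G) (α : Fin d) : 0 < z.width α :=
  hz.width_mem.1 α

variable [NeZero d]

theorem NonClassical.Valid.win_next {π : NonClassical d} {s : Side} (h : π.Valid s) :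
    (π.next s).win s = π.win s := by
  have h1 := h.isSplit.last_left_after
  rw [(π.next s).last_eq s] at h1
  simp only [Option.some.injEq] at h1
  simp only [win, h1]

namespace Stage

variable {G : Set (NonClassical d)}

/-- The two critical bands. -/
def IsCritical (z : Stage d) (α : Fin d) : Prop := α = z.winner ∨ α = z.loser

theorem isCritical_win (z : Stage d) (s : Side) : z.IsCritical (z.typ.win s) := by
  rcases Side.eq_or_eq_opp z.side s with h | h
  · exact .inl (by rw [h]; rfl)
  · exact .inr (by rw [h]; rfl)

theorem Good.isCritical_winner_step (hG : IsClosedClass G) {z : Stage d} (hz : z.Good G) :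
    z.step.IsCritical z.winner := by
  have h : z.step.typ.win z.side = z.winner := (hz.valid hG).win_next
  rw [← h]
  exact isCritical_win _ _

theorem width_step_of_ne {z : Stage d} {α : Fin d} (h : α ≠ z.winner) :
    z.step.width α = z.width α := shrink_of_ne h _

theorem width_step_winner (z : Stage d) :
    z.step.width z.winner = z.width z.winner - z.width z.loser := shrink_same _ _ _

theorem Good.width_step_le {z : Stage d} (hz : z.Good G) (α : Fin d) :
    z.step.width α ≤ z.width α := by
  by_cases h : α = z.winner
  · subst h; rw [width_step_winner]; linarith [hz.width_pos z.loser]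
  · rw [width_step_of_ne h]

theorem Good.antitone_width (hG : IsClosedClass G) {z : Stage d} (hz : z.Good G) (α : Fin d) :
    Antitone fun n => (Stage.step^[n] z).width α :=
  antitone_nat_of_succ_le fun n => by
    rw [Function.iterate_succ_apply']
    exact (hz.iterate hG n).width_step_le α

/-- The total width decreases by exactly the loser's width at each split, and it converges. -/
theorem Good.tendsto_width_loser (hG : IsClosedClass G) {z : Stage d} (hz : z.Good G) :
    Tendsto (fun n => (Stage.step^[n] z).width (Stage.step^[n] z).loser) atTop (𝓝 0) := by
  set S : ℕ → ℝ := fun n => ∑ α, (Stage.step^[n] z).width α with hS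
  have hanti : Antitone S := fun n m hnm =>
    Finset.sum_le_sum fun α _ => hz.antitone_width hG α hnm
  have hlim := tendsto_atTop_ciInf hanti ⟨0, by
    rintro _ ⟨n, rfl⟩
    exact Finset.sum_nonneg fun α _ => ((hz.iterate hG n).width_pos α).le⟩
  have hdiff := hlim.sub (hlim.comp (tendsto_add_atTop_nat 1))
  rw [sub_self] at hdiff
  refine hdiff.congr fun n => ?_
  simp only [hS, Function.comp_apply]
  rw [Function.iterate_succ_apply', ← Finset.sum_sub_distrib]
  set y := Stage.step^[n] z
  rw [Finset.sum_eq_single y.winner]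
  · rw [width_step_winner]; ring
  · intro β _ hβ
    rw [width_step_of_ne hβ, sub_self]
  · intro h; exact absurd (Finset.mem_univ _) h

/-- If the width had a positive limit, the band would eventually never lose. Since a winner stays
critical, from its next critical moment it would win forever, so the other widths, and with them the
losers' widths, would stay bounded away from zero. -/
theorem Good.tendsto_width_of_frequently (hG : IsClosedClass G) {z : Stage d} (hz : z.Good G)
    {α : Fin d} (h : ∃ᶠ n in atTop, (Stage.step^[n] z).IsCritical α) :
    Tendsto (fun n => (Stage.step^[n] z).width α) atTop (𝓝 0) := by
  have hpos : ∀ n β, 0 < (Stage.step^[n] z).width β := fun n => (hz.iterate hG n).width_pos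
  have hbdd : BddBelow (Set.range fun n => (Stage.step^[n] z).width α) :=
    ⟨0, by rintro _ ⟨n, rfl⟩; exact (hpos n α).le⟩
  have hlim := tendsto_atTop_ciInf (hz.antitone_width hG α) hbdd
  set l := ⨅ n, (Stage.step^[n] z).width α
  have hl0 : 0 ≤ l := le_ciInf fun n => (hpos n α).le
  rcases hl0.eq_or_lt with h0 | h0
  · rwa [← h0] at hlim
  exfalso
  have hlose := hz.tendsto_width_loser hG
  obtain ⟨N, hN⟩ := eventually_atTop.1 (hlose.eventually_lt_const h0)
  have hne : ∀ n ≥ N, α ≠ (Stage.step^[n] z).loser := fun n hn e => by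
    have h1 := hN n hn
    rw [← e] at h1
    exact absurd (ciInf_le hbdd n) (not_le.2 h1)
  obtain ⟨n₀, hn₀, hc⟩ := frequently_atTop.1 h N
  have hwin : ∀ k, α = (Stage.step^[n₀ + k] z).winner := fun k => by
    induction k with
    | zero => exact hc.resolve_right (hne _ hn₀)
    | succ k ih =>
      have h1 := (hz.iterate hG (n₀ + k)).isCritical_winner_step hG
      rw [← ih, ← Function.iterate_succ_apply' Stage.step] at h1
      exact h1.resolve_right (hne _ (by omega))
  have hconst : ∀ k β, β ≠ α → (Stage.step^[n₀ + k] z).width β = (Stage.step^[n₀] z).width β := by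
    intro k β hβ
    induction k with
    | zero => rfl
    | succ k ih =>
      rw [← ih, ← Nat.add_assoc, Function.iterate_succ_apply', width_step_of_ne]
      rw [← hwin k]; exact hβ
  obtain ⟨β₀, hβ₀⟩ := Finite.exists_min fun β => (Stage.step^[n₀] z).width β
  obtain ⟨M, hM⟩ := eventually_atTop.1 (hlose.eventually_lt_const (hpos n₀ β₀))
  have h1 := hM (n₀ + M) (by omega)
  rw [hconst] at h1
  · exact absurd (hβ₀ _) (not_le.2 h1)
  · exact (hne _ (by omega)).symm

end Stage

end BandExchange

/-! ### Bands that stop being critical would form a separate block -/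

namespace BandExchange

open Filter Matrix
open scoped Topology

variable {d : ℕ} [NeZero d]

theorem NonClassical.exists_mem_of_sgn_ne_zero (π : NonClassical d) (s : Side) :
    ∃ β, (β, false) ∈ π.1.word s ∧ π.1.sgn β ≠ 0 := by
  cases s
  · obtain ⟨β, h⟩ := π.exists_coef.1
    have h' : π.1.sgn β = 1 := by rw [Pattern.coef] at h; exact_mod_cast h
    refine ⟨β, ?_, by rw [h']; exact one_ne_zero⟩
    rcases π.1.mem_or .top (β, false) with h1 | h1
    · exact h1
    rcases π.1.mem_or .top (otherEnd (β, false)) with h2 | h2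
    · have := Pattern.sgn_of_preserving (s := .bot) h1 h2
      simp only [] at this
      rw [h'] at this; exact absurd this one_ne_zero
    · have := Pattern.sgn_of_bot h1 h2
      rw [h'] at this; norm_num at this
  · obtain ⟨β, h⟩ := π.exists_coef.2
    have h' : π.1.sgn β = -1 := by rw [Pattern.coef] at h; exact_mod_cast h
    refine ⟨β, ?_, by rw [h']; norm_num⟩
    rcases π.1.mem_or .bot (β, false) with h1 | h1
    · exact h1
    rcases π.1.mem_or .bot (otherEnd (β, false)) with h2 | h2
    · have := Pattern.sgn_of_preserving (s := .top) h1 h2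
      simp only [] at this
      rw [h'] at this; norm_num at this
    · have := Pattern.sgn_of_top h1 h2
      rw [h'] at this; norm_num at this

namespace Stage

variable {G : Set (NonClassical d)}

/-- The sets `leftEnds` increase inside a finite set and so stabilise. From then on neither end of a
winner lies in them: its critical end is rightmost and not in `P`, and its other end is excluded by
`otherEnd_notMem_leftEnds`. -/
theorem Good.eventually_leftEnds (hG : IsClosedClass G) {z : Stage d} (hz : z.Good G)
    {P : BandEnd d → Prop} (hP : ∀ e, P e → P (otherEnd e))
    (hcrit : ∀ n s, ¬ P ((Stage.step^[n] z).typ.1.crit s)) :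
    ∃ k, ∀ n ≥ k, ∀ e ∈ (Stage.step^[k] z).typ.1.leftEnds P, (Stage.step^[n] z).winner ≠ e.1 := by
  set D : ℕ → Set (BandEnd d) := fun n => (Stage.step^[n] z).typ.1.leftEnds P with hDdef
  have hsplit : ∀ n, IsSplit (Stage.step^[n] z).typ.1 (Stage.step^[n] z).side
      ((Stage.step^[n] z).typ.1.crit (Stage.step^[n] z).side)
      ((Stage.step^[n] z).typ.1.crit (Stage.step^[n] z).side.opp)
      (Stage.step^[n + 1] z).typ.1 := fun n => by
    rw [Function.iterate_succ_apply']
    exact ((hz.iterate hG n).valid hG).isSplit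
  have hmono : Monotone D := monotone_nat_of_le_succ fun n =>
    (hsplit n).leftEnds_subset (hcrit n _)
  obtain ⟨k, hk⟩ := WellFoundedGT.monotone_chain_condition ⟨D, hmono⟩
  change ∀ m, k ≤ m → D k = D m at hk
  refine ⟨k, fun n hn e he hwin => ?_⟩
  have hother : otherEnd ((Stage.step^[n] z).typ.1.crit (Stage.step^[n] z).side) ∉ D n :=
    (hsplit n).otherEnd_notMem_leftEnds
      (fun h => hcrit n _ (by have := hP _ h; rwa [otherEnd_otherEnd] at this))
      (hcrit n _) (hcrit n _) (by
        change D (n + 1) ⊆ D n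
        rw [← hk n hn, ← hk (n + 1) (by omega)])
  have hself : (Stage.step^[n] z).typ.1.crit (Stage.step^[n] z).side ∉ D n := by
    set s := (Stage.step^[n] z).side
    rintro ⟨t, ht⟩
    have hlast := (Stage.step^[n] z).typ.last_eq s
    rcases Side.eq_or_eq_opp s t with hst | hst <;> rw [hst] at ht
    · obtain ⟨v, hv⟩ := List.getLast?_eq_some_iff.1 hlast
      rw [hv, leftOf_concat (hcrit n _)] at ht
      have hn := (Stage.step^[n] z).typ.1.nodup_word s
      rw [hv, List.nodup_append] at hn
      exact hn.2.2 _ ht.mem _ (by simp) rfl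
    · exact Pattern.notMem_opp _ (List.mem_of_getLast? hlast) ht.mem
  change e ∈ D k at he
  rw [hk n hn] at he
  rcases eq_or_eq_otherEnd (a := e) (b := (Stage.step^[n] z).typ.1.crit (Stage.step^[n] z).side)
    hwin.symm with h | h
  · rw [h] at he; exact hself he
  · rw [h] at he; exact hother he

/-- Bands that are no longer critical and the others occupy separate parts of the words; the
switch condition then holds for the two parts separately. -/
theorem Good.frequently_isCritical (hG : IsClosedClass G) {z : Stage d} (hz : z.Good G)
    (α : Fin d) : ∃ᶠ n in atTop, (Stage.step^[n] z).IsCritical α := by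
  classical
  by_contra hα
  set K : Fin d → Prop := fun β => ¬ ∃ᶠ n in atTop, (Stage.step^[n] z).IsCritical β with hK
  have hev : ∀ᶠ n in atTop, ∀ β, K β → ¬ (Stage.step^[n] z).IsCritical β := by
    refine eventually_all.2 fun β => ?_
    by_cases h : K β
    · exact (not_frequently.1 h).mono fun n hn _ => hn
    · exact Eventually.of_forall fun n hn => absurd hn h
  obtain ⟨N, hN⟩ := eventually_atTop.1 hev
  have hzero : ∀ β, ¬ K β → Tendsto (fun n => (Stage.step^[n] z).width β) atTop (𝓝 0) :=
    fun β hβ => hz.tendsto_width_of_frequently hG (not_not.1 hβ)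
  obtain ⟨k, hk⟩ := (hz.iterate hG N).eventually_leftEnds hG (P := fun e => K e.1)
    (fun e h => h) fun n s hP => by
      rw [← Function.iterate_add_apply] at hP
      exact hN (n + N) (by omega) _ hP (isCritical_win _ s)
  rw [← Function.iterate_add_apply] at hk
  set y := Stage.step^[k + N] z with hy
  have hyg : y.Good G := hz.iterate hG _
  have hiter : ∀ m, Stage.step^[m] y = Stage.step^[m + (k + N)] z := fun m => by
    rw [hy, ← Function.iterate_add_apply]
  have hyw : ∀ β, ¬ K β → Tendsto (fun m => (Stage.step^[m] y).width β) atTop (𝓝 0) := fun β hβ => by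
    simp only [hiter]
    exact (hzero β hβ).comp (tendsto_add_atTop_nat (k + N))
  have hycrit : ∀ m β, K β → ¬ (Stage.step^[m] y).IsCritical β := fun m β hβ => by
    rw [hiter]; exact hN _ (by omega) β hβ
  -- A band with an end to the left of a `K`-end never wins again, so its width is constant. Outside
  -- `K` all widths tend to zero.
  have hleft : ∀ s, ∀ e, LeftOf (fun e : BandEnd d => K e.1) (y.typ.1.word s) e → K e.1 := by
    intro s e he
    by_contra hKe
    have hconst : ∀ m, (Stage.step^[m] y).width e.1 = y.width e.1 := fun m => by
      induction m with
      | zero => rfl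
      | succ m ih =>
        rw [← ih, Function.iterate_succ_apply', width_step_of_ne]
        have := hk (m + k) (by omega) e ⟨s, he⟩
        rw [← Function.iterate_add_apply, Nat.add_assoc] at this
        rw [hiter]
        exact this.symm
    have h1 := hyw e.1 (not_not.2 hKe)
    simp only [hconst] at h1
    exact (hyg.width_pos e.1).ne (tendsto_nhds_unique h1 tendsto_const_nhds)
  have hword : ∀ s, y.typ.1.word s = (y.typ.1.word s).filter (fun e => K e.1) ++
      (y.typ.1.word s).filter (fun e => ¬ K e.1) := fun s => eq_filter_append_filter (hleft s)
  have hKcoef : ∀ m β, K β → (Stage.step^[m] y).typ.1.coef β = y.typ.1.coef β ∧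
      (Stage.step^[m] y).width β = y.width β := by
    intro m β hβ
    induction m with
    | zero => exact ⟨rfl, rfl⟩
    | succ m ih =>
      rw [Function.iterate_succ_apply', (hyg.iterate hG m).coef_step hG,
        grow_of_ne fun h => hycrit m β hβ (.inr h), width_step_of_ne fun h => hycrit m β hβ (.inl h)]
      exact ih
  -- The contribution of `K` to the switch condition is constant in time, whereas that of the other
  -- bands tends to zero.
  have hsum : ∑ β with K β, y.typ.1.coef β * y.width β = 0 := by
    have h1 : ∀ m, ∑ β with K β, y.typ.1.coef β * y.width β =
        - ∑ β with ¬ K β, (Stage.step^[m] y).typ.1.coef β * (Stage.step^[m] y).width β := fun m => by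
      have h2 := (hyg.iterate hG m).width_mem.2.1
      rw [dotProduct, ← Finset.sum_filter_add_sum_filter_not _ K] at h2
      rw [← eq_neg_of_add_eq_zero_left h2]
      refine Finset.sum_congr rfl fun β hβ => ?_
      have := hKcoef m β (Finset.mem_filter.1 hβ).2
      rw [this.1, this.2]
    have h3 : Tendsto (fun m => - ∑ β with ¬ K β,
        (Stage.step^[m] y).typ.1.coef β * (Stage.step^[m] y).width β) atTop (𝓝 0) := by
      rw [← neg_zero, ← Finset.sum_const_zero (ι := Fin d) (s := Finset.univ.filter fun β => ¬ K β)]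
      refine (tendsto_finsetSum _ fun β hβ => ?_).neg
      refine squeeze_zero_norm (fun m => ?_) (hyw β (Finset.mem_filter.1 hβ).2)
      have hp := ((hyg.iterate hG m).width_pos β).le
      rw [norm_mul, Real.norm_of_nonneg hp]
      refine mul_le_of_le_one_left hp ?_
      rcases (Stage.step^[m] y).typ.1.coef_mem β with h | h | h <;> simp [h]
    simp only [← h1] at h3
    exact tendsto_nhds_unique tendsto_const_nhds h3
  -- By genericity the relation on `K` is a multiple `r` of the switch condition: for `r = 0` the
  -- coefficients vanish on `K`, otherwise they vanish off `K`. The first case gives a classical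
  -- prefix, the second a classical suffix.
  obtain ⟨r, hr⟩ := hyg.width_mem.2.2 (fun β => if K β then y.typ.1.sgn β else 0) (by
    rw [← hsum, dotProduct, Finset.sum_filter]
    refine Finset.sum_congr rfl fun β _ => ?_
    split_ifs <;> simp [Pattern.coef])
  obtain ⟨e₀, he₀⟩ : ∃ e : BandEnd d, K e.1 := ⟨(α, false), hα⟩
  by_cases hr0 : r = 0
  · have hsgn : ∀ β, K β → y.typ.1.sgn β = 0 := fun β hβ => by
      have := hr β
      rw [if_pos hβ, hr0, zero_mul] at this
      exact_mod_cast this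
    refine y.typ.2.2.no_classical_prefix (X := fun s => (y.typ.1.word s).filter (fun e => K e.1))
      (Y := fun s => (y.typ.1.word s).filter (fun e => ¬ K e.1)) hword (fun s x hx => ?_) ?_
      (.inr fun s => ?_)
    · rw [List.mem_filter, decide_eq_true_eq] at hx ⊢
      exact ⟨Pattern.preserving_of_sgn (hsgn _ hx.2) hx.1, hx.2⟩
    · have : ∃ e : BandEnd d, e ∈ y.typ.1.word .top ∧ K e.1 := by
        rcases y.typ.1.mem_or .top e₀ with h | h
        · exact ⟨e₀, h, he₀⟩
        · exact ⟨otherEnd e₀, Pattern.preserving_of_sgn (s := .bot) (hsgn _ he₀) h, he₀⟩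
      obtain ⟨e, h1, h2⟩ := this
      exact List.ne_nil_of_mem (a := e) (List.mem_filter.2 ⟨h1, by simpa using h2⟩)
    · refine List.ne_nil_of_mem (a := y.typ.1.crit s) (List.mem_filter.2
        ⟨List.mem_of_getLast? (y.typ.last_eq s), ?_⟩)
      simp only [decide_eq_true_eq]
      exact fun h => hycrit 0 _ h (isCritical_win y s)
  · have hcoef : ∀ β, ¬ K β → y.typ.1.sgn β = 0 := fun β hβ => by
      have := hr β
      rw [if_neg hβ, Int.cast_zero, eq_comm, mul_eq_zero, or_iff_right hr0] at this
      simpa [Pattern.coef] using this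
    have hside : ∀ s, ∃ e ∈ y.typ.1.word s, K e.1 := by
      intro s
      obtain ⟨β, h1, h2⟩ := y.typ.exists_mem_of_sgn_ne_zero s
      exact ⟨_, h1, by_contra fun h => h2 (hcoef β h)⟩
    refine y.typ.2.2.no_classical_suffix (X := fun s => (y.typ.1.word s).filter (fun e => ¬ K e.1))
      (Y := fun s => (y.typ.1.word s).filter (fun e => K e.1)) hword (fun s x hx => ?_) ?_
      (.inr fun s => ?_)
    · rw [List.mem_filter, decide_eq_true_eq] at hx ⊢
      exact ⟨Pattern.preserving_of_sgn (hcoef _ hx.2) hx.1, hx.2⟩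
    · refine List.ne_nil_of_mem (a := y.typ.1.crit .top) (List.mem_filter.2
        ⟨List.mem_of_getLast? (y.typ.last_eq .top), ?_⟩)
      simp only [decide_eq_true_eq]
      exact fun h => hycrit 0 _ h (isCritical_win y .top)
    · obtain ⟨e, h1, h2⟩ := hside s
      exact List.ne_nil_of_mem (a := e) (List.mem_filter.2 ⟨h1, by simpa using h2⟩)

theorem Good.tendsto_width (hG : IsClosedClass G) {z : Stage d} (hz : z.Good G) (α : Fin d) :
    Tendsto (fun n => (Stage.step^[n] z).width α) atTop (𝓝 0) :=
  hz.tendsto_width_of_frequently hG (hz.frequently_isCritical hG α)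

end Stage

end BandExchange

namespace BandExchange

open Filter Matrix
open scoped Topology

variable {d : ℕ}

/-! ### Relabelling -/

/-- Rename the ends of the bands. -/
def Pattern.map (π : Pattern d) (φ : Equiv.Perm (BandEnd d)) : Pattern d where
  word s := (π.word s).map φ
  nodup := by
    rw [← List.map_append]
    exact π.nodup.map φ.injective
  mem a := by
    rw [← List.map_append, List.mem_map]
    exact ⟨φ.symm a, π.mem _, φ.apply_symm_apply a⟩

theorem IsSplit.map {π π' : Pattern d} {s : Side} {a b : BandEnd d} (h : IsSplit π s a b π')
    {φ : Equiv.Perm (BandEnd d)} (hφ : ∀ a, φ (otherEnd a) = otherEnd (φ a)) :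
    IsSplit (π.map φ) s (φ a) (φ b) (π'.map φ) := by
  cases h with
  | preserving u v₁ v₂ h1 h2 h3 h4 =>
    exact .preserving (u.map φ) (v₁.map φ) (v₂.map φ) (by simp [Pattern.map, h1])
      (by simp [Pattern.map, h2, hφ]) (by simp [Pattern.map, h3]) (by simp [Pattern.map, h4, hφ])
  | reversing u₁ u₂ v h1 h2 h3 h4 =>
    exact .reversing (u₁.map φ) (u₂.map φ) (v.map φ) (by simp [Pattern.map, h1, hφ])
      (by simp [Pattern.map, h2]) (by simp [Pattern.map, h3, hφ]) (by simp [Pattern.map, h4])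

theorem Pattern.IsRecurrent.map {π : Pattern d} (h : π.IsRecurrent)
    {φ : Equiv.Perm (BandEnd d)} (hφ : ∀ a, φ (otherEnd a) = otherEnd (φ a)) :
    (π.map φ).IsRecurrent := by
  obtain ⟨w, hw, hs⟩ := h
  have hφ' : ∀ a, φ.symm (otherEnd a) = otherEnd (φ.symm a) := fun a => by
    rw [Equiv.symm_apply_eq, hφ, Equiv.apply_symm_apply]
  have hband : ∀ a : BandEnd d, (φ.symm (a.1, false)).1 = (φ.symm a).1 := by
    rintro ⟨α, _ | _⟩
    · rfl
    · have := congrArg Prod.fst (hφ' (α, false))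
      exact this.symm
  refine ⟨fun α => w (φ.symm (α, false)).1, fun α => hw _, ?_⟩
  have htot : ∀ s, (π.map φ).total (fun α => w (φ.symm (α, false)).1) s = π.total w s := fun s => by
    simp only [Pattern.total, Pattern.map, List.map_map]
    congr 1
    refine List.map_congr_left fun a _ => ?_
    simp only [Function.comp_apply, hband, Equiv.symm_apply_apply]
  rw [Pattern.SwitchCondition, htot, htot]
  exact hs

variable [NeZero d]

/-- Splits commute with relabelling, so arrows of the reduced diagram can be followed from any
labelled representative. -/
theorem NonClassical.Valid.of_reduced_eq {π π₁ π₁' : NonClassical d} {s : Side} {a b : BandEnd d}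
    (h : π.reduced = π₁.reduced) (hs : IsSplit π₁.1 s a b π₁'.1) :
    π.Valid s ∧ (π.next s).reduced = π₁'.reduced := by
  obtain ⟨φ, hφ, hword⟩ : SameType π₁ π := Quotient.exact h.symm
  have hπ : π.1 = π₁.1.map φ := Pattern.ext_word hword
  have hm := hs.map hφ
  rw [← hπ] at hm
  have hrec : (π₁'.1.map φ).IsRecurrent := π₁'.2.1.map hφ
  obtain ⟨hv, _, _, hn⟩ := Valid.of_isSplit (π' := ⟨π₁'.1.map φ, hrec,
    hm.isComplete π.2.2 (Pattern.word_ne_nil_of_recurrent hrec _)⟩) hm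
  refine ⟨hv, ?_⟩
  rw [← hn]
  exact (Quotient.sound ⟨φ, hφ, fun s => rfl⟩ : π₁'.reduced = _).symm

/-- The types in a sink of the reduced Rauzy diagram. -/
theorem IsSink.isClosedClass {G₀ : Set (ReducedType d)} (h : IsSink G₀) :
    IsClosedClass {π : NonClassical d | π.reduced ∈ G₀} where
  exists_valid π hπ := by
    obtain ⟨v, ⟨π₁, π₁', s, a, b, h1, -, h2⟩, -⟩ :=
      Relation.TransGen.head'_iff.1 (h.1 _ hπ _ hπ)
    exact ⟨s, (NonClassical.Valid.of_reduced_eq h1.symm h2).1⟩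
  next_mem π hπ s hs := h.2 _ hπ _ ⟨π, π.next s, s, _, _, rfl, rfl, hs.isSplit⟩

/-- The body has positive volume, and almost all of it is generic. -/
theorem NonClassical.generic_nonempty (π : NonClassical d) : π.generic.Nonempty := by
  have h1 : stageVolume π 1 Set.univ ≠ 0 := by
    rw [stageVolume_univ]
    refine ne_of_gt (lt_of_lt_of_le ?_ (le_hyperVolume_body π.isSign fun _ => one_pos))
    rw [ENNReal.ofReal_pos]
    have hd : (0 : ℝ) < d := by exact_mod_cast Nat.pos_of_ne_zero (NeZero.ne d)
    have := minRev_pos π.isSign (q := 1) fun _ => one_pos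
    have := Finset.prod_pos fun α (_ : α ∈ Finset.univ) =>
      hat_pos π.isSign (q := 1) (fun _ => one_pos) α
    positivity
  by_contra hcon
  rw [Set.not_nonempty_iff_eq_empty] at hcon
  refine h1 ?_
  rw [stageVolume_apply, hcon]
  simp

namespace Stage

variable {G : Set (NonClassical d)}

theorem step_grow {π : NonClassical d} {s : Side} (h : π.Valid s) {y : Fin d → ℝ}
    (hy : y ∈ (π.next s).generic) (q : Fin d → ℝ) :
    (⟨π, q, grow (π.win s) (π.win s.opp) y⟩ : Stage d).side = s ∧
    step ⟨π, q, grow (π.win s) (π.win s.opp) y⟩ =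
      ⟨π.next s, grow (π.win s.opp) (π.win s) q, y⟩ := by
  have h1 := (h.grow_mem hy).2
  refine ⟨h1, ?_⟩
  simp only [step, side, winner, loser, h1]
  rw [shrink_grow (π.win_ne s)]

/-- Any generic vector of widths can be prescribed after `n` given splits. -/
theorem Good.exists_splice (hG : IsClosedClass G) {z : Stage d} (hz : z.Good G) (n : ℕ)
    {y : Fin d → ℝ} (hy : y ∈ (Stage.step^[n] z).typ.generic) :
    ∃ x ∈ z.typ.generic, Agree n ⟨z.typ, z.norm, x⟩ z ∧
      Stage.step^[n] ⟨z.typ, z.norm, x⟩ = ⟨(Stage.step^[n] z).typ, (Stage.step^[n] z).norm, y⟩ := by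
  induction n generalizing z with
  | zero => exact ⟨y, hy, fun i hi => absurd hi (Nat.not_lt_zero i), rfl⟩
  | succ n ih =>
    rw [Function.iterate_succ_apply] at hy
    obtain ⟨x, hx, h1, h2⟩ := ih (hz.step hG) hy
    have hv := hz.valid hG
    obtain ⟨h3, h4⟩ := step_grow hv hx z.norm
    refine ⟨_, (hv.grow_mem hx).1, agree_succ.2 ⟨h3, ?_⟩, ?_⟩
    · rw [h4]; exact h1
    · rw [Function.iterate_succ_apply, Function.iterate_succ_apply, h4]; exact h2

/-- A path of splits of unlabelled types can be followed from every labelling of its start. -/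
theorem exists_follow (L : ℕ) (stage : ℕ → NonClassical d) (side' : ℕ → Side)
    (hsplit : ∀ i < L, ∃ a b, IsSplit (stage i).1 (side' i) a b (stage (i + 1)).1)
    {π : NonClassical d} (hπ : π.reduced = (stage 0).reduced) :
    ∃ x ∈ π.generic, ∀ q, (∀ i ≤ L, (step^[i] ⟨π, q, x⟩).typ.reduced = (stage i).reduced) ∧
      ∀ i < L, (step^[i] ⟨π, q, x⟩).side = side' i := by
  induction L generalizing stage side' π with
  | zero =>
    obtain ⟨x, hx⟩ := π.generic_nonempty
    refine ⟨x, hx, fun q => ⟨fun i hi => ?_, fun i hi => absurd hi (Nat.not_lt_zero i)⟩⟩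
    obtain rfl : i = 0 := by omega
    exact hπ
  | succ L ih =>
    obtain ⟨a, b, h0⟩ := hsplit 0 L.succ_pos
    obtain ⟨hv, hn⟩ := NonClassical.Valid.of_reduced_eq hπ h0
    obtain ⟨x, hx, h⟩ := ih (fun i => stage (i + 1)) (fun i => side' (i + 1))
      (fun i hi => hsplit (i + 1) (by omega)) hn
    refine ⟨_, (hv.grow_mem hx).1, fun q => ?_⟩
    obtain ⟨h3, h4⟩ := step_grow hv hx q
    refine ⟨fun i hi => ?_, fun i hi => ?_⟩ <;> cases i with
    | zero => first | exact hπ | exact h3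
    | succ i =>
      rw [Function.iterate_succ_apply, h4]
      first | exact (h _).1 i (by omega) | exact (h _).2 i (by omega)

theorem exists_reach {v : ReducedType d} {π : NonClassical d}
    (h : Relation.TransGen Arrow π.reduced v) :
    ∃ x ∈ π.generic, ∃ n, ∀ q, (step^[n] ⟨π, q, x⟩).typ.reduced = v := by
  generalize hu : π.reduced = u at h
  induction h using Relation.TransGen.head_induction_on generalizing π with
  | single h =>
    obtain ⟨π₁, π₁', s, a, b, h1, h2, h3⟩ := h
    obtain ⟨hv, hn⟩ := NonClassical.Valid.of_reduced_eq (hu.trans h1.symm) h3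
    obtain ⟨x, hx⟩ := (π.next s).generic_nonempty
    refine ⟨_, (hv.grow_mem hx).1, 1, fun q => ?_⟩
    rw [Function.iterate_one, (step_grow hv hx q).2]
    exact hn.trans h2
  | head h _ ih =>
    obtain ⟨π₁, π₁', s, a, b, h1, h2, h3⟩ := h
    obtain ⟨hv, hn⟩ := NonClassical.Valid.of_reduced_eq (hu.trans h1.symm) h3
    obtain ⟨x, hx, n, h⟩ := ih (hn.trans h2)
    refine ⟨_, (hv.grow_mem hx).1, n + 1, fun q => ?_⟩
    rw [Function.iterate_succ_apply, (step_grow hv hx q).2]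
    exact h _

/-! ### Positivity of the matrices -/

/-- Let `U` be the final support. A winner in `U` puts its loser into `U`. If some band is outside
`U`, then once it is critical the winner lies outside `U`; that winner stays critical, so all later
winners do too. Then the width of a band in `U` is constant, although all widths tend to zero. -/
theorem Good.exists_pos (hG : IsClosedClass G) {z : Stage d} (hz : z.Good G) {v : ℕ → Fin d → ℝ}
    (h0 : ∀ α, 0 ≤ v 0 α) (h1 : ∃ α, 0 < v 0 α)
    (hv : ∀ n, v (n + 1) = grow (Stage.step^[n] z).loser (Stage.step^[n] z).winner (v n)) :
    ∃ k, ∀ n ≥ k, ∀ α, 0 < v n α := by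
  have hnn : ∀ n α, 0 ≤ v n α := fun n => by
    induction n with
    | zero => exact h0
    | succ n ih =>
      intro α
      rw [hv]
      by_cases e : α = (Stage.step^[n] z).loser
      · rw [e, grow_same]; exact add_nonneg (ih _) (ih _)
      · rw [grow_of_ne e]; exact ih α
  have hmono : Monotone fun n => {α | 0 < v n α} := monotone_nat_of_le_succ fun n α hα => by
    simp only [Set.mem_ofPred_eq] at hα ⊢
    rw [hv]
    by_cases e : α = (Stage.step^[n] z).loser
    · rw [e, grow_same]; rw [e] at hα; exact add_pos_of_pos_of_nonneg hα (hnn _ _)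
    · rw [grow_of_ne e]; exact hα
  obtain ⟨k, hk⟩ := WellFoundedGT.monotone_chain_condition ⟨_, hmono⟩
  change ∀ m, k ≤ m → {α | 0 < v k α} = {α | 0 < v m α} at hk
  set U := {α | 0 < v k α} with hU
  obtain ⟨γ, hγ⟩ := h1
  have hγU : γ ∈ U := hmono (Nat.zero_le k) hγ
  suffices hall : ∀ β, β ∈ U by
    refine ⟨k, fun n hn α => ?_⟩
    have := hall α
    rw [hk n hn] at this
    exact this
  by_contra! hβ
  obtain ⟨β, hβ⟩ := hβ
  have hwl : ∀ n ≥ k, (Stage.step^[n] z).winner ∈ U → (Stage.step^[n] z).loser ∈ U := by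
    intro n hn hw
    rw [hk n hn] at hw
    rw [hk (n + 1) (by omega), Set.mem_ofPred_eq, hv, grow_same]
    exact add_pos_of_nonneg_of_pos (hnn _ _) hw
  obtain ⟨n₀, hn₀, hc⟩ := frequently_atTop.1 (hz.frequently_isCritical hG β) k
  have hw : ∀ m, (∃ c ∉ U, (Stage.step^[n₀ + m] z).IsCritical c) →
      (Stage.step^[n₀ + m] z).winner ∉ U := by
    rintro m ⟨c, hc, h | h⟩ hwin
    · exact hc (h ▸ hwin)
    · exact hc (h ▸ hwl _ (by omega) hwin)
  have hinv : ∀ m, ∃ c ∉ U, (Stage.step^[n₀ + m] z).IsCritical c := fun m => by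
    induction m with
    | zero => exact ⟨β, hβ, hc⟩
    | succ m ih =>
      refine ⟨_, hw m ih, ?_⟩
      rw [← Nat.add_assoc, Function.iterate_succ_apply']
      exact (hz.iterate hG _).isCritical_winner_step hG
  have hconst : ∀ m, (Stage.step^[n₀ + m] z).width γ = (Stage.step^[n₀] z).width γ := fun m => by
    induction m with
    | zero => rfl
    | succ m ih =>
      rw [← ih, ← Nat.add_assoc, Function.iterate_succ_apply', width_step_of_ne]
      rintro rfl
      exact hw m (hinv m) hγU
  have hlim := (hz.tendsto_width hG γ).comp (tendsto_add_atTop_nat n₀)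
  have h2 : (fun n => (Stage.step^[n] z).width γ) ∘ (fun a => a + n₀) =
      fun _ => (Stage.step^[n₀] z).width γ := by
    ext m
    rw [Function.comp_apply, Nat.add_comm]; exact hconst m
  rw [h2] at hlim
  exact ((hz.iterate hG n₀).width_pos γ).ne (tendsto_nhds_unique hlim tendsto_const_nhds)

end Stage

end BandExchange

namespace BandExchange

open Filter Matrix MeasureTheory
open scoped Topology ENNReal

variable {d : ℕ}

/-! ### The weights `hat` under a split -/

section Hat

variable {c q : Fin d → ℝ} {a b : Fin d}

/-- An optimal ray for the new weight of `γ` pulls back to a nonnegative vector of the old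
hyperplane with the same cost. Its entry at `γ` is at least one, and so is its entry at the winner
`a` when `γ` is the loser `b`. -/
theorem exists_ray_grow (hc : IsSign c) (hc' : IsSign (grow b a c)) (hq : ∀ α, 0 < q α)
    (γ : Fin d) : hat c q γ ≤ hat (grow b a c) (grow b a q) γ ∧
      (γ = b → hat c q a ≤ hat (grow b a c) (grow b a q) γ) := by
  obtain ⟨v, hv, h1, h2, h3, -⟩ := exists_ray hc' (grow b a q) γ
  have hv0 : ∀ β, 0 ≤ v β := fun β => by rcases hv β with h | h <;> simp [h]
  rw [grow_dotProduct] at h1 h3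
  have hg : ∀ β, v β ≤ grow a b v β := fun β => by
    by_cases e : β = a
    · subst e; rw [grow_same]; linarith [hv0 b]
    · rw [grow_of_ne e]
  have hg0 : ∀ β, 0 ≤ grow a b v β := fun β => (hv0 β).trans (hg β)
  have key : ∀ β, 1 ≤ grow a b v β → hat c q β ≤ hat (grow b a c) (grow b a q) γ := fun β hβ => by
    rw [← h3]
    refine le_trans ?_ (hat_mul_le hc hq hg0 h1 β)
    exact le_mul_of_one_le_right (hat_pos hc hq β).le hβ
  refine ⟨key γ (h2 ▸ hg γ), ?_⟩
  rintro rfl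
  refine key a ?_
  rw [grow_same, h2]; linarith [hv0 a]

theorem hat_le_hat_grow (hc : IsSign c) (hc' : IsSign (grow b a c)) (hq : ∀ α, 0 < q α)
    (γ : Fin d) : hat c q γ ≤ hat (grow b a c) (grow b a q) γ :=
  (exists_ray_grow hc hc' hq γ).1

theorem hat_winner_le (hc : IsSign c) (hc' : IsSign (grow b a c)) (hq : ∀ α, 0 < q α) :
    hat c q a ≤ hat (grow b a c) (grow b a q) b :=
  (exists_ray_grow hc hc' hq b).2 rfl

/-- The bands on which the minimum `minRev` is attained. -/
theorem exists_hat_eq_minRev (hc : IsSign c) (q : Fin d → ℝ) :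
    ∃ t u, c t = 1 ∧ c u = -1 ∧ q t = minOn c q 1 ∧ q u = minOn c q (-1) ∧
      hat c q t = minRev c q ∧ hat c q u = minRev c q := by
  obtain ⟨t, ht, htq⟩ := exists_minOn q hc.pos
  obtain ⟨u, hu, huq⟩ := exists_minOn q hc.neg
  refine ⟨t, u, ht, hu, htq, huq, ?_, ?_⟩
  · rw [hat_of_one ht, htq, minRev]
  · rw [hat_of_neg_one hu, huq, minRev, add_comm]

/-- The new minimum is attained at two bands of opposite sign. One of them is not the loser, so its
coefficient was already nonzero and its old weight at least the old minimum. -/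
theorem minRev_le_grow (hc : IsSign c) (hc' : IsSign (grow b a c)) (hq : ∀ α, 0 < q α) :
    minRev c q ≤ minRev (grow b a c) (grow b a q) := by
  obtain ⟨t, u, ht, hu, -, -, h1, h2⟩ := exists_hat_eq_minRev hc' (grow b a q)
  have key : ∀ γ, γ ≠ b → grow b a c γ ≠ 0 → hat (grow b a c) (grow b a q) γ =
      minRev (grow b a c) (grow b a q) → minRev c q ≤ minRev (grow b a c) (grow b a q) := by
    intro γ hγ h0 h
    rw [grow_of_ne hγ] at h0
    rw [← h]
    exact (minRev_le_hat hc h0).trans (hat_le_hat_grow hc hc' hq γ)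
  by_cases e : t = b
  · refine key u ?_ (by rw [hu]; norm_num) h2
    rintro rfl
    rw [e, hu] at ht; norm_num at ht
  · exact key t e (by rw [ht]; norm_num) h1

theorem hat_le_two_mul {M : ℝ} (hc : IsSign c) (hM : 0 ≤ M) (h : ∀ α, q α ≤ M) (γ : Fin d) :
    hat c q γ ≤ 2 * M := by
  obtain ⟨t, u, -, -, ht, hu, -⟩ := exists_hat_eq_minRev hc q
  rcases hc.mem γ with h0 | h0 | h0
  · rw [hat_of_zero h0]; linarith [h γ]
  · rw [hat_of_one h0, ← hu]; linarith [h γ, h u]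
  · rw [hat_of_neg_one h0, ← ht]; linarith [h γ, h t]

/-- One factor 2 bounds the new norms, the other the weights by the largest norm. -/
theorem hat_grow_le {M : ℝ} (hc : IsSign c) (hc' : IsSign (grow b a c)) (hq : ∀ α, 0 < q α)
    (h : ∀ α, hat c q α ≤ M) (γ : Fin d) : hat (grow b a c) (grow b a q) γ ≤ 4 * M := by
  have hqM : ∀ α, q α ≤ M := fun α => (le_hat hc hq α).trans (h α)
  have hM : 0 < M := (hq a).trans_le (hqM a)
  have := hat_le_two_mul (q := grow b a q) (M := 2 * M) hc' (by linarith) (fun α => by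
    by_cases e : α = b
    · subst e; rw [grow_same]; linarith [hqM α, hqM a]
    · rw [grow_of_ne e]; linarith [hqM α]) γ
  linarith

/-- The norm of a band other than the loser is unchanged, so its weight can grow only if its
cheapest partner was the loser. Its weight was then at least `minRev`, the weight of the loser,
hence already comparable with `M`. -/
theorem hat_grow_le_mul {M C : ℝ} (hc : IsSign c) (hc' : IsSign (grow b a c)) (hq : ∀ α, 0 < q α)
    (hC : 1 ≤ C) (h : ∀ α, hat c q α ≤ M) (hb : M ≤ C * hat c q b) (γ : Fin d) :
    hat (grow b a c) (grow b a q) γ ≤ 4 * C * hat c q γ := by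
  have hle := hat_grow_le hc hc' hq h γ
  have hpos := hat_pos hc hq γ
  have hself : hat c q γ ≤ 4 * C * hat c q γ := le_mul_of_one_le_left hpos.le (by linarith)
  have hbig : hat c q b ≤ hat c q γ → hat (grow b a c) (grow b a q) γ ≤ 4 * C * hat c q γ :=
    fun hbγ => by
      have : C * hat c q b ≤ C * hat c q γ := mul_le_mul_of_nonneg_left hbγ (by linarith)
      linarith
  by_cases e : γ = b
  · exact hbig (by rw [e])
  obtain ⟨t, u, ht, hu, htq, huq, h1, h2⟩ := exists_hat_eq_minRev hc q
  have hcγ : grow b a c γ = c γ := grow_of_ne e c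
  have hqγ : grow b a q γ = q γ := grow_of_ne e q
  rcases hc.mem γ with h0 | h0 | h0
  · rw [hat_of_zero (by rw [hcγ, h0]), hqγ]
    rw [hat_of_zero h0] at hself ⊢; exact hself
  · by_cases eu : u = b
    · refine hbig ?_
      rw [← eu, h2]; exact minRev_le_hat hc (by rw [h0]; norm_num)
    · refine le_trans ?_ hself
      rw [hat_of_one (by rw [hcγ, h0]), hqγ, hat_of_one h0, ← huq, ← grow_of_ne eu q]
      linarith [minOn_le (c := grow b a c) (grow b a q) (v := -1) (t := u)
        (by rw [grow_of_ne eu, hu])]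
  · by_cases et : t = b
    · refine hbig ?_
      rw [← et, h1]; exact minRev_le_hat hc (by rw [h0]; norm_num)
    · refine le_trans ?_ hself
      rw [hat_of_neg_one (by rw [hcγ, h0]), hqγ, hat_of_neg_one h0, ← htq, ← grow_of_ne et q]
      linarith [minOn_le (c := grow b a c) (grow b a q) (v := 1) (t := t)
        (by rw [grow_of_ne et, ht])]

end Hat

/-- Up to constants, the volume of the widths `x` with `q ⬝ᵥ x ≤ 1`. -/
noncomputable def bodySize (c q : Fin d → ℝ) : ℝ := minRev c q / ∏ α, hat c q α

theorem div_le_mul_div {m m' p p' K : ℝ} (hm : 0 ≤ m) (hp : 0 < p) (hp' : 0 < p') (hK : 0 ≤ K)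
    (h : m ≤ m') (h' : p' ≤ K * p) : m / p ≤ K * (m' / p') := by
  rw [← mul_div_assoc, div_le_div_iff₀ hp hp']
  calc m * p' ≤ m * (K * p) := mul_le_mul_of_nonneg_left h' hm
    _ ≤ m' * (K * p) := mul_le_mul_of_nonneg_right h (by positivity)
    _ = _ := by ring

/-- The weights of the bands at a stage. -/
noncomputable def Stage.hat (z : Stage d) (α : Fin d) : ℝ :=
  BandExchange.hat z.typ.1.coef z.norm α

theorem Stage.hat_congr {z z' : Stage d} (ht : z.typ = z'.typ) (hn : z.norm = z'.norm) :
    z.hat = z'.hat := by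
  ext α; simp only [hat, ht, hn]

/-- The weights of at least `k` bands are comparable with the largest weight. -/
def Stage.Balanced (C : ℝ) (k : ℕ) (z : Stage d) : Prop :=
  ∃ M > 0, (∀ α, z.hat α ≤ M) ∧ ∃ S : Finset (Fin d), S.card = k ∧ ∀ α ∈ S, M ≤ C * z.hat α

theorem Stage.Balanced.congr {C : ℝ} {k : ℕ} {z z' : Stage d} (ht : z.typ = z'.typ)
    (hn : z.norm = z'.norm) (h : z.Balanced C k) : z'.Balanced C k := by
  unfold Stage.Balanced at h ⊢
  rwa [← Stage.hat_congr ht hn]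

variable [NeZero d]

variable (d) in
/-- The constant in the lower bound of the volume of a body. -/
noncomputable def bodyConst : ℝ := ((d : ℝ)⁻¹) ^ (d - 1)

theorem bodyConst_pos : 0 < bodyConst d := by
  have : (0 : ℝ) < d := by exact_mod_cast Nat.pos_of_ne_zero (NeZero.ne d)
  unfold bodyConst; positivity

theorem bodyConst_le_one : bodyConst d ≤ 1 := by
  have h : (1 : ℝ) ≤ d := by exact_mod_cast Nat.one_le_iff_ne_zero.2 (NeZero.ne d)
  exact pow_le_one₀ (by positivity) (inv_le_one_of_one_le₀ h)

theorem stageVolume_univ_le (π : NonClassical d) {q : Fin d → ℝ} (hq : ∀ α, 0 < q α) :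
    stageVolume π q Set.univ ≤ ENNReal.ofReal (bodySize π.1.coef q) := by
  rw [stageVolume_univ]; exact hyperVolume_body_le π.isSign hq

theorem le_stageVolume_univ (π : NonClassical d) {q : Fin d → ℝ} (hq : ∀ α, 0 < q α) :
    ENNReal.ofReal (bodyConst d * bodySize π.1.coef q) ≤ stageVolume π q Set.univ := by
  rw [stageVolume_univ]; exact le_hyperVolume_body π.isSign hq

/-- Comparison of volumes from a comparison of sizes. -/
theorem stageVolume_univ_le_mul {π π' : NonClassical d} {q q' : Fin d → ℝ} (hq : ∀ α, 0 < q α)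
    (hq' : ∀ α, 0 < q' α) {K : ℝ} (hK : 0 ≤ K)
    (h : bodySize π.1.coef q ≤ K * bodySize π'.1.coef q') :
    stageVolume π q Set.univ ≤ ENNReal.ofReal (K / bodyConst d) * stageVolume π' q' Set.univ := by
  have hb := bodyConst_pos (d := d)
  refine (stageVolume_univ_le π hq).trans (le_trans ?_
    (mul_le_mul_right (le_stageVolume_univ π' hq') _))
  rw [← ENNReal.ofReal_mul (by positivity)]
  refine ENNReal.ofReal_le_ofReal (h.trans_eq ?_)
  field_simp

namespace Stage

variable {G : Set (NonClassical d)}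

theorem Good.hat_pos {z : Stage d} (hz : z.Good G) (α : Fin d) : 0 < z.hat α :=
  BandExchange.hat_pos z.typ.isSign hz.norm_pos α

theorem Good.step_hat (hG : IsClosedClass G) {z : Stage d} (hz : z.Good G) (α : Fin d) :
    z.step.hat α = BandExchange.hat (grow z.loser z.winner z.typ.1.coef)
      (grow z.loser z.winner z.norm) α := by
  rw [hat, hz.coef_step hG]; rfl

theorem Good.isSign_grow (hG : IsClosedClass G) {z : Stage d} (hz : z.Good G) :
    IsSign (grow z.loser z.winner z.typ.1.coef) := by
  rw [← hz.coef_step hG]; exact z.step.typ.isSign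

theorem Good.hat_le_step (hG : IsClosedClass G) {z : Stage d} (hz : z.Good G) (α : Fin d) :
    z.hat α ≤ z.step.hat α := by
  rw [hz.step_hat hG]
  exact hat_le_hat_grow z.typ.isSign (hz.isSign_grow hG) hz.norm_pos α

theorem Good.hat_winner_le_step (hG : IsClosedClass G) {z : Stage d} (hz : z.Good G) :
    z.hat z.winner ≤ z.step.hat z.loser := by
  rw [hz.step_hat hG]
  exact hat_winner_le z.typ.isSign (hz.isSign_grow hG) hz.norm_pos

theorem Good.minRev_le_step (hG : IsClosedClass G) {z : Stage d} (hz : z.Good G) :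
    minRev z.typ.1.coef z.norm ≤ minRev z.step.typ.1.coef z.step.norm := by
  rw [hz.coef_step hG]
  exact minRev_le_grow z.typ.isSign (hz.isSign_grow hG) hz.norm_pos

theorem Good.step_hat_le (hG : IsClosedClass G) {z : Stage d} (hz : z.Good G) {M : ℝ}
    (h : ∀ α, z.hat α ≤ M) (α : Fin d) : z.step.hat α ≤ 4 * M := by
  rw [hz.step_hat hG]
  exact hat_grow_le z.typ.isSign (hz.isSign_grow hG) hz.norm_pos h α

theorem Good.step_hat_le_mul (hG : IsClosedClass G) {z : Stage d} (hz : z.Good G) {M C : ℝ}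
    (hC : 1 ≤ C) (h : ∀ α, z.hat α ≤ M) (hb : M ≤ C * z.hat z.loser) (α : Fin d) :
    z.step.hat α ≤ 4 * C * z.hat α := by
  rw [hz.step_hat hG]
  exact hat_grow_le_mul z.typ.isSign (hz.isSign_grow hG) hz.norm_pos hC h hb α

theorem Good.monotone_hat (hG : IsClosedClass G) {z : Stage d} (hz : z.Good G) (α : Fin d) :
    Monotone fun n => (Stage.step^[n] z).hat α :=
  monotone_nat_of_le_succ fun n => by
    rw [Function.iterate_succ_apply']; exact (hz.iterate hG n).hat_le_step hG α

theorem Good.hat_le_iterate (hG : IsClosedClass G) {z : Stage d} (hz : z.Good G) (n : ℕ)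
    (α : Fin d) : z.hat α ≤ (Stage.step^[n] z).hat α := by
  have h : (Stage.step^[0] z).hat α ≤ (Stage.step^[n] z).hat α :=
    hz.monotone_hat hG α (Nat.zero_le n)
  rwa [Function.iterate_zero, id] at h

theorem Good.minRev_le_iterate (hG : IsClosedClass G) {z : Stage d} (hz : z.Good G) (n : ℕ) :
    minRev z.typ.1.coef z.norm ≤
      minRev (Stage.step^[n] z).typ.1.coef (Stage.step^[n] z).norm := by
  induction n with
  | zero => exact le_rfl
  | succ n ih =>
    rw [Function.iterate_succ_apply']
    exact ih.trans ((hz.iterate hG n).minRev_le_step hG)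

theorem Good.iterate_hat_le (hG : IsClosedClass G) {z : Stage d} (hz : z.Good G) {M : ℝ}
    (h : ∀ α, z.hat α ≤ M) (n : ℕ) (α : Fin d) : (Stage.step^[n] z).hat α ≤ 4 ^ n * M := by
  induction n generalizing α with
  | zero => simpa using h α
  | succ n ih =>
    rw [Function.iterate_succ_apply', pow_succ]
    exact ((hz.iterate hG n).step_hat_le hG ih α).trans_eq (by ring)

/-- At stage `n` the maximum is at most `4 ^ n * M` and heavy losers are still at least `M / C`, so
`hat_grow_le_mul` applies with the constant `4 ^ n * C`. -/
theorem Good.iterate_hat_le_mul (hG : IsClosedClass G) {z : Stage d} (hz : z.Good G) {M C : ℝ}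
    (hC : 1 ≤ C) (h : ∀ α, z.hat α ≤ M) {n : ℕ}
    (hl : ∀ i < n, M ≤ C * z.hat (Stage.step^[i] z).loser) (α : Fin d) :
    (Stage.step^[n] z).hat α ≤ (4 ^ n * C) ^ n * z.hat α := by
  induction n with
  | zero => simp
  | succ n ih =>
    have hi := ih fun i hi => hl i (by omega)
    have h4 : (1 : ℝ) ≤ 4 ^ n := one_le_pow₀ (by norm_num)
    have h4C : 1 ≤ 4 ^ n * C := one_le_mul_of_one_le_of_one_le h4 hC
    have hloser : 4 ^ n * M ≤ 4 ^ n * C * (Stage.step^[n] z).hat (Stage.step^[n] z).loser := by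
      rw [mul_assoc]
      refine mul_le_mul_of_nonneg_left ((hl n n.lt_succ_self).trans ?_) (by positivity)
      refine mul_le_mul_of_nonneg_left ?_ (by linarith)
      exact hz.hat_le_iterate hG n _
    have hstep := (hz.iterate hG n).step_hat_le_mul hG h4C (hz.iterate_hat_le hG h n) hloser α
    rw [Function.iterate_succ_apply']
    have hp := hz.hat_pos α
    calc _ ≤ 4 * (4 ^ n * C) * (Stage.step^[n] z).hat α := hstep
      _ ≤ 4 * (4 ^ n * C) * ((4 ^ n * C) ^ n * z.hat α) :=
          mul_le_mul_of_nonneg_left hi (by positivity)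
      _ ≤ 4 * (4 ^ n * C) * ((4 ^ (n + 1) * C) ^ n * z.hat α) := by
          refine mul_le_mul_of_nonneg_left (mul_le_mul_of_nonneg_right (pow_le_pow_left₀
            (by positivity) ?_ n) hp.le) (by positivity)
          rw [pow_succ]; linarith
      _ = (4 ^ (n + 1) * C) ^ (n + 1) * z.hat α := by ring

/-- The probability of a path along which the weights do not grow too much. -/
theorem Good.le_stageVolume_agree (hG : IsClosedClass G) {z : Stage d} (hz : z.Good G) {n : ℕ}
    {K : ℝ} (hK : 0 < K) (h : ∀ α, (Stage.step^[n] z).hat α ≤ K * z.hat α) :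
    ENNReal.ofReal (bodyConst d / K ^ d) * stageVolume z.typ z.norm Set.univ ≤
      stageVolume z.typ z.norm {x | Agree n ⟨z.typ, z.norm, x⟩ z} := by
  have hb := bodyConst_pos (d := d)
  have hzn := hz.iterate hG n
  have key := stageVolume_univ_le_mul (π := z.typ) (π' := (Stage.step^[n] z).typ) hz.norm_pos
    hzn.norm_pos (K := K ^ d) (by positivity) (by
      have hprod : ∏ α, (Stage.step^[n] z).hat α ≤ K ^ d * ∏ α, z.hat α := by
        have : K ^ d * ∏ α, z.hat α = ∏ α, (K * z.hat α) := by
          rw [Finset.prod_mul_distrib, Finset.prod_const, Finset.card_univ, Fintype.card_fin]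
        rw [this]
        exact Finset.prod_le_prod (fun α _ => (hzn.hat_pos α).le) fun α _ => h α
      exact div_le_mul_div (hm := (minRev_pos z.typ.isSign hz.norm_pos).le)
        (Finset.prod_pos fun α _ => hz.hat_pos α) (Finset.prod_pos fun α _ => hzn.hat_pos α)
        (by positivity) (hz.minRev_le_iterate hG n) hprod)
  have hagree := stageVolume_agree hG hz n Set.univ
  simp only [Set.mem_univ, and_true] at hagree
  rw [hagree]
  refine (mul_le_mul_right key _).trans_eq ?_
  rw [← mul_assoc, ← ENNReal.ofReal_mul (by positivity)]
  have : bodyConst d / K ^ d * (K ^ d / bodyConst d) = 1 := by field_simp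
  rw [this, ENNReal.ofReal_one, one_mul]

/-! ### Balanced sets of bands -/

/-- The weights of `k` bands are comparable with the largest weight, and a band outside the set of
these bands is critical. -/
def BalancedOpen (C : ℝ) (k : ℕ) (z : Stage d) : Prop :=
  ∃ M > 0, (∀ α, z.hat α ≤ M) ∧ ∃ S : Finset (Fin d), S.card = k ∧ (∀ α ∈ S, M ≤ C * z.hat α) ∧
    ∃ s, z.typ.win s ∉ S

theorem BalancedOpen.congr {C : ℝ} {k : ℕ} {z z' : Stage d} (ht : z.typ = z'.typ)
    (hn : z.norm = z'.norm) (h : z.BalancedOpen C k) : z'.BalancedOpen C k := by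
  unfold BalancedOpen at h ⊢
  rwa [← hat_congr ht hn, ← ht]

theorem Good.balanced_one {z : Stage d} (hz : z.Good G) : z.Balanced 1 1 := by
  obtain ⟨α, hα⟩ := Finite.exists_max z.hat
  exact ⟨z.hat α, hz.hat_pos α, hα, {α}, Finset.card_singleton α, fun β hβ => by
    rw [Finset.mem_singleton.1 hβ, one_mul]⟩

/-- Stop at the first moment when some critical band is outside `S`; before it all critical bands,
in particular the losers, lie in `S`. The bound is uniform because there are finitely many pairs of
a type and a set. -/
theorem exists_path_to_open (hG : IsClosedClass G) :
    ∃ N, ∀ π ∈ G, ∀ S : Finset (Fin d), S ≠ Finset.univ → ∃ x ∈ π.generic, ∃ n ≤ N, ∀ q,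
      (∀ i < n, (Stage.step^[i] ⟨π, q, x⟩).loser ∈ S) ∧
        ∃ s, (Stage.step^[n] ⟨π, q, x⟩).typ.win s ∉ S := by
  classical
  have key : ∀ p : NonClassical d × Finset (Fin d), ∃ N, p.1 ∈ G → p.2 ≠ Finset.univ →
      ∃ x ∈ p.1.generic, ∀ q, (∀ i < N, (Stage.step^[i] ⟨p.1, q, x⟩).loser ∈ p.2) ∧
        ∃ s, (Stage.step^[N] ⟨p.1, q, x⟩).typ.win s ∉ p.2 := by
    rintro ⟨π, S⟩
    by_cases hp : π ∈ G ∧ S ≠ Finset.univ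
    swap
    · exact ⟨0, fun h1 h2 => absurd ⟨h1, h2⟩ hp⟩
    obtain ⟨x, hx⟩ := π.generic_nonempty
    have hz : Good G ⟨π, 1, x⟩ := ⟨hp.1, hx, fun _ => one_pos⟩
    obtain ⟨α, hα⟩ : ∃ α, α ∉ S := by
      by_contra! h
      exact hp.2 (Finset.eq_univ_iff_forall.2 h)
    have hex : ∃ n, ∃ s, (Stage.step^[n] ⟨π, 1, x⟩).typ.win s ∉ S := by
      obtain ⟨n, hn⟩ := (hz.frequently_isCritical hG α).exists
      rcases hn with h | h
      · exact ⟨n, _, fun hw => hα (h ▸ hw)⟩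
      · exact ⟨n, _, fun hw => hα (h ▸ hw)⟩
    refine ⟨Nat.find hex, fun _ _ => ⟨x, hx, fun q => ?_⟩⟩
    have hc : ∀ i, (Stage.step^[i] ⟨π, q, x⟩).typ = (Stage.step^[i] ⟨π, 1, x⟩).typ := fun i =>
      (iterate_congr (z := ⟨π, q, x⟩) (z' := ⟨π, 1, x⟩) rfl rfl i).1
    refine ⟨fun i hi => ?_, ?_⟩
    · have := Nat.find_min hex hi
      push Not at this
      simp only [loser, hc i]
      exact this _
    · rw [hc]; exact Nat.find_spec hex
  choose N hN using key
  obtain ⟨B, hB⟩ := Set.Finite.bddAbove (Set.finite_range N)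
  refine ⟨B, fun π hπ S hS => ?_⟩
  obtain ⟨x, hx, h⟩ := hN (π, S) hπ hS
  exact ⟨x, hx, N (π, S), hB ⟨_, rfl⟩, h⟩

/-- All losers of the chosen path are heavy, so no weight grows by more than a bounded factor. This
bounds the probability of the path below and keeps `S` comparable with the maximum. -/
theorem exists_balancedOpen (hG : IsClosedClass G) {k : ℕ} (hk : k < d) {C : ℝ} (hC : 1 ≤ C) :
    ∃ C' : ℝ, 1 ≤ C' ∧ ∃ c : ℝ≥0∞, c ≠ 0 ∧ ∀ z : Stage d, z.Good G → z.Balanced C k →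
      c * stageVolume z.typ z.norm Set.univ ≤ stageVolume z.typ z.norm
        {x | ∃ i, (Stage.step^[i] ⟨z.typ, z.norm, x⟩).BalancedOpen C' k} := by
  obtain ⟨N, hN⟩ := exists_path_to_open hG
  have h4 : ∀ n : ℕ, (1 : ℝ) ≤ 4 ^ n := fun n => one_le_pow₀ (by norm_num)
  have hK : 0 < (4 ^ N * C) ^ N := by positivity
  refine ⟨4 ^ N * C, one_le_mul_of_one_le_of_one_le (h4 N) hC,
    ENNReal.ofReal (bodyConst d / ((4 ^ N * C) ^ N) ^ d), ?_, ?_⟩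
  · have := bodyConst_pos (d := d)
    rw [Ne, ENNReal.ofReal_eq_zero, not_le]; positivity
  rintro z hz ⟨M, hM0, hM, S, hS, hMS⟩
  obtain ⟨x, hx, n, hnN, hxn⟩ := hN z.typ hz.typ_mem S (by
    rintro rfl
    rw [Finset.card_univ, Fintype.card_fin] at hS
    omega)
  obtain ⟨hl, s, hs⟩ := hxn z.norm
  set y : Stage d := ⟨z.typ, z.norm, x⟩ with hy
  have hyg : y.Good G := ⟨hz.typ_mem, hx, hz.norm_pos⟩
  have hyhat : y.hat = z.hat := hat_congr rfl rfl
  rw [← hyhat] at hM hMS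
  refine (hyg.le_stageVolume_agree hG (n := n) hK fun α => ?_).trans (measure_mono fun w hw => ?_)
  · refine (hyg.iterate_hat_le_mul hG hC hM (fun i hi => hMS _ (hl i hi)) α).trans
      (mul_le_mul_of_nonneg_right ?_ (hyg.hat_pos α).le)
    have h1 : (4 : ℝ) ^ n ≤ 4 ^ N := pow_le_pow_right₀ (by norm_num) hnN
    have h2 : 1 ≤ 4 ^ N * C := one_le_mul_of_one_le_of_one_le (h4 N) hC
    calc (4 ^ n * C) ^ n ≤ (4 ^ N * C) ^ n :=
          pow_le_pow_left₀ (by positivity) (mul_le_mul_of_nonneg_right h1 (by linarith)) n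
      _ ≤ _ := pow_le_pow_right₀ h2 hnN
  · have hw' : Agree n ⟨z.typ, z.norm, w⟩ y := hw
    refine ⟨n, BalancedOpen.congr (hw'.symm.typ_eq rfl) (hw'.symm.norm_eq rfl rfl) ?_⟩
    refine ⟨4 ^ n * M, by positivity, hyg.iterate_hat_le hG hM n, S, hS, fun α hα => ?_, s, hs⟩
    rw [mul_assoc]
    have h1 : (4 : ℝ) ^ n ≤ 4 ^ N := pow_le_pow_right₀ (by norm_num) hnN
    have h2 := hMS α hα
    have h3 := hyg.hat_le_iterate hG n α
    exact mul_le_mul h1 (h2.trans (mul_le_mul_of_nonneg_left h3 (by linarith))) hM0.le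
      (by positivity)

end Stage

end BandExchange

namespace BandExchange

open Filter Matrix MeasureTheory
open scoped Topology ENNReal

variable {d : ℕ}

/-! ### Raising the norms on a set of bands -/

/-- The vector `q` with `ρ` added on the set `S`. -/
def bump (q : Fin d → ℝ) (S : Finset (Fin d)) (ρ : ℝ) (α : Fin d) : ℝ :=
  q α + if α ∈ S then ρ else 0

section Bump

variable {c q : Fin d → ℝ} {S : Finset (Fin d)} {ρ : ℝ}

theorem bump_of_mem {α : Fin d} (h : α ∈ S) : bump q S ρ α = q α + ρ := by simp [bump, h]

theorem bump_of_notMem {α : Fin d} (h : α ∉ S) : bump q S ρ α = q α := by simp [bump, h]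

theorem le_bump (hρ : 0 ≤ ρ) (α : Fin d) : q α ≤ bump q S ρ α := by
  unfold bump; split_ifs <;> linarith

theorem bump_le (hρ : 0 ≤ ρ) (α : Fin d) : bump q S ρ α ≤ q α + ρ := by
  unfold bump; split_ifs <;> linarith

theorem bump_pos (hρ : 0 ≤ ρ) (hq : ∀ α, 0 < q α) (α : Fin d) : 0 < bump q S ρ α :=
  (hq α).trans_le (le_bump hρ α)

theorem minOn_le_bump (hρ : 0 ≤ ρ) {v : ℝ} (h : ∃ t, c t = v) :
    minOn c q v ≤ minOn c (bump q S ρ) v := by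
  obtain ⟨t, ht, e⟩ := exists_minOn (bump q S ρ) h
  rw [← e]; exact (minOn_le q ht).trans (le_bump hρ t)

theorem minOn_bump_le (hρ : 0 ≤ ρ) {v : ℝ} (h : ∃ t, c t = v) :
    minOn c (bump q S ρ) v ≤ minOn c q v + ρ := by
  obtain ⟨t, ht, e⟩ := exists_minOn q h
  rw [← e]; exact (minOn_le _ ht).trans (bump_le hρ t)

theorem hat_le_bump (hc : IsSign c) (hρ : 0 ≤ ρ) (α : Fin d) :
    hat c q α ≤ hat c (bump q S ρ) α := by
  have h0 := le_bump (q := q) (S := S) hρ α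
  rcases hc.mem α with h | h | h
  · rwa [hat_of_zero h, hat_of_zero h]
  · rw [hat_of_one h, hat_of_one h]
    linarith [minOn_le_bump (q := q) (S := S) hρ hc.neg]
  · rw [hat_of_neg_one h, hat_of_neg_one h]
    linarith [minOn_le_bump (q := q) (S := S) hρ hc.pos]

theorem hat_bump_le (hc : IsSign c) (hρ : 0 ≤ ρ) (α : Fin d) :
    hat c (bump q S ρ) α ≤ hat c q α + 2 * ρ := by
  have h0 := bump_le (q := q) (S := S) hρ α
  rcases hc.mem α with h | h | h
  · rw [hat_of_zero h, hat_of_zero h]; linarith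
  · rw [hat_of_one h, hat_of_one h]
    linarith [minOn_bump_le (q := q) (S := S) hρ hc.neg]
  · rw [hat_of_neg_one h, hat_of_neg_one h]
    linarith [minOn_bump_le (q := q) (S := S) hρ hc.pos]

theorem le_hat_bump (hc : IsSign c) (hρ : 0 ≤ ρ) (hq : ∀ α, 0 < q α) {α : Fin d} (h : α ∈ S) :
    ρ ≤ hat c (bump q S ρ) α := by
  refine le_trans ?_ (le_hat hc (bump_pos hρ hq) α)
  rw [bump_of_mem h]; linarith [hq α]

theorem hat_bump_eq (hc : IsSign c) {α : Fin d} (hα : α ∉ S)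
    (h1 : c α ≠ 0 → minOn c (bump q S ρ) 1 = minOn c q 1 ∧
      minOn c (bump q S ρ) (-1) = minOn c q (-1)) :
    hat c (bump q S ρ) α = hat c q α := by
  rcases hc.mem α with h | h | h
  · rw [hat_of_zero h, hat_of_zero h, bump_of_notMem hα]
  · rw [hat_of_one h, hat_of_one h, bump_of_notMem hα, (h1 (by rw [h]; norm_num)).2]
  · rw [hat_of_neg_one h, hat_of_neg_one h, bump_of_notMem hα, (h1 (by rw [h]; norm_num)).1]

/-- If the weights outside `S` are smaller than those in `S` and `c` does not vanish outside `S`,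
the minima are attained outside `S`. -/
theorem minOn_bump_of_exists (hc : IsSign c) (hρ : 0 ≤ ρ) {μ : ℝ} (hS : ∀ α ∈ S, μ ≤ hat c q α)
    (hSc : ∀ α, α ∉ S → hat c q α < μ) (h : ∃ γ, γ ∉ S ∧ c γ ≠ 0) :
    minOn c (bump q S ρ) 1 = minOn c q 1 ∧ minOn c (bump q S ρ) (-1) = minOn c q (-1) := by
  obtain ⟨γ, hγ, hcγ⟩ := h
  obtain ⟨t, u, ht, hu, htq, huq, h1, h2⟩ := exists_hat_eq_minRev hc q
  have hlt : minRev c q < μ := (minRev_le_hat hc hcγ).trans_lt (hSc γ hγ)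
  have htS : t ∉ S := fun h => absurd (hS t h) (by rw [h1]; exact hlt.not_ge)
  have huS : u ∉ S := fun h => absurd (hS u h) (by rw [h2]; exact hlt.not_ge)
  refine ⟨le_antisymm ?_ (minOn_le_bump hρ hc.pos), le_antisymm ?_ (minOn_le_bump hρ hc.neg)⟩
  · rw [← htq, ← bump_of_notMem (q := q) (ρ := ρ) htS]; exact minOn_le _ ht
  · rw [← huq, ← bump_of_notMem (q := q) (ρ := ρ) huS]; exact minOn_le _ hu

theorem minOn_bump_of_forall (hρ : 0 ≤ ρ) (hS : ∀ α, α ∉ S → c α = 0) {v : ℝ} (hv : v ≠ 0)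
    (h : ∃ t, c t = v) : minOn c (bump q S ρ) v = minOn c q v + ρ := by
  refine le_antisymm (minOn_bump_le hρ h) ?_
  obtain ⟨t, ht, e⟩ := exists_minOn (bump q S ρ) h
  have htS : t ∈ S := by
    by_contra h0
    exact hv (by rw [← ht, hS t h0])
  rw [← e, bump_of_mem htS]
  linarith [minOn_le q ht]

/-- The gain at the start: each weight in `S` grows by a factor of at least `R`, and `e` accounts
for the growth of `minRev`. -/
theorem bodySize_bump_le {e R M : ℝ} (hc : IsSign c) (hq : ∀ α, 0 < q α) (hR : 1 ≤ R)
    (hM : ∀ α, hat c q α ≤ M) (hM0 : 0 < M)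
    (hm : minRev c (bump q S (R * M)) ≤ e * minRev c q) :
    bodySize c (bump q S (R * M)) ≤ e / R ^ S.card * bodySize c q := by
  have hρ : 0 ≤ R * M := by positivity
  have hprod : R ^ S.card * ∏ α, hat c q α ≤ ∏ α, hat c (bump q S (R * M)) α := by
    have : R ^ S.card * ∏ α, hat c q α = ∏ α, ((if α ∈ S then R else 1) * hat c q α) := by
      rw [Finset.prod_mul_distrib, Finset.prod_ite_mem, Finset.univ_inter, Finset.prod_const]
    rw [this]
    refine Finset.prod_le_prod (fun α _ => ?_) fun α _ => ?_
    · have := hat_pos hc hq α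
      split_ifs <;> positivity
    · split_ifs with h
      · exact (mul_le_mul_of_nonneg_left (hM α) (by linarith)).trans (le_hat_bump hc hρ hq h)
      · rw [one_mul]; exact hat_le_bump hc hρ α
  have hp : 0 < ∏ α, hat c q α := Finset.prod_pos fun α _ => hat_pos hc hq α
  have hm0 := minRev_pos hc hq
  have hmb := minRev_pos hc (bump_pos (S := S) hρ hq)
  unfold bodySize
  rw [div_mul_div_comm]
  exact div_le_div₀ (hmb.le.trans hm) hm (by positivity) hprod

/-- The loss at the end, with a separate factor `w` for each weight so that bands that are already
large can be treated better. -/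
theorem bodySize_le_bump {τ : ℝ} (hc : IsSign c) (hq : ∀ α, 0 < q α) (hρ : 0 ≤ ρ)
    (hm : minRev c q ≤ τ * minRev c (bump q S ρ)) {w : Fin d → ℝ}
    (hw : ∀ α, hat c (bump q S ρ) α ≤ w α * hat c q α) :
    bodySize c q ≤ (τ * ∏ α, w α) * bodySize c (bump q S ρ) := by
  have hp : 0 < ∏ α, hat c q α := Finset.prod_pos fun α _ => hat_pos hc hq α
  have hb : ∀ α, 0 < hat c (bump q S ρ) α := fun α => hat_pos hc (bump_pos hρ hq) α
  have hpb : 0 < ∏ α, hat c (bump q S ρ) α := Finset.prod_pos fun α _ => hb α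
  have hprod : ∏ α, hat c (bump q S ρ) α ≤ (∏ α, w α) * ∏ α, hat c q α := by
    rw [← Finset.prod_mul_distrib]
    exact Finset.prod_le_prod (fun α _ => (hb α).le) fun α _ => hw α
  have hw0 : 0 ≤ ∏ α, w α := Finset.prod_nonneg fun α _ => by
    have := (hb α).le.trans (hw α)
    exact nonneg_of_mul_nonneg_left this (hat_pos hc hq α)
  have hm0 := minRev_pos hc hq
  have hmb := minRev_pos hc (bump_pos (S := S) hρ hq)
  refine (div_le_mul_div hm0.le hp hpb hw0 hm hprod).trans_eq ?_
  unfold bodySize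
  ring

theorem prod_ite_one {h : ℝ} {α : Fin d} (hα : α ∈ S) :
    ∏ γ, (if γ ∈ S then (if γ = α then 3 else h) else 1) = 3 * h ^ (S.card - 1) := by
  rw [Finset.prod_ite_mem, Finset.univ_inter, ← Finset.mul_prod_erase _ _ hα, if_pos rfl,
    ← Finset.card_erase_of_mem hα, ← Finset.prod_const]
  congr 1
  exact Finset.prod_congr rfl fun γ hγ => if_neg (Finset.ne_of_mem_erase hγ)

theorem prod_ite_two {h e : ℝ} {α t : Fin d} (hα : α ∈ S) (ht : t ∈ S) (hne : α ≠ t) :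
    ∏ γ, (if γ ∈ S then (if γ = t then e else if γ = α then 3 else h) else 1) =
      e * (3 * h ^ (S.card - 2)) := by
  have hα' : α ∈ S.erase t := Finset.mem_erase.2 ⟨hne, hα⟩
  rw [Finset.prod_ite_mem, Finset.univ_inter, ← Finset.mul_prod_erase _ _ ht, if_pos rfl,
    ← Finset.mul_prod_erase _ _ hα', if_neg hne, if_pos rfl, show S.card - 2 = S.card - 1 - 1 from rfl,
    ← Finset.card_erase_of_mem ht, ← Finset.card_erase_of_mem hα', ← Finset.prod_const]
  congr 2
  refine Finset.prod_congr rfl fun γ hγ => ?_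
  rw [if_neg (Finset.ne_of_mem_erase (Finset.mem_of_mem_erase hγ)),
    if_neg (Finset.ne_of_mem_erase hγ)]

/-- Comparison at the start, when `c` does not vanish outside `S`. -/
theorem bodySize_bump_le_of_exists {R M C : ℝ} (hc : IsSign c) (hq : ∀ α, 0 < q α) (hR : 1 ≤ R)
    (hC : 1 ≤ C) (hM : ∀ α, hat c q α ≤ M) (hM0 : 0 < M) (hS : ∀ α ∈ S, M ≤ C * hat c q α)
    (hSc : ∀ α, α ∉ S → C * hat c q α < M) (h : ∃ γ, γ ∉ S ∧ c γ ≠ 0) :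
    bodySize c (bump q S (R * M)) ≤ 1 / R ^ S.card * bodySize c q := by
  have hC0 : 0 < C := by linarith
  refine bodySize_bump_le hc hq hR hM hM0 ?_
  obtain ⟨h1, h2⟩ := minOn_bump_of_exists (ρ := R * M) hc (by positivity) (μ := M / C)
    (fun α hα => by rw [div_le_iff₀ hC0, mul_comm]; exact hS α hα)
    (fun α hα => by rw [lt_div_iff₀ hC0, mul_comm]; exact hSc α hα) h
  rw [one_mul, minRev, minRev, h1, h2]

/-- Comparison at the end, when `c` does not vanish outside `S`. -/
theorem bodySize_le_bump_of_exists {R M C : ℝ} (hc : IsSign c) (hq : ∀ α, 0 < q α) (hR : 1 ≤ R)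
    (hC : 1 ≤ C) (hM0 : 0 < M) (hS : ∀ α ∈ S, M ≤ C * hat c q α)
    (hSc : ∀ α, α ∉ S → C * hat c q α < M) (h : ∃ γ, γ ∉ S ∧ c γ ≠ 0) {α : Fin d} (hα : α ∈ S)
    (hαM : R * M ≤ hat c q α) :
    bodySize c q ≤ (3 * (1 + 2 * R * C) ^ (S.card - 1)) * bodySize c (bump q S (R * M)) := by
  have hC0 : 0 < C := by linarith
  have hρ : 0 ≤ R * M := by positivity
  obtain ⟨h1, h2⟩ := minOn_bump_of_exists (ρ := R * M) hc hρ (μ := M / C)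
    (fun α hα => by rw [div_le_iff₀ hC0, mul_comm]; exact hS α hα)
    (fun α hα => by rw [lt_div_iff₀ hC0, mul_comm]; exact hSc α hα) h
  have := bodySize_le_bump (S := S) (ρ := R * M) (τ := 1) hc hq hρ
    (by rw [one_mul, minRev, minRev, h1, h2])
    (w := fun γ => if γ ∈ S then (if γ = α then 3 else 1 + 2 * R * C) else 1) (fun γ => by
      have hle := hat_bump_le (q := q) (S := S) hc hρ γ
      split_ifs with hγ e
      · subst e; linarith
      · have := mul_le_mul_of_nonneg_left (hS γ hγ) (by linarith : 0 ≤ 2 * R)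
        linarith
      · rw [one_mul, hat_bump_eq hc hγ fun _ => ⟨h1, h2⟩])
  rwa [prod_ite_one hα, one_mul] at this

/-- Comparison at the start, when `c` vanishes outside `S`. -/
theorem bodySize_bump_le_of_forall {R M C : ℝ} (hc : IsSign c) (hq : ∀ α, 0 < q α) (hR : 1 ≤ R)
    (hM : ∀ α, hat c q α ≤ M) (hM0 : 0 < M) (hS : ∀ α ∈ S, M ≤ C * hat c q α)
    (h : ∀ α, α ∉ S → c α = 0) :
    bodySize c (bump q S (R * M)) ≤ (1 + 2 * R * C) / R ^ S.card * bodySize c q := by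
  refine bodySize_bump_le hc hq hR hM hM0 ?_
  have hρ : 0 ≤ R * M := by positivity
  rw [minRev, minOn_bump_of_forall hρ h one_ne_zero hc.pos,
    minOn_bump_of_forall hρ h (by norm_num) hc.neg]
  obtain ⟨t, u, ht, hu, htq, huq, h1, h2⟩ := exists_hat_eq_minRev hc q
  have htS : t ∈ S := by
    by_contra h0
    have := h t h0
    rw [ht] at this; norm_num at this
  have := mul_le_mul_of_nonneg_left (hS t htS) (by linarith : 0 ≤ 2 * R)
  rw [h1] at this
  have e : minRev c q = minOn c q 1 + minOn c q (-1) := rfl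
  linarith

/-- Comparison at the end, when `c` vanishes outside `S`. -/
theorem bodySize_le_bump_of_forall {R M C : ℝ} (hc : IsSign c) (hq : ∀ α, 0 < q α) (hR : 1 ≤ R)
    (hM0 : 0 < M) (hS : ∀ α ∈ S, M ≤ C * hat c q α)
    (h : ∀ α, α ∉ S → c α = 0) {α : Fin d} (hα : α ∈ S) (hαM : R * M ≤ hat c q α) :
    2 ≤ S.card ∧
    bodySize c q ≤ (3 * (1 + 2 * R * C) ^ (S.card - 2)) * bodySize c (bump q S (R * M)) := by
  have hρ : 0 ≤ R * M := by positivity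
  have hm1 := minOn_bump_of_forall (q := q) hρ h one_ne_zero hc.pos
  have hm2 := minOn_bump_of_forall (q := q) hρ h (by norm_num) hc.neg
  have hmb : minRev c (bump q S (R * M)) = minRev c q + 2 * (R * M) := by
    rw [minRev, minRev, hm1, hm2]; ring
  have hm0 := minRev_pos hc hq
  -- Two bands attain the minimum, so one differs from `α`. Its growth factor cancels exactly
  -- against the growth of `minRev`, which leaves the exponent `S.card - 2` and offsets the factor
  -- `1 + 2 * R * C` lost at the start.
  obtain ⟨t, ht, hαt, hct⟩ : ∃ t, c t ≠ 0 ∧ α ≠ t ∧ hat c q t = minRev c q := by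
    obtain ⟨t, u, ht, hu, -, -, h1, h2⟩ := exists_hat_eq_minRev hc q
    by_cases e : α = t
    · refine ⟨u, by rw [hu]; norm_num, ?_, h2⟩
      rintro rfl
      rw [e, ht] at hu; norm_num at hu
    · exact ⟨t, by rw [ht]; norm_num, e, h1⟩
  have htS : t ∈ S := by_contra fun h0 => ht (h t h0)
  refine ⟨Finset.one_lt_card.2 ⟨α, hα, t, htS, hαt⟩, ?_⟩
  have := bodySize_le_bump (S := S) (ρ := R * M)
    (τ := minRev c q / (minRev c q + 2 * (R * M))) hc hq hρ
    (by rw [hmb, div_mul_cancel₀]; positivity)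
    (w := fun γ => if γ ∈ S then (if γ = t then (minRev c q + 2 * (R * M)) / minRev c q else
      if γ = α then 3 else 1 + 2 * R * C) else 1) (fun γ => by
      have hle := hat_bump_le (q := q) (S := S) hc hρ γ
      split_ifs with hγ e e'
      · subst e
        rw [hct, div_mul_cancel₀ _ hm0.ne']
        rwa [hct] at hle
      · subst e'; linarith
      · have := mul_le_mul_of_nonneg_left (hS γ hγ) (by linarith : 0 ≤ 2 * R)
        linarith
      · rw [one_mul, hat_bump_eq hc hγ fun h0 => absurd (h γ hγ) h0])
  rw [prod_ite_two hα htS hαt, ← mul_assoc, div_mul_div_cancel₀ (by positivity), div_self hm0.ne',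
    one_mul] at this
  exact this

end Bump

end BandExchange

/-! ### Enlarging a balanced set of bands -/

namespace BandExchange

open Filter Matrix MeasureTheory
open scoped Topology ENNReal

variable {d : ℕ} [NeZero d]

namespace Stage

variable {G : Set (NonClassical d)}

/-- The weights are unbounded along an orbit. -/
theorem Good.exists_lt_hat (hG : IsClosedClass G) {z : Stage d} (hz : z.Good G) (K : ℝ) :
    ∃ n α, K < (Stage.step^[n] z).hat α := by
  by_contra! hcon
  -- The left side is a positive invariant of the orbit, while the widths tend to zero; norms are
  -- bounded by weights.
  have hle : ∀ n, z.norm ⬝ᵥ z.width ≤ ∑ α, K * (Stage.step^[n] z).width α := fun n => by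
    rw [← iterate_norm_dotProduct z n]
    have hg := hz.iterate hG n
    exact Finset.sum_le_sum fun α _ => mul_le_mul_of_nonneg_right
      ((le_hat (Stage.step^[n] z).typ.isSign hg.norm_pos α).trans (hcon n α)) (hg.width_pos α).le
  have hlim : Tendsto (fun n => ∑ α, K * (Stage.step^[n] z).width α) atTop (𝓝 0) := by
    have : Tendsto (fun n => ∑ α, K * (Stage.step^[n] z).width α) atTop (𝓝 (∑ _α : Fin d, K * 0)) :=
      tendsto_finsetSum _ fun α _ => (hz.tendsto_width hG α).const_mul K
    simpa using this
  have h0 : 0 < z.norm ⬝ᵥ z.width := Finset.sum_pos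
    (fun α _ => mul_pos (hz.norm_pos α) (hz.width_pos α)) Finset.univ_nonempty
  exact absurd (ge_of_tendsto' hlim hle) h0.not_ge

/-- Along a path on which no further band becomes heavy, the winners lie outside `S`. -/
theorem Good.winner_notMem (hG : IsClosedClass G) {z : Stage d} (hz : z.Good G)
    {S : Finset (Fin d)} {M C R : ℝ} (hM0 : 0 < M) (hC : 1 ≤ C) (hR : 1 ≤ R)
    (hM : ∀ α, z.hat α ≤ M) (hS : ∀ α ∈ S, M ≤ C * z.hat α) (hcrit : ∃ s, z.typ.win s ∉ S) {n : ℕ}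
    (hle : ∀ i < n, ∀ α, (Stage.step^[i] z).hat α ≤ R * M)
    (hnot : ∀ i ≤ n, ¬ (Stage.step^[i] z).Balanced (4 * R * C) (S.card + 1)) :
    (∀ i ≤ n, ∀ γ, γ ∉ S → C * (Stage.step^[i] z).hat γ < M) ∧
      ∀ i < n, (Stage.step^[i] z).winner ∉ S := by
  classical
  -- Otherwise `S` together with `γ` would be balanced. The weights are at most `4 * R * M`, as the
  -- last split may overshoot `R * M` by a factor 4.
  have hsmall : ∀ i ≤ n, ∀ γ, γ ∉ S → C * (Stage.step^[i] z).hat γ < M := by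
    intro i hi γ hγ
    by_contra! hcon
    refine hnot i hi ⟨4 * R * M, by positivity, fun α => ?_, insert γ S,
      Finset.card_insert_of_notMem hγ, fun α hα => ?_⟩
    · cases i with
      | zero =>
        refine (hM α).trans ?_
        have := mul_le_mul_of_nonneg_right hR hM0.le
        linarith
      | succ i =>
        rw [Function.iterate_succ_apply']
        exact ((hz.iterate hG i).step_hat_le hG (hle i (by omega)) α).trans_eq (by ring)
    · have : M ≤ C * (Stage.step^[i] z).hat α := by
        rcases Finset.mem_insert.1 hα with rfl | hα
        · exact hcon
        · exact (hS α hα).trans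
            (mul_le_mul_of_nonneg_left (hz.hat_le_iterate hG i α) (by linarith))
      have := mul_le_mul_of_nonneg_left this (by linarith : 0 ≤ 4 * R)
      linarith
  refine ⟨hsmall, ?_⟩
  -- A winner in `S` passes its weight on to its loser, so a loser outside `S` would become heavy. A
  -- winner outside `S` stays critical, which propagates the hypothesis.
  have key : ∀ i < n, (∃ s, (Stage.step^[i] z).typ.win s ∉ S) →
      (Stage.step^[i] z).winner ∉ S := by
    rintro i hi ⟨s, hs⟩ hw
    have hl : (Stage.step^[i] z).loser ∉ S := by
      rcases isCritical_win (Stage.step^[i] z) s with h | h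
      · rw [h] at hs; exact absurd hw hs
      · rwa [h] at hs
    have h1 := hsmall (i + 1) hi _ hl
    rw [Function.iterate_succ_apply'] at h1
    have h2 := (hz.iterate hG i).hat_winner_le_step hG
    have h3 := hz.hat_le_iterate hG i (Stage.step^[i] z).winner
    have h4 := hS _ hw
    have h5 := mul_le_mul_of_nonneg_left (h3.trans h2) (by linarith : 0 ≤ C)
    linarith
  have hinv : ∀ i ≤ n, ∃ s, (Stage.step^[i] z).typ.win s ∉ S := fun i => by
    induction i with
    | zero => exact fun _ => hcrit
    | succ i ih =>
      intro hi
      refine ⟨(Stage.step^[i] z).side, ?_⟩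
      rw [Function.iterate_succ_apply']
      have : (Stage.step^[i] z).step.typ.win (Stage.step^[i] z).side = (Stage.step^[i] z).winner :=
        ((hz.iterate hG i).valid hG).win_next
      rw [this]
      exact key i hi (ih (by omega))
  exact fun i hi => key i hi (hinv i hi.le)

/-- A split adds the norm of the winner to that of the loser, and the winners' norms are not raised;
so the bump on `S` persists unchanged. -/
theorem iterate_norm_bump {π : NonClassical d} {q x : Fin d → ℝ} {S : Finset (Fin d)} {ρ : ℝ}
    {n : ℕ} (h : ∀ i < n, (step^[i] ⟨π, q, x⟩).winner ∉ S) :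
    (step^[n] ⟨π, bump q S ρ, x⟩).norm = bump (step^[n] ⟨π, q, x⟩).norm S ρ := by
  induction n with
  | zero => rfl
  | succ n ih =>
    have hw := h n n.lt_succ_self
    obtain ⟨h1, h2⟩ := iterate_congr (z := ⟨π, bump q S ρ, x⟩) (z' := ⟨π, q, x⟩) rfl rfl n
    have hs : (step^[n] ⟨π, bump q S ρ, x⟩).side = (step^[n] ⟨π, q, x⟩).side := by
      simp only [side, h1, h2]
    rw [Function.iterate_succ_apply', Function.iterate_succ_apply']
    simp only [step]
    rw [winner_congr h1 hs, loser_congr h1 hs, ih fun i hi => h i (by omega)]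
    set y := step^[n] ⟨π, q, x⟩
    ext γ
    by_cases e : γ = y.loser
    · subst e
      rw [grow_same, bump_of_notMem hw, bump, bump, grow_same]
      ring
    · rw [grow_of_ne e, bump, bump, grow_of_ne e]

/-- Each split adds the coefficient of a band outside `S` to one other coefficient. The case
distinction in the volume comparison is therefore the same at both ends of the path. -/
theorem Good.coef_of_winner_notMem (hG : IsClosedClass G) {z : Stage d} (hz : z.Good G)
    {S : Finset (Fin d)} {n : ℕ} (h : ∀ i < n, (Stage.step^[i] z).winner ∉ S) :
    ((∃ γ, γ ∉ S ∧ z.typ.1.coef γ ≠ 0) → ∃ γ, γ ∉ S ∧ (Stage.step^[n] z).typ.1.coef γ ≠ 0) ∧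
    ((∀ γ, γ ∉ S → z.typ.1.coef γ = 0) → ∀ γ, γ ∉ S → (Stage.step^[n] z).typ.1.coef γ = 0) := by
  induction n with
  | zero => exact ⟨id, id⟩
  | succ n ih =>
    obtain ⟨h1, h2⟩ := ih fun i hi => h i (by omega)
    have hw := h n n.lt_succ_self
    rw [Function.iterate_succ_apply', (hz.iterate hG n).coef_step hG]
    set y := Stage.step^[n] z
    refine ⟨fun h0 => ?_, fun h0 γ hγ => ?_⟩
    · obtain ⟨γ, hγ, hc⟩ := h1 h0
      by_cases e : γ = y.loser
      · by_cases hcw : y.typ.1.coef y.winner = 0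
        · refine ⟨γ, hγ, ?_⟩
          rw [e, grow_same, hcw, add_zero, ← e]; exact hc
        · exact ⟨y.winner, hw, by rwa [grow_of_ne y.winner_ne_loser]⟩
      · exact ⟨γ, hγ, by rwa [grow_of_ne e]⟩
    · by_cases e : γ = y.loser
      · rw [e, grow_same, h2 h0 _ hw, add_zero, ← e]; exact h2 h0 γ hγ
      · rw [grow_of_ne e]; exact h2 h0 γ hγ

/-- Comparison of the sizes at the end of a path on which no further band becomes heavy. -/
theorem bad_path (hG : IsClosedClass G) {z : Stage d} (hz : z.Good G)
    {S : Finset (Fin d)} {M C R : ℝ} (hM0 : 0 < M) (hC : 1 ≤ C) (hR : 1 ≤ R)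
    (hM : ∀ α, z.hat α ≤ M) (hS : ∀ α ∈ S, M ≤ C * z.hat α) (hcrit : ∃ s, z.typ.win s ∉ S) {n : ℕ}
    (hle : ∀ i < n, ∀ α, (Stage.step^[i] z).hat α ≤ R * M)
    (hlt : ∃ α, R * M < (Stage.step^[n] z).hat α)
    (hnot : ∀ i ≤ n, ¬ (Stage.step^[i] z).Balanced (4 * R * C) (S.card + 1)) :
    ((∃ γ, γ ∉ S ∧ z.typ.1.coef γ ≠ 0) →
      bodySize (Stage.step^[n] z).typ.1.coef (Stage.step^[n] z).norm ≤
        3 * (1 + 2 * R * C) ^ (S.card - 1) * bodySize (Stage.step^[n] z).typ.1.coef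
          (Stage.step^[n] ⟨z.typ, bump z.norm S (R * M), z.width⟩).norm) ∧
    ((∀ γ, γ ∉ S → z.typ.1.coef γ = 0) → 2 ≤ S.card ∧
      bodySize (Stage.step^[n] z).typ.1.coef (Stage.step^[n] z).norm ≤
        3 * (1 + 2 * R * C) ^ (S.card - 2) * bodySize (Stage.step^[n] z).typ.1.coef
          (Stage.step^[n] ⟨z.typ, bump z.norm S (R * M), z.width⟩).norm) := by
  obtain ⟨hsmall, hwin⟩ := hz.winner_notMem hG hM0 hC hR hM hS hcrit hle hnot
  obtain ⟨α, hα⟩ := hlt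
  have hzn := hz.iterate hG n
  have hMR : M ≤ R * M := le_mul_of_one_le_left hM0.le hR
  have hαS : α ∈ S := by
    by_contra h
    have h1 := hsmall n le_rfl α h
    have h2 := le_mul_of_one_le_left (hzn.hat_pos α).le hC
    linarith
  have hSn : ∀ β ∈ S, M ≤ C * (Stage.step^[n] z).hat β := fun β hβ => (hS β hβ).trans
    (mul_le_mul_of_nonneg_left (hz.hat_le_iterate hG n β) (by linarith))
  obtain ⟨hex, hall⟩ := hz.coef_of_winner_notMem hG hwin
  rw [iterate_norm_bump (π := z.typ) (q := z.norm) (x := z.width) hwin]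
  exact ⟨fun h => bodySize_le_bump_of_exists (Stage.step^[n] z).typ.isSign hzn.norm_pos hR hC hM0
    hSn (hsmall n le_rfl) (hex h) hαS hα.le,
    fun h => bodySize_le_bump_of_forall (Stage.step^[n] z).typ.isSign hzn.norm_pos hR hM0
    hSn (hall h) hαS hα.le⟩

/-- Cut the bad event at the first time a weight exceeds `K`. On each cylinder its volume is at most
`A` times the volume for the norms `q'`, and these sum to at most the total for `q'`, which is `B`
times the original total. Each passage from sizes to volumes costs one factor `bodyConst`. -/
theorem Good.half_le_of_bad (hG : IsClosedClass G) {z : Stage d} (hz : z.Good G) {q' : Fin d → ℝ}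
    (hq' : ∀ α, 0 < q' α) {C K : ℝ} {k : ℕ} {A B : ℝ} (hA0 : 0 ≤ A) (hB0 : 0 ≤ B)
    (hAB : A * B / bodyConst d ^ 2 ≤ 2⁻¹)
    (hstart : bodySize z.typ.1.coef q' ≤ B * bodySize z.typ.1.coef z.norm)
    (hend : ∀ n, ∀ x ∈ z.typ.generic,
      (∀ i < n, ∀ α, (Stage.step^[i] ⟨z.typ, z.norm, x⟩).hat α ≤ K) →
      (∃ α, K < (Stage.step^[n] ⟨z.typ, z.norm, x⟩).hat α) →
      (∀ i ≤ n, ¬ (Stage.step^[i] ⟨z.typ, z.norm, x⟩).Balanced C k) →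
      bodySize (Stage.step^[n] ⟨z.typ, z.norm, x⟩).typ.1.coef
        (Stage.step^[n] ⟨z.typ, z.norm, x⟩).norm ≤ A * bodySize
        (Stage.step^[n] ⟨z.typ, z.norm, x⟩).typ.1.coef (Stage.step^[n] ⟨z.typ, q', x⟩).norm) :
    2⁻¹ * stageVolume z.typ z.norm Set.univ ≤ stageVolume z.typ z.norm
      {x | ∃ i, (Stage.step^[i] ⟨z.typ, z.norm, x⟩).Balanced C k} := by
  obtain ⟨π, q, w⟩ := z
  have hδ := bodyConst_pos (d := d)
  set δ := bodyConst d
  have hq : ∀ α, 0 < q α := hz.norm_pos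
  simp only [] at hstart hend ⊢
  have := isFiniteMeasure_stageVolume π hq
  set E : Set (Fin d → ℝ) := {x | ∃ i, (Stage.step^[i] ⟨π, q, x⟩).Balanced C k} with hE
  set P : ℕ → Set (Fin d → ℝ) := fun n => {x | (∀ i < n, ∀ α, (Stage.step^[i] ⟨π, q, x⟩).hat α ≤ K)
    ∧ (∃ α, K < (Stage.step^[n] ⟨π, q, x⟩).hat α) ∧
    ∀ i ≤ n, ¬ (Stage.step^[i] ⟨π, q, x⟩).Balanced C k} with hP
  have hPd : ∀ n, Determined (sideCode π q) n (P n) := by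
    intro n x y hxy hx
    have ha : Agree n ⟨π, q, x⟩ ⟨π, q, y⟩ := hxy
    have ht : ∀ i ≤ n, (Stage.step^[i] ⟨π, q, x⟩).typ = (Stage.step^[i] ⟨π, q, y⟩).typ :=
      fun i hi => (ha.mono hi).typ_eq rfl
    have hn : ∀ i ≤ n, (Stage.step^[i] ⟨π, q, x⟩).norm = (Stage.step^[i] ⟨π, q, y⟩).norm :=
      fun i hi => (ha.mono hi).norm_eq rfl rfl
    have hh : ∀ i ≤ n, (Stage.step^[i] ⟨π, q, x⟩).hat = (Stage.step^[i] ⟨π, q, y⟩).hat :=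
      fun i hi => hat_congr (ht i hi) (hn i hi)
    refine ⟨fun i hi => ?_, ?_, fun i hi hb => hx.2.2 i hi (hb.congr (ht i hi).symm (hn i hi).symm)⟩
    · rw [← hh i hi.le]; exact hx.1 i hi
    · rw [← hh n le_rfl]; exact hx.2.1
  have hPE : ∀ x ∈ π.generic, x ∈ E ∪ ⋃ n, P n := by
    intro x hx
    by_cases hxE : x ∈ E
    · exact .inl hxE
    have hg : Good G ⟨π, q, x⟩ := ⟨hz.typ_mem, hx, hz.norm_pos⟩
    have hex := hg.exists_lt_hat hG K
    classical
    refine .inr (Set.mem_iUnion.2 ⟨Nat.find hex, fun i hi α => ?_, Nat.find_spec hex, fun i _ hb =>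
      hxE ⟨i, hb⟩⟩)
    have := Nat.find_min hex hi
    push Not at this
    exact this α
  have hbad := measure_iUnion_le_of_cylinder (measurableSet_cylinder π q) (μ := stageVolume π q)
    (ν := ENNReal.ofReal (A / δ) • stageVolume π q') hPd (fun n y hy => by
      by_cases h0 : stageVolume π q (cylinder (sideCode π q) n y) = 0
      · rw [h0]; exact zero_le
      obtain ⟨x, hx, hxg⟩ := exists_generic_of_ne_zero h0
      rw [cylinder_eq hx]
      have hxP : x ∈ P n := (hPd n).cylinder_subset hy hx
      have hg : Good G ⟨π, q, x⟩ := ⟨hz.typ_mem, hxg, hq⟩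
      have hg' : Good G ⟨π, q', x⟩ := ⟨hz.typ_mem, hxg, hq'⟩
      have h1 := stageVolume_agree hG hg n Set.univ
      have h2 := stageVolume_agree hG hg' n Set.univ
      simp only [Set.mem_univ, and_true] at h1 h2
      have hc1 : cylinder (sideCode π q) n x = {w | Agree n ⟨π, q, w⟩ ⟨π, q, x⟩} := rfl
      -- The sides depend on type and widths only, so both choices of norms have the same cylinders.
      have hc2 : cylinder (sideCode π q) n x = {w | Agree n ⟨π, q', w⟩ ⟨π, q', x⟩} := by
        ext w
        have e : ∀ u i, (Stage.step^[i] ⟨π, q, u⟩).side = (Stage.step^[i] ⟨π, q', u⟩).side :=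
          fun u i => agree_of_width (z := ⟨π, q, u⟩) (z' := ⟨π, q', u⟩) rfl rfl (i + 1) i
            (Nat.lt_succ_self i)
        refine forall₂_congr fun i _ => ?_
        rw [sideCode, sideCode, e, e]
      rw [Measure.smul_apply, smul_eq_mul]
      nth_rewrite 2 [hc2]
      rw [hc1, h1, h2]
      have ht : (Stage.step^[n] ⟨π, q', x⟩).typ = (Stage.step^[n] ⟨π, q, x⟩).typ :=
        (iterate_congr (z := ⟨π, q', x⟩) (z' := ⟨π, q, x⟩) rfl rfl n).1
      rw [ht]
      exact stageVolume_univ_le_mul (hg.iterate hG n).norm_pos (hg'.iterate hG n).norm_pos hA0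
        (hend n x hxg hxP.1 hxP.2.1 hxP.2.2))
  have hle : stageVolume π q Set.univ ≤ stageVolume π q E + 2⁻¹ * stageVolume π q Set.univ := by
    calc stageVolume π q Set.univ ≤ stageVolume π q (E ∪ ⋃ n, P n) := by
          refine measure_mono_ae ?_
          filter_upwards [stageVolume_mem_generic π q] with x hx _ using hPE x hx
      _ ≤ stageVolume π q E + stageVolume π q (⋃ n, P n) := measure_union_le _ _
      _ ≤ stageVolume π q E + ENNReal.ofReal (A / δ) * stageVolume π q' Set.univ := by
          gcongr
          exact hbad.trans (by
            rw [Measure.smul_apply, smul_eq_mul]; gcongr; exact Set.subset_univ _)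
      _ ≤ stageVolume π q E + ENNReal.ofReal (A / δ) *
            (ENNReal.ofReal (B / δ) * stageVolume π q Set.univ) := by
          gcongr
          exact stageVolume_univ_le_mul hq' hq hB0 hstart
      _ ≤ _ := by
          refine add_le_add le_rfl ?_
          rw [← mul_assoc, ← ENNReal.ofReal_mul (by positivity)]
          refine mul_le_mul_left ?_ _
          rw [← ENNReal.ofReal_ofNat 2, ← ENNReal.ofReal_inv_of_pos (by norm_num)]
          refine ENNReal.ofReal_le_ofReal ?_
          rwa [div_mul_div_comm, ← sq]
  have hfin : 2⁻¹ * stageVolume π q Set.univ ≠ ⊤ :=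
    ENNReal.mul_ne_top (by simp) (measure_ne_top _ _)
  refine (ENNReal.add_le_add_iff_right hfin).1 (le_trans (le_of_eq ?_) hle)
  rw [← add_mul, ENNReal.inv_two_add_inv_two, one_mul]

/-- From a balanced set with a critical band outside, a larger balanced set is reached with
probability at least one half. -/
theorem exists_balanced_succ (hG : IsClosedClass G) {k : ℕ} (hk : 1 ≤ k) {C : ℝ} (hC : 1 ≤ C) :
    ∃ C' : ℝ, 1 ≤ C' ∧ ∀ z : Stage d, z.Good G → z.BalancedOpen C k →
      2⁻¹ * stageVolume z.typ z.norm Set.univ ≤ stageVolume z.typ z.norm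
        {x | ∃ i, (Stage.step^[i] ⟨z.typ, z.norm, x⟩).Balanced C' (k + 1)} := by
  have hδ := bodyConst_pos (d := d)
  have hδ1 := bodyConst_le_one (d := d)
  set δ := bodyConst d
  -- Since `1 + 2 * R * C ≤ 3 * R * C`, the bad probability is at most `3 * (3 * C) ^ (k - 1) / (R *
  -- δ ^ 2)`, and this `R` makes the bound one half.
  obtain ⟨R, hR⟩ : ∃ R : ℝ, R = 6 * (3 * C) ^ (k - 1) / δ ^ 2 := ⟨_, rfl⟩
  have hR1 : 1 ≤ R := by
    rw [hR, le_div_iff₀ (by positivity), one_mul]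
    have h1 : δ ^ 2 ≤ 1 := pow_le_one₀ hδ.le hδ1
    have h2 : 1 ≤ (3 * C) ^ (k - 1) := one_le_pow₀ (by linarith)
    linarith
  have hRC : 1 ≤ R * C := one_le_mul_of_one_le_of_one_le hR1 hC
  have hsmall : 3 * (1 + 2 * R * C) ^ (k - 1) / R ^ k / δ ^ 2 ≤ 2⁻¹ := by
    have h1 : (1 + 2 * R * C) ^ (k - 1) ≤ (3 * C) ^ (k - 1) * R ^ (k - 1) := by
      rw [← mul_pow]
      exact pow_le_pow_left₀ (by positivity) (by linarith) _
    have h2 : R ^ k = R ^ (k - 1) * R := by rw [← pow_succ, Nat.sub_add_cancel hk]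
    have hRp : 0 < R ^ (k - 1) := by positivity
    rw [div_div, div_le_iff₀ (by positivity), h2]
    have h3 : R * δ ^ 2 = 6 * (3 * C) ^ (k - 1) := by rw [hR]; field_simp
    have h4 : 2⁻¹ * (R ^ (k - 1) * R * δ ^ 2) = 3 * ((3 * C) ^ (k - 1) * R ^ (k - 1)) := by
      rw [mul_assoc (R ^ (k - 1)), h3]; ring
    rw [h4]
    linarith
  refine ⟨4 * R * C, by linarith, ?_⟩
  rintro z hz ⟨M, hM0, hM, S, hSk, hS, hcrit⟩
  subst hSk
  by_cases hbal : z.Balanced (4 * R * C) (S.card + 1)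
  · have : {x | ∃ i, (Stage.step^[i] ⟨z.typ, z.norm, x⟩).Balanced (4 * R * C) (S.card + 1)} =
        Set.univ := Set.eq_univ_of_forall fun x => ⟨0, hbal.congr rfl rfl⟩
    rw [this]
    exact mul_le_of_le_one_left zero_le (by simp)
  have hSc : ∀ γ, γ ∉ S → C * z.hat γ < M :=
    (hz.winner_notMem hG hM0 hC hR1 hM hS hcrit (n := 0) (fun i hi => absurd hi (Nat.not_lt_zero i))
      (fun i hi => by
        obtain rfl : i = 0 := by omega
        exact hbal)).1 0 le_rfl
  have hend := fun (n : ℕ) (x : Fin d → ℝ) (hx : x ∈ z.typ.generic)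
      (h1 : ∀ i < n, ∀ α, (Stage.step^[i] ⟨z.typ, z.norm, x⟩).hat α ≤ R * M)
      (h2 : ∃ α, R * M < (Stage.step^[n] ⟨z.typ, z.norm, x⟩).hat α)
      (h3 : ∀ i ≤ n, ¬ (Stage.step^[i] ⟨z.typ, z.norm, x⟩).Balanced (4 * R * C) (S.card + 1)) =>
    bad_path hG (z := ⟨z.typ, z.norm, x⟩) ⟨hz.typ_mem, hx, hz.norm_pos⟩ hM0 hC hR1 hM hS hcrit
      h1 h2 h3
  obtain ⟨A, B, hA0, hB0, hAB, hstart, hend⟩ : ∃ A B : ℝ, 0 ≤ A ∧ 0 ≤ B ∧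
      A * B / δ ^ 2 ≤ 2⁻¹ ∧
      bodySize z.typ.1.coef (bump z.norm S (R * M)) ≤ B * bodySize z.typ.1.coef z.norm ∧
      ∀ n, ∀ x ∈ z.typ.generic, (∀ i < n, ∀ α, (Stage.step^[i] ⟨z.typ, z.norm, x⟩).hat α ≤ R * M) →
        (∃ α, R * M < (Stage.step^[n] ⟨z.typ, z.norm, x⟩).hat α) →
        (∀ i ≤ n, ¬ (Stage.step^[i] ⟨z.typ, z.norm, x⟩).Balanced (4 * R * C) (S.card + 1)) →
        bodySize (Stage.step^[n] ⟨z.typ, z.norm, x⟩).typ.1.coef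
          (Stage.step^[n] ⟨z.typ, z.norm, x⟩).norm ≤ A * bodySize
          (Stage.step^[n] ⟨z.typ, z.norm, x⟩).typ.1.coef
          (Stage.step^[n] ⟨z.typ, bump z.norm S (R * M), x⟩).norm := by
    by_cases hex : ∃ γ, γ ∉ S ∧ z.typ.1.coef γ ≠ 0
    · refine ⟨_, _, by positivity, by positivity, ?_,
        bodySize_bump_le_of_exists z.typ.isSign hz.norm_pos hR1 hC hM hM0 hS hSc hex,
        fun n x hx h1 h2 h3 => (hend n x hx h1 h2 h3).1 hex⟩
      rwa [mul_one_div]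
    · push Not at hex
      by_cases hk2 : 2 ≤ S.card
      · refine ⟨_, _, by positivity, by positivity, ?_,
          bodySize_bump_le_of_forall z.typ.isSign hz.norm_pos hR1 hM hM0 hS hex,
          fun n x hx h1 h2 h3 => ((hend n x hx h1 h2 h3).2 hex).2⟩
        have : 3 * (1 + 2 * R * C) ^ (S.card - 2) * ((1 + 2 * R * C) / R ^ S.card) =
            3 * (1 + 2 * R * C) ^ (S.card - 1) / R ^ S.card := by
          rw [show S.card - 1 = S.card - 2 + 1 by omega, pow_succ]; ring
        rwa [this]
      -- With fewer than two bands in `S` and coefficients vanishing off `S`, no bad path exists, so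
      -- the comparison holds vacuously with `A = 0`.
      · refine ⟨0, _, le_rfl, by positivity, by simp,
          bodySize_bump_le_of_forall z.typ.isSign hz.norm_pos hR1 hM hM0 hS hex,
          fun n x hx h1 h2 h3 => absurd ((hend n x hx h1 h2 h3).2 hex).1 hk2⟩
  exact hz.half_le_of_bad hG (bump_pos (by positivity) hz.norm_pos) hA0 hB0 hAB hstart hend

end Stage

end BandExchange

/-! ### Almost every orbit of stages is normal -/

namespace BandExchange

open Filter Matrix MeasureTheory
open scoped Topology ENNReal

variable {d : ℕ} [NeZero d]

namespace Stage

variable {G : Set (NonClassical d)}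

/-- Induction on `k`: a single band of maximal weight always exists, and each further band costs two
applications of `frequently_stage`, one to make a band outside the set critical and one to enlarge
the set. -/
theorem frequently_balanced (hG : IsClosedClass G) {k : ℕ} (hk : 1 ≤ k) (hkd : k ≤ d) :
    ∃ C : ℝ, 1 ≤ C ∧ ∀ π ∈ G, ∀ q : Fin d → ℝ, (∀ α, 0 < q α) →
      ∀ᵐ x ∂stageVolume π q, ∃ᶠ n in atTop, (step^[n] ⟨π, q, x⟩).Balanced C k := by
  induction k, hk using Nat.le_induction with
  | base =>
    refine ⟨1, le_rfl, fun π hπ q hq => ?_⟩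
    filter_upwards [stageVolume_mem_generic π q] with x hx
    exact Frequently.of_forall fun n =>
      (Good.iterate hG (z := ⟨π, q, x⟩) ⟨hπ, hx, hq⟩ n).balanced_one
  | succ k hk ih =>
    obtain ⟨C, hC, h⟩ := ih (by omega)
    obtain ⟨C', hC', c, hc, h'⟩ := exists_balancedOpen hG (k := k) (by omega) hC
    obtain ⟨C'', hC'', h''⟩ := exists_balanced_succ hG hk hC'
    refine ⟨C'', hC'', fun π hπ q hq => ?_⟩
    have h1 := frequently_stage hG (E := Balanced C k) (F := BalancedOpen C' k) (L := 0)
      (fun _ _ ht hn => Balanced.congr ht hn) (fun _ _ ht hn _ => BalancedOpen.congr ht hn) hc h' hπ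
      hq (h π hπ q hq)
    exact frequently_stage hG (E := BalancedOpen C' k) (F := Balanced C'' (k + 1)) (L := 0)
      (fun _ _ ht hn => BalancedOpen.congr ht hn) (fun _ _ ht hn _ => Balanced.congr ht hn)
      (c := 2⁻¹) (by simp) h'' hπ hq h1

/-- The norms depend linearly on the initial norms. -/
theorem iterate_norm_eq (π : NonClassical d) (q x : Fin d → ℝ) (n : ℕ) (α : Fin d) :
    (step^[n] ⟨π, q, x⟩).norm α =
      q ⬝ᵥ fun γ => (step^[n] ⟨π, Pi.single γ 1, x⟩).norm α := by
  induction n generalizing α with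
  | zero =>
    simp only [Function.iterate_zero, id, dotProduct, Pi.single_apply, mul_ite, mul_one, mul_zero]
    simp
  | succ n ih =>
    have key : ∀ p : Fin d → ℝ, (step^[n + 1] ⟨π, p, x⟩).norm =
        grow (step^[n] ⟨π, q, x⟩).loser (step^[n] ⟨π, q, x⟩).winner (step^[n] ⟨π, p, x⟩).norm := by
      intro p
      obtain ⟨h1, h2⟩ := iterate_congr (z := ⟨π, p, x⟩) (z' := ⟨π, q, x⟩) rfl rfl n
      have hs : (step^[n] ⟨π, p, x⟩).side = (step^[n] ⟨π, q, x⟩).side := by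
        simp only [side, h1, h2]
      rw [Function.iterate_succ_apply', ← winner_congr h1 hs, ← loser_congr h1 hs]
      rfl
    simp only [key]
    by_cases e : α = (step^[n] ⟨π, q, x⟩).loser
    · subst e
      simp only [grow_same, ih]
      rw [← dotProduct_add]; rfl
    · simp only [grow_of_ne e, ih]

/-- From every type of a sink one can reach every other one with comparable norms. -/
theorem exists_distributed {G₀ : Set (ReducedType d)} (hG : IsSink G₀) {v : ReducedType d}
    (hv : v ∈ G₀) : ∃ C : ℝ, 1 < C ∧ ∀ π : NonClassical d, π.reduced ∈ G₀ →
      ∃ x ∈ π.generic, ∃ m, ∀ q : Fin d → ℝ, (∀ α, 0 < q α) →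
        (step^[m] ⟨π, q, x⟩).typ.reduced = v ∧
        ∀ α β, (step^[m] ⟨π, q, x⟩).norm α < C * (step^[m] ⟨π, q, x⟩).norm β := by
  have hGc := hG.isClosedClass
  have key : ∀ π : NonClassical d, ∃ C : ℝ, π.reduced ∈ G₀ →
      ∃ x ∈ π.generic, ∃ m, ∀ q : Fin d → ℝ, (∀ α, 0 < q α) →
        (step^[m] ⟨π, q, x⟩).typ.reduced = v ∧
        ∀ α β, (step^[m] ⟨π, q, x⟩).norm α < C * (step^[m] ⟨π, q, x⟩).norm β := by
    intro π
    by_cases hπ : π.reduced ∈ G₀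
    swap
    · exact ⟨0, fun h => absurd h hπ⟩
    obtain ⟨x₀, hx₀⟩ := π.generic_nonempty
    have hz : Good {π : NonClassical d | π.reduced ∈ G₀} ⟨π, 1, x₀⟩ := ⟨hπ, hx₀, fun _ => one_pos⟩
    -- Starting from the unit vectors, the norms are the rows of the path matrix, so this says that
    -- the matrix eventually becomes positive.
    have hpos : ∀ γ : Fin d, ∃ k, ∀ n ≥ k, ∀ α,
        0 < (step^[n] ⟨π, Pi.single γ 1, x₀⟩).norm α := by
      intro γ
      refine hz.exists_pos hGc (v := fun n => (step^[n] ⟨π, Pi.single γ 1, x₀⟩).norm) (fun α => ?_)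
        ⟨γ, by simp⟩ fun n => ?_
      · simp only [Function.iterate_zero, id, Pi.single_apply]
        split_ifs <;> norm_num
      · obtain ⟨h1, h2⟩ := iterate_congr (z := ⟨π, Pi.single γ 1, x₀⟩) (z' := ⟨π, 1, x₀⟩) rfl rfl n
        have hs : (step^[n] ⟨π, Pi.single γ 1, x₀⟩).side = (step^[n] ⟨π, 1, x₀⟩).side := by
          simp only [side, h1, h2]
        rw [Function.iterate_succ_apply', ← winner_congr h1 hs, ← loser_congr h1 hs]
        rfl
    choose k hk using hpos
    obtain ⟨K, hK⟩ := Set.Finite.bddAbove (Set.finite_range k)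
    obtain ⟨x₁, hx₁, n, hn⟩ := exists_reach (hG.1 _ ((hz.iterate hGc K).typ_mem) v hv)
    obtain ⟨x, hx, hag, hxK⟩ := hz.exists_splice hGc K hx₁
    have hpos' : ∀ γ α, 0 < (step^[n + K] ⟨π, Pi.single γ 1, x⟩).norm α := by
      intro γ
      rw [Function.iterate_add_apply]
      refine iterate_norm_pos (fun α => ?_) n
      have hag' : Agree K ⟨π, Pi.single γ 1, x⟩ ⟨π, Pi.single γ 1, x₀⟩ := fun i hi => by
        have e : ∀ u, (step^[i] ⟨π, Pi.single γ 1, u⟩).side = (step^[i] ⟨π, 1, u⟩).side :=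
          fun u => agree_of_width (z := ⟨π, Pi.single γ 1, u⟩) (z' := ⟨π, 1, u⟩) rfl rfl (i + 1) i
            (Nat.lt_succ_self i)
        rw [e, e]
        exact hag i hi
      rw [hag'.norm_eq rfl rfl]
      exact hk γ K (hK ⟨γ, rfl⟩) α
    set b : Fin d → Fin d → ℝ := fun γ α => (step^[n + K] ⟨π, Pi.single γ 1, x⟩).norm α with hb
    -- The new norms are nonnegative combinations of the rows of one fixed positive matrix. Ratios
    -- within a row bound the ratios of the norms, whatever `q` is.
    obtain ⟨B, hB⟩ := Set.Finite.bddAbove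
      (Set.finite_range fun p : Fin d × Fin d × Fin d => b p.1 p.2.1 / b p.1 p.2.2)
    have hbB : ∀ γ α β, b γ α ≤ B * b γ β := fun γ α β => by
      rw [← div_le_iff₀ (hpos' γ β)]
      exact hB ⟨(γ, α, β), rfl⟩
    refine ⟨B + 1, fun _ => ⟨x, hx, n + K, fun q hq => ⟨?_, fun α β => ?_⟩⟩⟩
    · have h1 := (iterate_congr (z := ⟨π, q, x⟩) (z' := ⟨π, 1, x⟩) rfl rfl (n + K)).1
      rw [h1, Function.iterate_add_apply]
      have : Stage.step^[K] ⟨π, 1, x⟩ = _ := hxK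
      rw [this]
      exact hn _
    · rw [iterate_norm_eq π q x _ α, iterate_norm_eq π q x _ β, dotProduct, dotProduct,
        Finset.mul_sum]
      refine Finset.sum_lt_sum_of_nonempty Finset.univ_nonempty fun γ _ => ?_
      rw [mul_left_comm]
      refine mul_lt_mul_of_pos_left ?_ (hq γ)
      have h1 := hbB γ α β
      have h2 := hpos' γ β
      linarith
  choose C hC using key
  obtain ⟨B, hB⟩ := Set.Finite.bddAbove (Set.finite_range C)
  refine ⟨max B 2, lt_max_of_lt_right one_lt_two, fun π hπ => ?_⟩
  obtain ⟨x, hx, m, h⟩ := hC π hπ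
  refine ⟨x, hx, m, fun q hq => ⟨(h q hq).1, fun α β => ((h q hq).2 α β).trans_le ?_⟩⟩
  exact mul_le_mul_of_nonneg_right ((hB ⟨π, rfl⟩).trans (le_max_left _ _))
    (iterate_norm_pos (z := ⟨π, q, x⟩) hq m β).le

/-- The norms are `C`-comparable and the next `L` splits follow the given path. -/
def IsTarget (C : ℝ) (L : ℕ) (stage : ℕ → NonClassical d) (side' : ℕ → Side) (z : Stage d) : Prop :=
  (∀ α β, z.norm α < C * z.norm β) ∧ (∀ i ≤ L, (step^[i] z).typ.reduced = (stage i).reduced) ∧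
    ∀ i < L, (step^[i] z).side = side' i

theorem IsTarget.congr {C : ℝ} {L : ℕ} {stage : ℕ → NonClassical d} {side' : ℕ → Side}
    {z z' : Stage d} (ht : z.typ = z'.typ) (hn : z.norm = z'.norm) (ha : Agree L z z')
    (h : z.IsTarget C L stage side') : z'.IsTarget C L stage side' := by
  refine ⟨fun α β => ?_, fun i hi => ?_, fun i hi => ?_⟩
  · rw [← hn]; exact h.1 α β
  · rw [← (ha.mono hi).typ_eq ht]; exact h.2.1 i hi
  · rw [← ha i hi]; exact h.2.2 i hi

/-- In a sink, almost every orbit follows any given path infinitely often from stages with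
comparable norms. -/
theorem frequently_isTarget {G₀ : Set (ReducedType d)} (hG : IsSink G₀) {v : ReducedType d}
    (hv : v ∈ G₀) : ∃ C : ℝ, 1 < C ∧ ∀ (L : ℕ) (stage : ℕ → NonClassical d) (side' : ℕ → Side),
      (stage 0).reduced = v →
      (∀ i < L, ∃ a b, IsSplit (stage i).1 (side' i) a b (stage (i + 1)).1) →
      ∀ π : NonClassical d, π.reduced ∈ G₀ → ∀ q : Fin d → ℝ, (∀ α, 0 < q α) →
      ∀ᵐ x ∂stageVolume π q, ∃ᶠ n in atTop, (step^[n] ⟨π, q, x⟩).IsTarget C L stage side' := by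
  have hGc := hG.isClosedClass
  obtain ⟨C, hC, hreach⟩ := exists_distributed hG hv
  refine ⟨C, hC, fun L stage side' h0 hsplit π hπ q hq => ?_⟩
  -- The path that equalises the norms is spliced with the prescribed one. Only the lower bound on
  -- the probability depends on the latter; the constant `C` was fixed before.
  have hpath : ∀ π : NonClassical d, ∃ m, π.reduced ∈ G₀ → ∃ x ∈ π.generic, ∀ q : Fin d → ℝ,
      (∀ α, 0 < q α) → (step^[m] ⟨π, q, x⟩).IsTarget C L stage side' := by
    intro π
    by_cases hπ : π.reduced ∈ G₀
    swap
    · exact ⟨0, fun h => absurd h hπ⟩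
    obtain ⟨x, hx, m, h⟩ := hreach π hπ
    have hz : Good {π : NonClassical d | π.reduced ∈ G₀} ⟨π, 1, x⟩ := ⟨hπ, hx, fun _ => one_pos⟩
    obtain ⟨y, hy, hy'⟩ := exists_follow L stage side' hsplit
      (((h 1 fun _ => one_pos).1).trans h0.symm)
    obtain ⟨x', hx', hag, hxm⟩ := hz.exists_splice hGc m hy
    refine ⟨m, fun _ => ⟨x', hx', fun q hq => ?_⟩⟩
    have hag' : Agree m ⟨π, q, x'⟩ ⟨π, q, x⟩ := fun i hi => by
      have e : ∀ u, (step^[i] ⟨π, q, u⟩).side = (step^[i] ⟨π, 1, u⟩).side :=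
        fun u => agree_of_width (z := ⟨π, q, u⟩) (z' := ⟨π, 1, u⟩) rfl rfl (i + 1) i
          (Nat.lt_succ_self i)
      rw [e, e]
      exact hag i hi
    have hw : (step^[m] ⟨π, q, x'⟩).width = y :=
      (iterate_congr (z := ⟨π, q, x'⟩) (z' := ⟨π, 1, x'⟩) rfl rfl m).2.trans
        (congrArg Stage.width hxm)
    have ht : (step^[m] ⟨π, q, x'⟩).typ = (step^[m] ⟨π, 1, x⟩).typ :=
      (iterate_congr (z := ⟨π, q, x'⟩) (z' := ⟨π, 1, x'⟩) rfl rfl m).1.trans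
        (congrArg Stage.typ hxm :)
    have e : step^[m] ⟨π, q, x'⟩ = ⟨(step^[m] ⟨π, 1, x⟩).typ, (step^[m] ⟨π, q, x⟩).norm, y⟩ :=
      Stage.ext ht (hag'.norm_eq rfl rfl) hw
    rw [e]
    exact ⟨(h q hq).2, (hy' _).1, (hy' _).2⟩
  choose m hm using hpath
  obtain ⟨N, hN⟩ := Set.Finite.bddAbove (Set.finite_range m)
  obtain ⟨C₁, hC₁, hbal⟩ := frequently_balanced hGc (k := d)
    (Nat.one_le_iff_ne_zero.2 (NeZero.ne d)) le_rfl
  have h4 : ∀ n : ℕ, (1 : ℝ) ≤ 4 ^ n := fun n => one_le_pow₀ (by norm_num)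
  set N' := N + L with hN'
  have hK : 0 < (4 ^ N' * C₁) ^ N' := by positivity
  refine frequently_stage hGc (E := Balanced C₁ d) (L := L)
    (c := ENNReal.ofReal (bodyConst d / ((4 ^ N' * C₁) ^ N') ^ d))
    (fun _ _ ht hn => Balanced.congr ht hn) (fun _ _ ht hn ha => IsTarget.congr ht hn ha) ?_ ?_ hπ hq
    (hbal π hπ q hq)
  · have := bodyConst_pos (d := d)
    rw [Ne, ENNReal.ofReal_eq_zero, not_le]; positivity
  rintro z hz ⟨M, hM0, hM, S, hS, hMS⟩
  -- Balanced with `d` bands means that every band is heavy, so any loser is allowed and every path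
  -- of bounded length has probability bounded below.
  have hSu : ∀ α, α ∈ S := by
    rw [← Finset.eq_univ_iff_forall, ← Finset.card_eq_iff_eq_univ, hS, Fintype.card_fin]
  obtain ⟨x, hx, hxt⟩ := hm z.typ hz.typ_mem
  set y : Stage d := ⟨z.typ, z.norm, x⟩ with hy
  have hyg : y.Good {π : NonClassical d | π.reduced ∈ G₀} := ⟨hz.typ_mem, hx, hz.norm_pos⟩
  have hyhat : y.hat = z.hat := hat_congr rfl rfl
  rw [← hyhat] at hM hMS
  set n := m z.typ + L with hn
  have hnN : n ≤ N' := Nat.add_le_add_right (hN ⟨_, rfl⟩) L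
  refine (hyg.le_stageVolume_agree hGc (n := n) hK fun α => ?_).trans
    (measure_mono fun w hw => ?_)
  · refine (hyg.iterate_hat_le_mul hGc hC₁ hM (fun i _ => hMS _ (hSu _)) α).trans
      (mul_le_mul_of_nonneg_right ?_ (hyg.hat_pos α).le)
    have h1 : (4 : ℝ) ^ n ≤ 4 ^ N' := pow_le_pow_right₀ (by norm_num) hnN
    have h2 : 1 ≤ 4 ^ N' * C₁ := one_le_mul_of_one_le_of_one_le (h4 N') hC₁
    calc (4 ^ n * C₁) ^ n ≤ (4 ^ N' * C₁) ^ n :=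
          pow_le_pow_left₀ (by positivity) (mul_le_mul_of_nonneg_right h1 (by linarith)) n
      _ ≤ _ := pow_le_pow_right₀ h2 hnN
  · have hw' : Agree n ⟨z.typ, z.norm, w⟩ y := hw
    have hw'' := hw'.mono (Nat.le_add_right _ _ : m z.typ ≤ n)
    exact ⟨m z.typ, IsTarget.congr (hw''.typ_eq rfl).symm (hw''.norm_eq rfl rfl).symm
      hw'.iterate.symm (hxt z.norm hz.norm_pos)⟩

end Stage

end BandExchange

namespace BandExchange

open MeasureTheory Filter Matrix
open scoped ENNReal NNReal

variable {d : ℕ}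

/-! ### From the volume on a hyperplane to the volume on a slice -/

/-- The value of `c`, the sum of the coordinates, and all coordinates but two. -/
noncomputable def sliceMap (c : Fin d → ℝ) (t u : Fin d) :
    (Fin d → ℝ) →ₗ[ℝ] ℝ × ℝ × (↥({t, u}ᶜ : Finset (Fin d)) → ℝ) :=
  (dotProductBilin ℝ ℝ c).prod ((dotProductBilin ℝ ℝ 1).prod
    (LinearMap.funLeft ℝ ℝ Subtype.val))

theorem sliceMap_apply (c : Fin d → ℝ) (t u : Fin d) (x : Fin d → ℝ) :
    sliceMap c t u x = (c ⬝ᵥ x, ∑ α, x α, fun i => x i.1) := by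
  simp [sliceMap, dotProductBilin, LinearMap.funLeft, Function.comp_def, one_dotProduct]

theorem sliceMap_injective {c : Fin d → ℝ} {t u : Fin d} (ht : c t = 1) (hu : c u = -1) :
    Function.Injective (sliceMap c t u) := by
  have htu : t ≠ u := by rintro rfl; rw [ht] at hu; norm_num at hu
  rw [← LinearMap.ker_eq_bot, LinearMap.ker_eq_bot']
  intro x hx
  rw [sliceMap_apply, Prod.mk_eq_zero, Prod.mk_eq_zero] at hx
  obtain ⟨h1, h2, h3⟩ := hx
  have h0 : ∀ α, α ∉ ({t, u} : Finset (Fin d)) → x α = 0 := fun α hα =>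
    congrFun h3 ⟨α, Finset.mem_compl.2 hα⟩
  have e1 : c ⬝ᵥ x = c t * x t + c u * x u := by
    rw [dotProduct, ← Finset.sum_subset (Finset.subset_univ {t, u})
      (fun α _ hα => by rw [h0 α hα, mul_zero]), Finset.sum_pair htu]
  rw [← Finset.sum_subset (Finset.subset_univ {t, u}) (fun α _ hα => h0 α hα),
    Finset.sum_pair htu] at h2
  rw [e1, ht, hu] at h1
  funext α
  by_cases hα : α ∈ ({t, u} : Finset (Fin d))
  · rw [Finset.mem_insert, Finset.mem_singleton] at hα
    rcases hα with rfl | rfl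
    · simp only [Pi.zero_apply]; linarith
    · simp only [Pi.zero_apply]; linarith
  · exact h0 α hα

theorem card_compl_pair {t u : Fin d} (htu : t ≠ u) :
    Fintype.card ↥({t, u}ᶜ : Finset (Fin d)) + 2 = d := by
  rw [Fintype.card_coe, ← Finset.card_pair htu, Finset.card_compl_add_card, Fintype.card_fin]

/-- The coordinates `sliceMap` as a linear homeomorphism. -/
noncomputable def sliceEquiv (c : Fin d → ℝ) (t u : Fin d) (ht : c t = 1) (hu : c u = -1) :
    (Fin d → ℝ) ≃L[ℝ] ℝ × ℝ × (↥({t, u}ᶜ : Finset (Fin d)) → ℝ) :=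
  (LinearEquiv.ofInjectiveOfFinrankEq (sliceMap c t u) (sliceMap_injective ht hu) (by
    have htu : t ≠ u := by rintro rfl; rw [ht] at hu; norm_num at hu
    rw [Module.finrank_prod, Module.finrank_prod, Module.finrank_self,
      Module.finrank_fintype_fun_eq_card, Module.finrank_fintype_fun_eq_card, Fintype.card_fin]
    have := card_compl_pair htu
    omega)).toContinuousLinearEquiv

theorem sliceEquiv_apply (c : Fin d → ℝ) (t u : Fin d) (ht : c t = 1) (hu : c u = -1)
    (x : Fin d → ℝ) : sliceEquiv c t u ht hu x = (c ⬝ᵥ x, ∑ α, x α, fun i => x i.1) :=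
  sliceMap_apply c t u x

/-- Fubini in the coordinates of `sliceEquiv`: almost every level of the coordinate sum is null, so
some level in the unit interval is. For cones one level suffices. -/
theorem exists_slice_null {c : Fin d → ℝ} {t u : Fin d} (ht : c t = 1) (hu : c u = -1)
    {B : Set (Fin d → ℝ)} (hB : hyperVolume c B = 0) :
    ∃ s ∈ Set.Ioo (0 : ℝ) 1, volume {w | (sliceEquiv c t u ht hu).symm (0, s, w) ∈ B} = 0 := by
  have htu : t ≠ u := by rintro rfl; rw [ht] at hu; norm_num at hu
  set e := sliceEquiv c t u ht hu with he
  -- Here `c ⬝ᵥ v = 1`, and the coordinate sum and the remaining coordinates of `v` vanish. In slice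
  -- coordinates the projection along `v` just sets the first coordinate to zero.
  set v : Fin d → ℝ := (1 / 2 : ℝ) • (Pi.single t 1 - Pi.single u 1) with hv
  have hcv : c ⬝ᵥ v = 1 := by
    rw [hv, dotProduct_smul, dotProduct_sub, dotProduct_single, dotProduct_single, ht, hu,
      smul_eq_mul]
    norm_num
  have hev : e v = (1, 0, 0) := by
    rw [he, sliceEquiv_apply, hcv]
    refine Prod.ext rfl (Prod.ext ?_ ?_)
    · simp [hv, ← Finset.mul_sum, Finset.sum_sub_distrib]
    · funext i
      have := i.2
      rw [Finset.mem_compl, Finset.mem_insert, Finset.mem_singleton, not_or] at this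
      simp [hv, Pi.single_eq_of_ne this.1, Pi.single_eq_of_ne this.2]
  rw [hyperVolume_eq hcv] at hB
  have h1 : volume ({x | c ⬝ᵥ x ∈ Set.Icc (0 : ℝ) 1} ∩ {x | hyperProj c v x ∈ B}) = 0 := by
    rw [Set.inter_comm]
    exact le_antisymm (((Measure.le_restrict_apply _ _).trans
      (Measure.le_map_apply (measurable_hyperProj c v).aemeasurable _)).trans hB.le) (zero_le)
  have hac : (volume : Measure (ℝ × ℝ × (↥({t, u}ᶜ : Finset (Fin d)) → ℝ))) ≪
      Measure.map e volume := by
    have := e.isAddHaarMeasure_map (volume : Measure (Fin d → ℝ))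
    have : (volume : Measure (ℝ × (↥({t, u}ᶜ : Finset (Fin d)) → ℝ))).IsAddHaarMeasure :=
      Measure.prod.instIsAddHaarMeasure _ _
    have : (volume : Measure (ℝ × ℝ × (↥({t, u}ᶜ : Finset (Fin d)) → ℝ))).IsAddHaarMeasure :=
      Measure.prod.instIsAddHaarMeasure _ _
    exact Measure.absolutelyContinuous_isAddHaarMeasure _ _
  have h2 : volume {p : ℝ × ℝ × (↥({t, u}ᶜ : Finset (Fin d)) → ℝ) |
      p.1 ∈ Set.Icc (0 : ℝ) 1 ∧ e.symm (0, p.2) ∈ B} = 0 := by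
    apply hac
    refine (e.toHomeomorph.toMeasurableEquiv.map_apply _).trans ?_
    refine measure_mono_null (fun x hx => ?_) h1
    have hx' : (e x).1 ∈ Set.Icc (0 : ℝ) 1 ∧ e.symm (0, (e x).2) ∈ B := hx
    have hex : e x = (c ⬝ᵥ x, (e x).2) := by rw [he, sliceEquiv_apply]
    refine ⟨by rw [hex] at hx'; exact hx'.1, ?_⟩
    have : hyperProj c v x = e.symm (0, (e x).2) := by
      rw [ContinuousLinearEquiv.eq_symm_apply, hyperProj, map_sub, map_smul, hev]
      refine Prod.ext ?_ ?_
      · rw [hex]; simp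
      · simp
    simp only [Set.mem_ofPred_eq]
    rw [this]; exact hx'.2
  have h3 : ∀ᵐ r : ℝ, volume {p : ℝ × (↥({t, u}ᶜ : Finset (Fin d)) → ℝ) |
      r ∈ Set.Icc (0 : ℝ) 1 ∧ e.symm (0, p) ∈ B} = 0 :=
    Measure.measure_ae_null_of_prod_null h2
  have pick : ∀ {P : ℝ → Prop}, (∀ᵐ s : ℝ, P s) → ∃ s ∈ Set.Ioo (0 : ℝ) 1, P s := by
    intro P hP
    by_contra! hcon
    have : volume (Set.Ioo (0 : ℝ) 1) = 0 := measure_mono_null (fun s hs => hcon s hs) hP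
    simp at this
  obtain ⟨r, hr, hr'⟩ := pick h3
  have h4 : volume {p : ℝ × (↥({t, u}ᶜ : Finset (Fin d)) → ℝ) | e.symm (0, p) ∈ B} = 0 :=
    by
    refine measure_mono_null (fun p hp => ?_) hr'
    exact ⟨⟨hr.1.le, hr.2.le⟩, hp⟩
  exact pick (Measure.measure_ae_null_of_prod_null h4)

theorem NonClassical.measurableSet_configSpace (π : NonClassical d) :
    MeasurableSet π.configSpace := by
  have : π.configSpace = (⋂ α, {x | 0 ≤ x α}) ∩
      ({x | ∑ α, x α = 1} ∩ {x | π.1.coef ⬝ᵥ (fun α => x α) = 0}) := by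
    ext x; simp [NonClassical.configSpace, Pattern.switchCondition_iff]
  rw [this]
  refine (MeasurableSet.iInter fun α => measurableSet_le measurable_const (by fun_prop)).inter
    ((measurableSet_eq_fun (by fun_prop) measurable_const).inter
      (measurableSet_eq_fun (by unfold dotProduct; fun_prop) measurable_const))

theorem exists_lipschitz_slice {ι : Type*} [Fintype ι] (e : (ℝ × ℝ × (ι → ℝ)) ≃L[ℝ] (Fin d → ℝ))
    (s : ℝ) : ∃ f : (ι → ℝ) → EuclideanSpace ℝ (Fin d), ∃ K, LipschitzWith K f ∧
      ∀ w, f w = WithLp.toLp 2 (s⁻¹ • e (0, s, w)) := by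
  let g : (Fin d → ℝ) →L[ℝ] EuclideanSpace ℝ (Fin d) := (EuclideanSpace.equiv (Fin d) ℝ).symm
  have h1 := (s⁻¹ • g).lipschitz
  have h2 := (e : (ℝ × ℝ × (ι → ℝ)) →L[ℝ] (Fin d → ℝ)).lipschitz
  have h3 := (LipschitzWith.prodMk_left (α := ℝ) (β := ℝ × (ι → ℝ)) 0).comp
    (LipschitzWith.prodMk_left (α := ℝ) (β := ι → ℝ) s)
  exact ⟨_, _, (h1.comp h2).comp h3, fun w => rfl⟩

/-- A cone that is null for the volume on the hyperplane of the switch condition meets the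
configuration space in a null set. -/
theorem NonClassical.ae_volume_of_cone [NeZero d] (π : NonClassical d) {B : Set (Fin d → ℝ)}
    (hB : hyperVolume π.1.coef {x | x ∈ B ∧ ∑ α, x α ≤ 1} = 0)
    (hscale : ∀ x ∈ B, ∀ s : ℝ, 0 < s → s • x ∈ B) :
    ∀ᵐ x ∂π.volume, (fun α => x α) ∉ B := by
  obtain ⟨⟨t, ht⟩, ⟨u, hu⟩⟩ := π.exists_coef
  have htu : t ≠ u := by rintro rfl; rw [ht] at hu; norm_num at hu
  obtain ⟨s, hs, hs'⟩ := exists_slice_null ht hu hB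
  set e := sliceEquiv π.1.coef t u ht hu with he
  set N := {w | e.symm (0, s, w) ∈ {x | x ∈ B ∧ ∑ α, x α ≤ 1}} with hN
  obtain ⟨f, K, hK, hf⟩ : ∃ f : (↥({t, u}ᶜ : Finset (Fin d)) → ℝ) → EuclideanSpace ℝ (Fin d),
      ∃ K, LipschitzWith K f ∧ ∀ w, f w = WithLp.toLp 2 (s⁻¹ • e.symm (0, s, w)) :=
    exists_lipschitz_slice e.symm s
  have hcard : ((d : ℝ) - 2) = (Fintype.card ↥({t, u}ᶜ : Finset (Fin d)) : ℝ) := by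
    have := card_compl_pair htu
    have h : ((Fintype.card ↥({t, u}ᶜ : Finset (Fin d)) + 2 : ℕ) : ℝ) = d := by rw [this]
    push_cast at h ⊢
    linarith
  rw [ae_iff, NonClassical.volume, Measure.restrict_apply' π.measurableSet_configSpace, hcard]
  -- The null slice at level `s` is rescaled to level one by a Lipschitz map. In dimension `d - 2`
  -- Hausdorff measure on the parameter space is Lebesgue measure, so the image stays null.
  have h0 := hK.hausdorffMeasure_image_le
    (Nat.cast_nonneg (Fintype.card ↥({t, u}ᶜ : Finset (Fin d)))) N
  rw [hausdorffMeasure_pi_real, hs', mul_zero] at h0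
  refine measure_mono_null (fun x hx => ?_) (le_antisymm h0 (zero_le))
  obtain ⟨hxB, -, hsum, hsw⟩ := hx
  rw [Set.mem_ofPred_eq, not_not] at hxB
  set y : Fin d → ℝ := fun α => x α with hy
  have hey : e (s • y) = (0, s, fun i => s * y i.1) := by
    rw [he, sliceEquiv_apply, dotProduct_smul, (Pattern.switchCondition_iff _ _).1 hsw, smul_zero]
    refine Prod.ext rfl (Prod.ext ?_ rfl)
    show ∑ α, s * y α = s
    rw [← Finset.mul_sum, hsum, mul_one]
  have hey' : e.symm (0, s, fun i => s * y i.1) = s • y := by rw [← hey, e.symm_apply_apply]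
  refine ⟨fun i => s * y i.1, ?_, ?_⟩
  · rw [hN, Set.mem_ofPred_eq, hey']
    refine ⟨hscale y hxB s hs.1, ?_⟩
    show ∑ α, s * y α ≤ 1
    rw [← Finset.mul_sum, hsum, mul_one]; exact hs.2.le
  · rw [hf, hey', inv_smul_smul₀ hs.1.ne']

end BandExchange

namespace BandExchange

open MeasureTheory Filter Matrix
open scoped ENNReal

variable {d : ℕ}

/-! ### The expansion of a point and its orbit -/

theorem shrink_smul (α β : Fin d) (s : ℝ) (x : Fin d → ℝ) :
    shrink α β (s • x) = s • shrink α β x := by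
  ext γ
  by_cases h : γ = α
  · subst h; simp [shrink, mul_sub]
  · simp [shrink, h]

theorem smul_mem_generic {π : NonClassical d} {x : Fin d → ℝ} (hx : x ∈ π.generic) {s : ℝ}
    (hs : 0 < s) : s • x ∈ π.generic :=
  ⟨fun α => mul_pos hs (hx.1 α), by rw [dotProduct_smul, hx.2.1, smul_zero], fun g hg =>
    hx.2.2 g (by
      rw [dotProduct_smul, smul_eq_mul] at hg
      exact (mul_eq_zero.1 hg).resolve_left hs.ne')⟩

theorem Expansion.matrix_nonneg {π : NonClassical d} {x : EuclideanSpace ℝ (Fin d)}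
    (e : Expansion π x) (n : ℕ) (α β : Fin d) : 0 ≤ e.matrix n α β := by
  induction n generalizing α β with
  | zero =>
    rw [Expansion.matrix, one_apply]
    split_ifs <;> norm_num
  | succ n ih =>
    rw [Expansion.matrix, mul_apply]
    refine Finset.sum_nonneg fun γ _ => mul_nonneg (ih α γ) ?_
    rw [splitMatrix, Matrix.add_apply, one_apply, single_apply]
    split_ifs <;> norm_num

variable [NeZero d]

theorem NonClassical.sideOf_smul (π : NonClassical d) (x : Fin d → ℝ) {s : ℝ} (hs : 0 < s) :
    π.sideOf (s • x) = π.sideOf x := by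
  simp only [NonClassical.sideOf, Pi.smul_apply, smul_eq_mul, mul_lt_mul_iff_right₀ hs]

namespace Stage

theorem iterate_smul (z : Stage d) {s : ℝ} (hs : 0 < s) (n : ℕ) :
    step^[n] ⟨z.typ, z.norm, s • z.width⟩ =
      ⟨(step^[n] z).typ, (step^[n] z).norm, s • (step^[n] z).width⟩ := by
  induction n with
  | zero => rfl
  | succ n ih =>
    rw [Function.iterate_succ_apply', Function.iterate_succ_apply', ih]
    simp only [step, winner, loser, side, NonClassical.sideOf_smul _ _ hs, shrink_smul]

theorem agree_smul (z : Stage d) {s : ℝ} (hs : 0 < s) (n : ℕ) :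
    Agree n z ⟨z.typ, z.norm, s • z.width⟩ := fun i _ => by
  rw [iterate_smul z hs]
  exact (NonClassical.sideOf_smul _ _ hs).symm

/-- The norms of the columns are balanced and `j` follows immediately, infinitely often. -/
def IsNormal (C : ℝ) (π : NonClassical d) (x : Fin d → ℝ) : Prop :=
  ∀ j : SplittingSequence π,
    ∃ᶠ n in atTop, (step^[n] ⟨π, 1, x⟩).IsTarget C j.length j.stage j.side

theorem IsNormal.smul {C : ℝ} {π : NonClassical d} {x : Fin d → ℝ} (h : IsNormal C π x) {s : ℝ}
    (hs : 0 < s) : IsNormal C π (s • x) := fun j => (h j).mono fun n hn => by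
  have ha := agree_smul ⟨π, 1, x⟩ hs (n + j.length)
  have ha' := ha.mono (Nat.le_add_right n j.length)
  exact hn.congr (ha'.typ_eq rfl) (ha'.norm_eq rfl rfl) ha.iterate

/-- A splitting sequence carries irrelevant values beyond its length. Recording only its first
`length + 1` entries leaves countably many possibilities, so the exceptional sets may be united. -/
theorem ae_isNormal {C : ℝ} {π : NonClassical d}
    (h : ∀ (L : ℕ) (stage : ℕ → NonClassical d) (side' : ℕ → Side),
      (stage 0).reduced = π.reduced →
      (∀ i < L, ∃ a b, IsSplit (stage i).1 (side' i) a b (stage (i + 1)).1) →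
      ∀ᵐ x ∂stageVolume π 1, ∃ᶠ n in atTop, (step^[n] ⟨π, 1, x⟩).IsTarget C L stage side') :
    ∀ᵐ x ∂stageVolume π 1, IsNormal C π x := by
  have key : ∀ᵐ x ∂stageVolume π 1, ∀ (L : ℕ) (st : Fin (L + 1) → NonClassical d × Side),
      (st 0).1.reduced = π.reduced →
      (∀ i < L, ∃ a b, IsSplit (st (Fin.ofNat (L + 1) i)).1.1 (st (Fin.ofNat (L + 1) i)).2 a b
        (st (Fin.ofNat (L + 1) (i + 1))).1.1) →
      ∃ᶠ n in atTop, (step^[n] ⟨π, 1, x⟩).IsTarget C L (fun i => (st (Fin.ofNat (L + 1) i)).1)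
        fun i => (st (Fin.ofNat (L + 1) i)).2 := by
    simp only [ae_all_iff]
    exact fun L st h0 h1 => h L (fun i => (st (Fin.ofNat (L + 1) i)).1)
      (fun i => (st (Fin.ofNat (L + 1) i)).2) h0 h1
  filter_upwards [key] with x hx j
  have hv : ∀ i ≤ j.length, (Fin.ofNat (j.length + 1) i : ℕ) = i := fun i hi =>
    Nat.mod_eq_of_lt (Nat.lt_succ_of_le hi)
  refine (hx j.length (fun k => (j.stage k, j.side k)) (by simp [j.stage_zero]) fun i hi => ?_).mono
    fun n hn => ⟨hn.1, fun i hi => ?_, fun i hi => ?_⟩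
  · simp only [hv i hi.le, hv (i + 1) hi]
    exact j.isSplit i hi
  · have := hn.2.1 i hi
    simpa only [hv i hi] using this
  · have := hn.2.2 i hi
    simpa only [hv i hi.le] using this

end Stage

/-- Genericity and normality are invariant under scaling, so the nonnegative vectors lacking one of
them form a cone, and with all norms one the truncation is by the coordinate sum. -/
theorem NonClassical.ae_generic_isNormal {π : NonClassical d} {C : ℝ}
    (h : ∀ᵐ x ∂stageVolume π 1, Stage.IsNormal C π x) :
    ∀ᵐ x ∂π.volume, (fun α => x α) ∈ π.generic ∧ Stage.IsNormal C π fun α => x α := by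
  set B : Set (Fin d → ℝ) :=
    {x | (∀ α, 0 ≤ x α) ∧ ¬ (x ∈ π.generic ∧ Stage.IsNormal C π x)} with hB
  have hnull : hyperVolume π.1.coef {x | x ∈ B ∧ ∑ α, x α ≤ 1} = 0 := by
    rw [ae_iff, stageVolume_apply] at h
    refine measure_mono_null (fun x hx => ?_)
      (measure_union_null (hyperVolume_not_generic (π := π)) h)
    by_cases hg : x ∈ π.generic
    · refine Or.inr ⟨fun hn => hx.1.2 ⟨hg, hn⟩, hg, ?_⟩
      rw [Set.mem_ofPred_eq, one_dotProduct]; exact hx.2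
    · exact Or.inl ⟨hx.1.1, hg⟩
  have hmem : ∀ᵐ x ∂π.volume, x ∈ π.configSpace := ae_restrict_mem π.measurableSet_configSpace
  have hcone : ∀ x ∈ B, ∀ s : ℝ, 0 < s → s • x ∈ B := fun x hx s hs => by
    refine ⟨fun α => mul_nonneg hs.le (hx.1 α), fun hn => hx.2 ?_⟩
    have e : s⁻¹ • s • x = x := inv_smul_smul₀ hs.ne' x
    exact ⟨e ▸ smul_mem_generic hn.1 (inv_pos.2 hs), e ▸ hn.2.smul (inv_pos.2 hs)⟩
  filter_upwards [hmem, π.ae_volume_of_cone hnull hcone] with x hx hxB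
  by_contra hcon
  exact hxB ⟨hx.1, hcon⟩

namespace Expansion

variable {π : NonClassical d} {x : EuclideanSpace ℝ (Fin d)} (e : Expansion π x)

theorem side_eq (n : ℕ) : e.side n = (e.stage n).sideOf (e.width n) ∧
    (e.winner n).1 = (e.stage n).win (e.side n) ∧
    (e.loser n).1 = (e.stage n).win (e.side n).opp ∧
    e.stage (n + 1) = (e.stage n).next (e.side n) := by
  obtain ⟨-, h1, h2, h3⟩ := NonClassical.Valid.of_isSplit (e.isSplit n)
  have h := e.loser_lt_winner n
  rw [h1, h2] at h
  exact ⟨(NonClassical.sideOf_eq _ h).symm, by rw [h1]; rfl, by rw [h2]; rfl, h3⟩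

/-- The strict inequality between the critical widths determines each split, so an expansion is
unique and agrees with the orbit of stages. -/
theorem eq_iterate (n : ℕ) : e.stage n = (Stage.step^[n] ⟨π, 1, fun α => x α⟩).typ ∧
    e.width n = (Stage.step^[n] ⟨π, 1, fun α => x α⟩).width := by
  induction n with
  | zero => exact ⟨e.stage_zero, funext e.width_zero⟩
  | succ n ih =>
    obtain ⟨h1, h2, h3, h4⟩ := e.side_eq n
    have h5 := e.width_eq n
    rw [splitMatrix_mulVec, h2, h3] at h5
    have h6 : e.width (n + 1) = shrink ((e.stage n).win (e.side n))
        ((e.stage n).win (e.side n).opp) (e.width n) := by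
      rw [h5, shrink_grow (NonClassical.win_ne _ _)]
    rw [Function.iterate_succ_apply', h4, h6, h1, ih.1, ih.2]
    exact ⟨rfl, rfl⟩

theorem side_eq_iterate (n : ℕ) :
    e.side n = (Stage.step^[n] ⟨π, 1, fun α => x α⟩).side := by
  rw [(e.side_eq n).1, (e.eq_iterate n).1, (e.eq_iterate n).2]; rfl

/-- This identifies the abstract norms started at the all-ones vector with the column sums of `Q_n`,
and hence with the norms of its columns, as the entries are nonnegative. -/
theorem one_vecMul_matrix (n : ℕ) :
    (1 : Fin d → ℝ) ᵥ* e.matrix n = (Stage.step^[n] ⟨π, 1, fun α => x α⟩).norm := by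
  induction n with
  | zero => exact vecMul_one _
  | succ n ih =>
    rw [matrix, ← vecMul_vecMul, ih, vecMul_splitMatrix, Function.iterate_succ_apply',
      (e.side_eq n).2.1, (e.side_eq n).2.2.1, e.side_eq_iterate n, (e.eq_iterate n).1]
    rfl

theorem oneNorm_col_matrix (n : ℕ) (α : Fin d) :
    oneNorm ((e.matrix n).col α) = (Stage.step^[n] ⟨π, 1, fun α => x α⟩).norm α := by
  rw [← e.one_vecMul_matrix n, vecMul, one_dotProduct]
  exact Finset.sum_congr rfl fun β _ => abs_of_nonneg (e.matrix_nonneg n β α)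

theorem stageDistributed_and_followedBy {C : ℝ} (hC : 0 < C) {n : ℕ} {j : SplittingSequence π}
    (h : (Stage.step^[n] ⟨π, 1, fun α => x α⟩).IsTarget C j.length j.stage j.side) :
    e.StageDistributed C n ∧ e.FollowedBy n j := by
  have hpos := Stage.iterate_norm_pos (z := ⟨π, 1, fun α => x α⟩) (fun _ => one_pos) n
  refine ⟨fun α β => ?_, fun i hi => ?_, fun i hi => ?_⟩
  · simp only [oneNorm_col_matrix]
    refine ⟨?_, (div_lt_iff₀ (hpos β)).2 (h.1 α β)⟩
    rw [div_lt_div_iff₀ hC (hpos β), one_mul, mul_comm]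
    exact h.1 β α
  · rw [(e.eq_iterate _).1, add_comm, Function.iterate_add_apply]
    exact h.2.1 i hi
  · rw [e.side_eq_iterate, add_comm, Function.iterate_add_apply]
    exact h.2.2 i hi

theorem nonempty_of_generic {G : Set (NonClassical d)} (hG : IsClosedClass G) (hπ : π ∈ G)
    (hx : (fun α => x α) ∈ π.generic) : Nonempty (Expansion π x) := by
  have hz : Stage.Good G ⟨π, 1, fun α => x α⟩ := ⟨hπ, hx, fun _ => one_pos⟩
  set z := fun n => Stage.step^[n] (⟨π, 1, fun α => x α⟩ : Stage d) with hzn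
  have hs : ∀ n, z (n + 1) = (z n).step := fun n => Function.iterate_succ_apply' _ _ _
  exact ⟨{
    stage := fun n => (z n).typ
    side := fun n => (z n).side
    winner := fun n => (z n).typ.1.crit (z n).side
    loser := fun n => (z n).typ.1.crit (z n).side.opp
    width := fun n => (z n).width
    stage_zero := rfl
    width_zero := fun _ => rfl
    isSplit := fun n => by
      rw [hs]; exact ((hz.iterate hG n).valid hG).isSplit
    loser_lt_winner := fun n => (hz.iterate hG n).loser_lt_winner hG
    width_eq := fun n => by
      rw [hs, splitMatrix_mulVec]
      exact (grow_shrink (z n).winner_ne_loser _).symm }⟩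

end Expansion

theorem IsSink.ae_infinite {G₀ : Set (ReducedType d)} (hG : IsSink G₀) {v : ReducedType d}
    (hv : v ∈ G₀) : ∃ C : ℝ, 1 < C ∧ ∀ C' : ℝ, C ≤ C' → ∀ π : NonClassical d, π.reduced = v →
      ∀ᵐ x ∂π.volume, Nonempty (Expansion π x) ∧ ∀ (e : Expansion π x) (j : SplittingSequence π),
        {n : ℕ | e.StageDistributed C' n ∧ e.FollowedBy n j}.Infinite := by
  obtain ⟨C, hC, h⟩ := Stage.frequently_isTarget hG hv
  refine ⟨C, hC, fun C' hC' π hπ => ?_⟩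
  have hπG : π.reduced ∈ G₀ := hπ ▸ hv
  filter_upwards [NonClassical.ae_generic_isNormal (Stage.ae_isNormal fun L stage side' h0 h1 =>
    h L stage side' (h0.trans hπ) h1 π hπG 1 fun _ => one_pos)] with x hx
  refine ⟨Expansion.nonempty_of_generic hG.isClosedClass hπG hx.1, fun e j => ?_⟩
  rw [← Nat.frequently_atTop_iff_infinite]
  refine (hx.2 j).mono fun n hn =>
    e.stageDistributed_and_followedBy (zero_lt_one.trans (hC.trans_le hC')) ⟨fun α β => ?_, hn.2⟩
  exact (hn.1 α β).trans_le (mul_le_mul_of_nonneg_right hC'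
    (Stage.iterate_norm_pos (z := ⟨π, 1, fun α => x α⟩) (fun _ => one_pos) n β).le)

end BandExchange

theorem mainTheorem3 (d : ℕ) :
    ∃ C : ℝ, 1 < C ∧
      ∀ (π₀ : BandExchange.NonClassical d) (G₀ : Set (BandExchange.ReducedType d)),
        BandExchange.IsSink G₀ → π₀.reduced ∈ G₀ →
        ∀ᵐ x ∂π₀.volume,
          Nonempty (BandExchange.Expansion π₀ x) ∧
            ∀ (e : BandExchange.Expansion π₀ x) (j : BandExchange.SplittingSequence π₀),
              {n : ℕ | e.StageDistributed C n ∧ e.FollowedBy n j}.Infinite := by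
  rcases Nat.eq_zero_or_pos d with rfl | hd
  -- Without bands there is no arrow, so no vertex lies in a sink.
  · refine ⟨2, one_lt_two, fun π₀ G₀ hG hπ => ?_⟩
    have : ∀ v v' : BandExchange.ReducedType 0, ¬ BandExchange.Arrow v v' :=
      fun _ _ ⟨_, _, _, a, _⟩ => a.1.elim0
    cases hG.1 _ hπ _ hπ with
    | single h => exact absurd h (this _ _)
    | tail _ h => exact absurd h (this _ _)
  have : NeZero d := ⟨hd.ne'⟩
  -- There are finitely many sinks and vertices for given `d`, and the conclusion persists when the
  -- constant is enlarged, so one constant serves all.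
  have key : ∀ p : Set (BandExchange.ReducedType d) × BandExchange.ReducedType d, ∃ C : ℝ,
      BandExchange.IsSink p.1 → p.2 ∈ p.1 → ∀ C' : ℝ, C ≤ C' →
      ∀ π : BandExchange.NonClassical d, π.reduced = p.2 →
      ∀ᵐ x ∂π.volume, Nonempty (BandExchange.Expansion π x) ∧
        ∀ (e : BandExchange.Expansion π x) (j : BandExchange.SplittingSequence π),
        {n : ℕ | e.StageDistributed C' n ∧ e.FollowedBy n j}.Infinite := by
    intro p
    by_cases hG : BandExchange.IsSink p.1
    · by_cases hv : p.2 ∈ p.1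
      · obtain ⟨C, -, h⟩ := hG.ae_infinite hv
        exact ⟨C, fun _ _ => h⟩
      · exact ⟨0, fun _ h => absurd h hv⟩
    · exact ⟨0, fun h => absurd h hG⟩
  choose C hC using key
  obtain ⟨M, hM⟩ := Set.Finite.bddAbove (Set.finite_range C)
  exact ⟨max M 2, one_lt_two.trans_le (le_max_right _ _), fun π₀ G₀ hG hπ =>
    hC (G₀, π₀.reduced) hG hπ _ ((hM ⟨_, rfl⟩).trans (le_max_left _ _)) π₀ rfl⟩
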